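/- Let $\zeta\in\mathbb{C}$ with $|\zeta|=1$ and $\Re\zeta^2>0$, and let $U:\mathbb{R}\to\mathbb{C}$ satisfy, for some constants $C,c>0$ and $\gamma>1$: U1) $U$ is smooth and $U(0)=U'(0)=0$; U2) $\zeta^2U''(0)$ is real and positive; U3) $\Re U(x)\ge \frac1C\min(1,|x|^2)$ for all $x\in\mathbb{R}$; U4) $U$ has an analytic extension to the strip $|\Im z|\le c$ such that $|U'(z)|\le C\,(\max(1,\Re U(z)))^\gamma$ for all $z$ in this strip. For $W>0$ let $K$ be the integral operator on $L_2(\mathbb{R})$ with kernel $$K(x,y)=\exp\left\{-W^2\zeta^2(x-y)^2-\tfrac12U(x)-\tfrac12U(y)\right\},$$ and put $$\alpha=W\sqrt{\zeta^2U''(0)/2}>0,\qquad \mu=\sqrt{\frac{\pi}{W^2\zeta^2+\alpha}}\ \text{ (principal branch)},\qquad g_\alpha(x)=\left(\frac{2\alpha}{\pi}\right)^{1/4}e^{-\alpha x^2}.$$ Let $P$ be the orthogonal projection of $L_2(\mathbb{R})$ onto $(\mathbb{C}g_\alpha)^\perp$, let $\hat K=\mu^{-1}K$, and let $$A=(1-P)\hat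 K(1-P),\quad B=(1-P)\hat KP,\quad C_{\mathrm{bl}}=P\hat K(1-P),\quad D=P\hat KP$$ be the blocks of $\hat K$ with respect to $L_2(\mathbb{R})=\mathbb{C}g_\alpha\oplus(\mathbb{C}g_\alpha)^\perp$. Then there are $\delta>0$ depending only on $\gamma$, and $M,W_0>0$ depending only on $\gamma,C,c$, such that for every $W\ge W_0$ the operator $K$ is well defined and bounded on $L_2(\mathbb{R})$, and $$\|A-(1-P)\|\le MW^{-1-\delta},\qquad \|B\|\le MW^{-1-\delta},\qquad \|C_{\mathrm{bl}}\|\le MW^{-1-\delta},$$ $$\|D\|\le 1-\sqrt{\frac{|U''(0)|}{2}}\,\frac{\Re\zeta^2}{W}+MW^{-1-\delta}.$$ -/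

import Mathlib

open MeasureTheory

open scoped ContDiff InnerProductSpace

noncomputable section

/-- The complex Hilbert space `L₂(ℝ)` (Lebesgue measure). -/
abbrev L2R : Type := Lp ℂ 2 (volume : Measure ℝ)

/-- The standing assumptions U1)--U4) on the potential `U : ℝ → ℂ`, relative to the rotation
`ζ`, with quantitative constants `C` (lower bound and growth), `c` (half-width of the strip) and
`γ` (growth exponent). -/
structure SaddlePotential (ζ : ℂ) (C c γ : ℝ) (U : ℝ → ℂ) : Prop where
  /-- U1: smoothness and the critical point at the origin. -/
  smooth : ContDiff ℝ ∞ U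
  map_zero : U 0 = 0
  deriv_zero : deriv U 0 = 0
  /-- U2: the complex number `ζ² U''(0)` is real and positive. -/
  rotated_im : (ζ ^ 2 * iteratedDeriv 2 U 0).im = 0
  rotated_pos : 0 < (ζ ^ 2 * iteratedDeriv 2 U 0).re
  /-- U3: quantitative lower bound on the real part. -/
  lower : ∀ x : ℝ, 1 / C * min 1 (|x| ^ 2) ≤ (U x).re
  /-- U4: analytic extension to a closed strip, with growth control of the derivative. -/
  extension : ∃ F : ℂ → ℂ,
    AnalyticOnNhd ℂ F {z : ℂ | |z.im| ≤ c} ∧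
    (∀ x : ℝ, F (x : ℂ) = U x) ∧
    ∀ z : ℂ, |z.im| ≤ c → ‖deriv F z‖ ≤ C * (max 1 (F z).re) ^ γ

/-- The kernel `K(x, y) = exp(-W² ζ² (x - y)² - U(x)/2 - U(y)/2)`. -/
def transferKernel (W : ℝ) (ζ : ℂ) (U : ℝ → ℂ) (x y : ℝ) : ℂ :=
  Complex.exp (-((W : ℂ) ^ 2 * ζ ^ 2 * ((x : ℂ) - (y : ℂ)) ^ 2) - U x / 2 - U y / 2)

/-- `K` is the bounded operator on `L₂(ℝ)` with integral kernel `k`. The formula determines `K`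
uniquely. -/
def IsIntegralOperator (k : ℝ → ℝ → ℂ) (K : L2R →L[ℂ] L2R) : Prop :=
  ∀ f : L2R,
    (∀ᵐ x : ℝ, Integrable (fun y : ℝ => k x y * f y)) ∧
    (K f : ℝ → ℂ) =ᵐ[volume] fun x : ℝ => ∫ y : ℝ, k x y * f y

theorem IsIntegralOperator.unique {k : ℝ → ℝ → ℂ} {K K' : L2R →L[ℂ] L2R}
    (h : IsIntegralOperator k K) (h' : IsIntegralOperator k K') : K = K' := by
  ext1 f
  exact Lp.ext ((h f).2.trans (h' f).2.symm)

/-- `α = W √(ζ² U''(0) / 2)`; the radicand is a positive real number for the potentials under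
consideration. -/
def saddleAlpha (W : ℝ) (ζ : ℂ) (U : ℝ → ℂ) : ℝ :=
  W * Real.sqrt ((ζ ^ 2 * iteratedDeriv 2 U 0).re / 2)

theorem saddleAlpha_pos {W : ℝ} {ζ : ℂ} {C c γ : ℝ} {U : ℝ → ℂ} (hW : 0 < W)
    (hU : SaddlePotential ζ C c γ U) : 0 < saddleAlpha W ζ U :=
  mul_pos hW (Real.sqrt_pos.2 (half_pos hU.rotated_pos))

/-- `μ = √(π / (W² ζ² + α))`, with the principal branch of the square root. -/
def saddleMu (W : ℝ) (ζ : ℂ) (U : ℝ → ℂ) : ℂ :=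
  ((Real.pi : ℂ) / ((W : ℂ) ^ 2 * ζ ^ 2 + (saddleAlpha W ζ U : ℂ))) ^ (1 / 2 : ℂ)

/-- The Gaussian `g_α(x) = (2α/π)^(1/4) exp(-α x²)`, as a complex-valued function. -/
def gaussianFun (α : ℝ) (x : ℝ) : ℂ :=
  (((2 * α / Real.pi) ^ (1 / 4 : ℝ) * Real.exp (-α * x ^ 2) : ℝ) : ℂ)

theorem memLp_gaussianFun {α : ℝ} (hα : 0 < α) : MemLp (gaussianFun α) 2 volume := by
  have hc : Continuous (gaussianFun α) := by
    unfold gaussianFun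
    fun_prop
  rw [memLp_two_iff_integrable_sq_norm hc.aestronglyMeasurable]
  have h := (integrable_exp_neg_mul_sq (b := 2 * α) (by positivity)).const_mul
    (((2 * α / Real.pi) ^ (1 / 4 : ℝ)) ^ 2)
  refine h.congr (Filter.Eventually.of_forall fun x => ?_)
  simp only [gaussianFun, Complex.norm_real, Real.norm_eq_abs, sq_abs, mul_pow, ← Real.exp_nat_mul]
  congr 2
  push_cast
  ring

/-- The Gaussian `g_α`, `α > 0`, as an element of `L₂(ℝ)`. -/
def gaussianL2 (α : ℝ) (hα : 0 < α) : L2R :=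
  (memLp_gaussianFun hα).toLp (gaussianFun α)

/-- The orthogonal projection of `L₂(ℝ)` onto the orthogonal complement of `ℂ g`. -/
def perpProj (g : L2R) : L2R →L[ℂ] L2R :=
  (Submodule.span ℂ {g})ᗮ.starProjection

/-- The blocks of an operator `T` with respect to `L₂(ℝ) = ℂ g ⊕ (ℂ g)^⊥`, as operators on
`L₂(ℝ)`: with `P` the orthogonal projection onto `(ℂ g)^⊥`, they are
`A = (1 - P) T (1 - P)`, `B = (1 - P) T P`, `C = P T (1 - P)`, `D = P T P`. -/
def blockA (g : L2R) (T : L2R →L[ℂ] L2R) : L2R →L[ℂ] L2R :=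
  (1 - perpProj g) * T * (1 - perpProj g)

/-- The block `B = (1 - P) T P`. -/
def blockB (g : L2R) (T : L2R →L[ℂ] L2R) : L2R →L[ℂ] L2R :=
  (1 - perpProj g) * T * perpProj g

/-- The block `C = P T (1 - P)`. -/
def blockC (g : L2R) (T : L2R →L[ℂ] L2R) : L2R →L[ℂ] L2R :=
  perpProj g * T * (1 - perpProj g)

/-- The block `D = P T P`. -/
def blockD (g : L2R) (T : L2R →L[ℂ] L2R) : L2R →L[ℂ] L2R :=
  perpProj g * T * perpProj g

end

/-! Write v = ζ², u = U''(0), so that |v| = 1 and vu = |u|. Two estimates give all four blocks, each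
with error O(W^(-6/5)), hence δ = 1/5.

Blocks A, B, C. Near the saddle e^{-U/2} is e^{-ux²/4}, and the identity W²vu = 2α² makes g_α an
eigenfunction of the resulting Gaussian kernel up to relative errors O(W^(-2)), with eigenvalue μ.
The cubic Taylor remainder, tested against a Gaussian of width α^(-1/2), costs O(W^(-3/2)). Thus
K̂g_α - g_α is small (`norm_apply_gaussian_sub_le`), which controls A and C. The adjoint of K has
the same shape with v and U conjugated, while α is unchanged; this controls B.

Block D. The kernel is complex, so spectral theory does not apply to K directly. Instead K is a
scalar times T'*T, where T convolves e^{-U/2}f with a Gaussian of parameter 2W²v and T' is its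
conjugate. Cauchy–Schwarz reduces the bound to ‖Tf‖² and ‖T'h‖², and ‖Tf‖² is a constant times the
form of the real Gaussian convolution with parameter a = W²/Re v, at φ = e^{-U/2}f. Since α²/a = Re
u/2, the comparison oscillator for this real form again has ground state g_α. Its normalized
eigenvalues are ρ^(k+1/2) with ρ = 1 - t + O(t²), t = α/a = √(|u|/2) Re v/W; orthogonality to g_α
leaves ρ^(3/2), that is, 1 - 3t/2. The normalization |μ|⁻¹√π/W contributes 1 + t/2, and the product
is 1 - t.

The comparison holds only near 0, so the form is localized at scale R by cos²θ + sin²θ = 1. The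
Taylor error R³ and the localization error W^(-2)R^(-2) balance at R = W^(-2/5). Outside, U3 gives
e^{-R²/C}, and R² dominates 1/W. The spectral gap of the Mehler kernel is
`norm_mehler_sub_rankOne_le`; the localized estimate is `re_inner_gaussKernel_le`. Uniformity in ζ
and U comes from `SaddlePotential.exists_uniform_bounds`. -/

open scoped ENNReal ComplexConjugate

/-! ### Cauchy–Schwarz inequalities and the Schur test -/

/-- Cauchy--Schwarz for lower Lebesgue integrals. -/
theorem lintegral_mul_sq_le {α : Type*} [MeasurableSpace α] (ν : Measure α) {p q : α → ℝ≥0∞}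
    (hp : AEMeasurable p ν) (hq : AEMeasurable q ν) :
    (∫⁻ x, p x * q x ∂ν) ^ 2 ≤ (∫⁻ x, p x ^ 2 ∂ν) * ∫⁻ x, q x ^ 2 ∂ν := by
  have h := ENNReal.lintegral_mul_le_Lp_mul_Lq ν (Real.HolderConjugate.two_two) hp hq
  have h2 : ((∫⁻ x, p x * q x ∂ν) ^ 2) ≤
      ((∫⁻ a, p a ^ (2:ℝ) ∂ν) ^ (1 / (2:ℝ)) * (∫⁻ a, q a ^ (2:ℝ) ∂ν) ^ (1 / (2:ℝ))) ^ 2 := by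
    gcongr
    simpa using h
  refine h2.trans (le_of_eq ?_)
  rw [mul_pow]
  simp only [← ENNReal.rpow_natCast, ← ENNReal.rpow_mul]
  norm_num

/-- Weighted Cauchy--Schwarz for lower Lebesgue integrals. -/
theorem lintegral_mul_sq_le_weighted {α : Type*} [MeasurableSpace α] (ν : Measure α)
    {w q : α → ℝ≥0∞} (hw : AEMeasurable w ν) (hq : AEMeasurable q ν) :
    (∫⁻ x, w x * q x ∂ν) ^ 2 ≤ (∫⁻ x, w x ∂ν) * ∫⁻ x, w x * q x ^ 2 ∂ν := by
  have key : ∀ t : ℝ≥0∞, (t ^ (1 / 2 : ℝ)) ^ 2 = t := fun t => by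
    rw [← ENNReal.rpow_natCast, ← ENNReal.rpow_mul]; norm_num
  have h := lintegral_mul_sq_le ν (p := fun x => w x ^ (1 / 2 : ℝ))
    (q := fun x => w x ^ (1 / 2 : ℝ) * q x) (hw.pow_const _) ((hw.pow_const _).mul hq)
  simp only [mul_pow, key, ← mul_assoc] at h
  simpa only [← sq, key] using h

/-- A measurable kernel whose rows and columns have `L¹` norm at most `S`. -/
structure SchurKernel (k : ℝ → ℝ → ℂ) (S : ℝ) : Prop where
  measurable : Measurable (Function.uncurry k)
  nonneg : 0 ≤ S
  row : ∀ x, ∫⁻ y, ‖k x y‖ₑ ≤ ENNReal.ofReal S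
  col : ∀ y, ∫⁻ x, ‖k x y‖ₑ ≤ ENNReal.ofReal S

namespace SchurKernel

variable {k l : ℝ → ℝ → ℂ} {S S' : ℝ}

theorem measurable_row (h : SchurKernel k S) (x : ℝ) : Measurable (k x) :=
  h.measurable.of_uncurry_left

theorem adjoint (h : SchurKernel k S) : SchurKernel (fun x y => conj (k y x)) S where
  measurable := Complex.continuous_conj.measurable.comp (h.measurable.comp measurable_swap)
  nonneg := h.nonneg
  row x := by simpa using h.col x
  col y := by simpa using h.row y

/-- Cauchy–Schwarz with |k(x, ·)| as weight spends the row bound; after Tonelli the column bound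
gives the second factor S. -/
theorem lintegral_sq_le (h : SchurKernel k S) {f : ℝ → ℝ≥0∞} (hf : AEMeasurable f) :
    ∫⁻ x, (∫⁻ y, ‖k x y‖ₑ * f y) ^ 2 ≤ ENNReal.ofReal S ^ 2 * ∫⁻ y, f y ^ 2 := by
  have hm : AEMeasurable (fun p : ℝ × ℝ => ‖k p.1 p.2‖ₑ * f p.2 ^ 2) (volume.prod volume) :=
    h.measurable.enorm.aemeasurable.mul ((hf.comp_snd).pow_const 2)
  calc ∫⁻ x, (∫⁻ y, ‖k x y‖ₑ * f y) ^ 2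
      ≤ ∫⁻ x, ENNReal.ofReal S * ∫⁻ y, ‖k x y‖ₑ * f y ^ 2 := by
        refine lintegral_mono fun x => ?_
        refine (lintegral_mul_sq_le_weighted _ (h.measurable_row x).enorm.aemeasurable hf).trans ?_
        gcongr
        exact h.row x
    _ = ENNReal.ofReal S * ∫⁻ x, ∫⁻ y, ‖k x y‖ₑ * f y ^ 2 :=
        lintegral_const_mul' _ _ ENNReal.ofReal_ne_top
    _ = ENNReal.ofReal S * ∫⁻ y, ∫⁻ x, ‖k x y‖ₑ * f y ^ 2 := by
        rw [lintegral_lintegral_swap hm]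
    _ ≤ ENNReal.ofReal S * ∫⁻ y, ENNReal.ofReal S * f y ^ 2 := by
        gcongr with y
        rw [lintegral_mul_const'' _ (h.measurable.of_uncurry_right.enorm.aemeasurable)]
        gcongr
        exact h.col y
    _ = ENNReal.ofReal S ^ 2 * ∫⁻ y, f y ^ 2 := by
        rw [lintegral_const_mul' _ _ ENNReal.ofReal_ne_top, sq, mul_assoc]

end SchurKernel

theorem MeasureTheory.MemLp.lintegral_enorm_sq_lt_top {f : ℝ → ℂ} (hf : MemLp f 2 volume) :
    ∫⁻ y, ‖f y‖ₑ ^ 2 < ⊤ := by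
  have := hf.2
  rw [eLpNorm_lt_top_iff_lintegral_rpow_enorm_lt_top (by simp) (by simp)] at this
  simpa using this

theorem memLp_two_of_lintegral {f : ℝ → ℂ} (hf : AEStronglyMeasurable f volume)
    (h : ∫⁻ y, ‖f y‖ₑ ^ 2 < ⊤) : MemLp f 2 volume := by
  refine ⟨hf, ?_⟩
  rw [eLpNorm_lt_top_iff_lintegral_rpow_enorm_lt_top (by simp) (by simp)]
  simpa using h

theorem enorm_sq_eq_lintegral (f : L2R) : ‖f‖ₑ ^ 2 = ∫⁻ y, ‖f y‖ₑ ^ 2 := by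
  rw [Lp.enorm_def, eLpNorm_eq_lintegral_rpow_enorm_toReal (by simp) (by simp)]
  rw [← ENNReal.rpow_natCast, ← ENNReal.rpow_mul]
  simp

/-- Comparison of `L₂` norms through lower integrals. -/
theorem norm_le_of_lintegral_le {f : L2R} {B : ℝ} (hB : 0 ≤ B)
    (h : ∫⁻ y, ‖f y‖ₑ ^ 2 ≤ ENNReal.ofReal B ^ 2) : ‖f‖ ≤ B := by
  rw [← enorm_sq_eq_lintegral] at h
  have h1 : ‖f‖ₑ ≤ ENNReal.ofReal B := (ENNReal.pow_le_pow_left_iff two_ne_zero).1 h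
  rw [← ofReal_norm] at h1
  exact (ENNReal.ofReal_le_ofReal_iff hB).1 h1

namespace SchurKernel

variable {k l : ℝ → ℝ → ℂ} {S S' : ℝ}

theorem ae_lintegral_lt_top (h : SchurKernel k S) {f : ℝ → ℝ≥0∞} (hf : AEMeasurable f)
    (hf2 : ∫⁻ y, f y ^ 2 < ⊤) : ∀ᵐ x : ℝ, ∫⁻ y, ‖k x y‖ₑ * f y < ⊤ := by
  have hm : AEMeasurable (fun x => (∫⁻ y, ‖k x y‖ₑ * f y) ^ 2) volume := by
    refine AEMeasurable.pow_const ?_ 2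
    exact AEMeasurable.lintegral_prod_right'
      (f := fun p : ℝ × ℝ => ‖k p.1 p.2‖ₑ * f p.2)
      (h.measurable.enorm.aemeasurable.mul hf.comp_snd)
  have := ae_lt_top' hm ((h.lintegral_sq_le hf).trans_lt
    (ENNReal.mul_lt_top (by simp) hf2)).ne
  filter_upwards [this] with x hx
  by_contra hc
  simp [not_lt_top_iff.1 hc] at hx

theorem ae_integrable (h : SchurKernel k S) {f : ℝ → ℂ} (hf : MemLp f 2 volume) :
    ∀ᵐ x : ℝ, Integrable (fun y : ℝ => k x y * f y) := by
  filter_upwards [h.ae_lintegral_lt_top hf.1.enorm hf.lintegral_enorm_sq_lt_top] with x hx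
  refine ⟨(h.measurable_row x).aestronglyMeasurable.mul hf.1, ?_⟩
  simpa [HasFiniteIntegral, enorm_mul] using hx

theorem aestronglyMeasurable_mul (h : SchurKernel k S) {f : ℝ → ℂ}
    (hf : AEStronglyMeasurable f volume) :
    AEStronglyMeasurable (fun p : ℝ × ℝ => k p.1 p.2 * f p.2) (volume.prod volume) :=
  h.measurable.aestronglyMeasurable.mul hf.comp_snd

theorem lintegral_enorm_le (h : SchurKernel k S) {f : ℝ → ℂ} (hf : MemLp f 2 volume) :
    ∫⁻ x, ‖∫ y, k x y * f y‖ₑ ^ 2 ≤ ENNReal.ofReal S ^ 2 * ∫⁻ y, ‖f y‖ₑ ^ 2 := by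
  refine le_trans (lintegral_mono fun x => pow_le_pow_left' ?_ 2) (h.lintegral_sq_le hf.1.enorm)
  simpa only [enorm_mul] using enorm_integral_le_lintegral_enorm (fun y => k x y * f y)

theorem memLp (h : SchurKernel k S) {f : ℝ → ℂ} (hf : MemLp f 2 volume) :
    MemLp (fun x => ∫ y, k x y * f y) 2 volume :=
  memLp_two_of_lintegral (h.aestronglyMeasurable_mul hf.1).integral_prod_right'
    ((h.lintegral_enorm_le hf).trans_lt (ENNReal.mul_lt_top (by simp)
      hf.lintegral_enorm_sq_lt_top))

/-- **Schur test**: a Schur kernel defines a bounded operator on `L₂(ℝ)`. -/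
theorem exists_isIntegralOperator (h : SchurKernel k S) :
    ∃ K : L2R →L[ℂ] L2R, IsIntegralOperator k K ∧ ‖K‖ ≤ S := by
  let T : L2R →ₗ[ℂ] L2R :=
    { toFun := fun f => (h.memLp (Lp.memLp f)).toLp _
      map_add' := by
        intro f f'
        refine Lp.ext ?_
        filter_upwards [(h.memLp (Lp.memLp f)).coeFn_toLp, (h.memLp (Lp.memLp f')).coeFn_toLp,
          (h.memLp (Lp.memLp (f + f'))).coeFn_toLp, h.ae_integrable (Lp.memLp f),
          h.ae_integrable (Lp.memLp f'), Lp.coeFn_add ((h.memLp (Lp.memLp f)).toLp _)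
            ((h.memLp (Lp.memLp f')).toLp _)] with x h1 h2 h3 i1 i2 h4
        rw [h4, Pi.add_apply, h1, h2, h3, ← integral_add i1 i2]
        refine integral_congr_ae ?_
        filter_upwards [Lp.coeFn_add f f'] with y hy
        rw [hy, Pi.add_apply, mul_add]
      map_smul' := by
        intro c f
        refine Lp.ext ?_
        filter_upwards [(h.memLp (Lp.memLp f)).coeFn_toLp,
          (h.memLp (Lp.memLp (c • f))).coeFn_toLp,
          Lp.coeFn_smul c ((h.memLp (Lp.memLp f)).toLp _)] with x h1 h2 h3
        rw [RingHom.id_apply, h3, Pi.smul_apply, h1, h2, smul_eq_mul, ← integral_const_mul]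
        refine integral_congr_ae ?_
        filter_upwards [Lp.coeFn_smul c f] with y hy
        rw [hy, Pi.smul_apply, smul_eq_mul]
        ring }
  have hT : ∀ f, (T f : ℝ → ℂ) =ᵐ[volume] fun x => ∫ y, k x y * f y := fun f =>
    (h.memLp (Lp.memLp f)).coeFn_toLp
  have hb : ∀ f, ‖T f‖ ≤ S * ‖f‖ := by
    intro f
    refine norm_le_of_lintegral_le (mul_nonneg h.nonneg (norm_nonneg _)) ?_
    rw [lintegral_congr_ae ((hT f).mono fun x hx => by rw [hx])]
    refine (h.lintegral_enorm_le (Lp.memLp f)).trans (le_of_eq ?_)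
    rw [ENNReal.ofReal_mul h.nonneg, mul_pow, ofReal_norm, enorm_sq_eq_lintegral]
  exact ⟨T.mkContinuous S hb, fun f => ⟨h.ae_integrable (Lp.memLp f), hT f⟩,
    T.mkContinuous_norm_le h.nonneg hb⟩

theorem norm_le (h : SchurKernel k S) {K : L2R →L[ℂ] L2R} (hK : IsIntegralOperator k K) :
    ‖K‖ ≤ S := by
  obtain ⟨K', hK', hn⟩ := h.exists_isIntegralOperator
  rwa [hK.unique hK']

theorem integrable_prod (h : SchurKernel k S) {f g : ℝ → ℂ} (hf : MemLp f 2 volume)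
    (hg : MemLp g 2 volume) :
    Integrable (fun p : ℝ × ℝ => g p.1 * (k p.1 p.2 * f p.2)) (volume.prod volume) := by
  have hms : AEStronglyMeasurable (fun p : ℝ × ℝ => g p.1 * (k p.1 p.2 * f p.2))
      (volume.prod volume) := hg.1.comp_fst.mul (h.aestronglyMeasurable_mul hf.1)
  refine ⟨hms, ?_⟩
  rw [HasFiniteIntegral, lintegral_prod _ hms.enorm]
  have e : ∀ x, ∫⁻ y, ‖g x * (k x y * f y)‖ₑ = ‖g x‖ₑ * ∫⁻ y, ‖k x y‖ₑ * ‖f y‖ₑ := by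
    intro x
    simp only [enorm_mul]
    exact lintegral_const_mul' _ _ (by simp)
  simp only [e]
  have hm : AEMeasurable (fun x => ∫⁻ y, ‖k x y‖ₑ * ‖f y‖ₑ) volume :=
    AEMeasurable.lintegral_prod_right' (f := fun p : ℝ × ℝ => ‖k p.1 p.2‖ₑ * ‖f p.2‖ₑ)
      (h.measurable.enorm.aemeasurable.mul hf.1.enorm.comp_snd)
  have h1 := lintegral_mul_sq_le volume hg.1.enorm hm
  have h2 : (∫⁻ x, ‖g x‖ₑ ^ 2) * ∫⁻ x, (∫⁻ y, ‖k x y‖ₑ * ‖f y‖ₑ) ^ 2 < ⊤ :=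
    ENNReal.mul_lt_top hg.lintegral_enorm_sq_lt_top ((h.lintegral_sq_le hf.1.enorm).trans_lt
      (ENNReal.mul_lt_top (by simp) hf.lintegral_enorm_sq_lt_top))
  by_contra hc
  simp only [not_lt_top_iff.1 hc] at h1
  simp [top_le_iff.1 (le_trans (by simp) h1)] at h2

end SchurKernel

/-! ### Inner products, adjoints and products of integral operators -/

namespace IsIntegralOperator

variable {k l m : ℝ → ℝ → ℂ} {S S' : ℝ} {K L : L2R →L[ℂ] L2R}

theorem inner_eq_integral (hK : IsIntegralOperator k K) (h : SchurKernel k S) (f g : L2R) :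
    ⟪g, K f⟫_ℂ = ∫ p : ℝ × ℝ, conj (g p.1) * (k p.1 p.2 * f p.2) := by
  rw [L2.inner_def, Measure.volume_eq_prod, integral_prod _
    (h.integrable_prod (g := fun x => conj (g x)) (Lp.memLp f) (Lp.memLp g).star)]
  refine integral_congr_ae ?_
  filter_upwards [(hK f).2] with x hx
  simp only [hx, integral_const_mul, RCLike.inner_apply]
  ring

theorem adjoint (hK : IsIntegralOperator k K) (h : SchurKernel k S) :
    IsIntegralOperator (fun x y => conj (k y x)) (ContinuousLinearMap.adjoint K) := by
  obtain ⟨L, hL, -⟩ := h.adjoint.exists_isIntegralOperator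
  convert hL using 1
  symm
  rw [ContinuousLinearMap.eq_adjoint_iff]
  intro f g
  rw [← inner_conj_symm, hL.inner_eq_integral h.adjoint, hK.inner_eq_integral h,
    ← integral_conj, Measure.volume_eq_prod, ← integral_prod_swap]
  refine integral_congr_ae (Filter.Eventually.of_forall fun p => ?_)
  simp
  ring

/-- Fubini is legitimate for almost every x because |l| maps |f| into L₂ and |k| acts on the result,
both by the Schur bound. -/
theorem comp (hK : IsIntegralOperator k K) (hL : IsIntegralOperator l L)
    (h : SchurKernel k S) (h' : SchurKernel l S')
    (hm : ∀ x y, ∫ z, k x z * l z y = m x y) : IsIntegralOperator m (K * L) := by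
  intro f
  have hf := Lp.memLp f
  have hF : AEMeasurable (fun z => ∫⁻ y, ‖l z y‖ₑ * ‖f y‖ₑ) volume :=
    AEMeasurable.lintegral_prod_right' (f := fun p : ℝ × ℝ => ‖l p.1 p.2‖ₑ * ‖f p.2‖ₑ)
      (h'.measurable.enorm.aemeasurable.mul hf.1.enorm.comp_snd)
  have hfin := h.ae_lintegral_lt_top hF ((h'.lintegral_sq_le hf.1.enorm).trans_lt
      (ENNReal.mul_lt_top (by simp) hf.lintegral_enorm_sq_lt_top))
  have hint : ∀ᵐ x : ℝ, Integrable (fun p : ℝ × ℝ => k x p.1 * (l p.1 p.2 * f p.2))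
      (volume.prod volume) := by
    filter_upwards [hfin] with x hx
    have hms : AEStronglyMeasurable (fun p : ℝ × ℝ => k x p.1 * (l p.1 p.2 * f p.2))
        (volume.prod volume) :=
      (h.measurable_row x).aestronglyMeasurable.comp_fst.mul (h'.aestronglyMeasurable_mul hf.1)
    refine ⟨hms, ?_⟩
    rw [HasFiniteIntegral, lintegral_prod _ hms.enorm]
    refine lt_of_eq_of_lt (lintegral_congr fun z => ?_) hx
    simp only [enorm_mul]
    exact lintegral_const_mul' _ _ (by simp)
  have hrw : ∀ x y, ∫ z, k x z * (l z y * f y) = m x y * f y := by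
    intro x y
    rw [← hm, ← integral_mul_const]
    simp only [mul_assoc]
  constructor
  · filter_upwards [hint] with x hx
    simpa only [hrw] using hx.integral_prod_right
  · filter_upwards [hint, (hK (L f)).2] with x hx h1
    rw [mul_apply_eq_comp, h1]
    have h2 : ∫ z, k x z * (L f) z = ∫ z, ∫ y, k x z * (l z y * f y) := by
      refine integral_congr_ae ?_
      filter_upwards [(hL f).2] with z hz
      simp only [hz, integral_const_mul]
    rw [h2, integral_integral_swap hx]
    simp only [hrw]

theorem sub (hK : IsIntegralOperator k K) (hL : IsIntegralOperator l L) :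
    IsIntegralOperator (fun x y => k x y - l x y) (K - L) := by
  intro f
  constructor
  · filter_upwards [(hK f).1, (hL f).1] with x h1 h2
    refine (h1.sub h2).congr (Filter.Eventually.of_forall fun y => ?_)
    simp only [Pi.sub_apply, sub_mul]
  · filter_upwards [(hK f).1, (hL f).1, (hK f).2, (hL f).2, Lp.coeFn_sub (K f) (L f)]
      with x h1 h2 h3 h4 h5
    rw [sub_apply, h5, Pi.sub_apply, h3, h4, ← integral_sub h1 h2]
    simp only [sub_mul]

theorem const_smul (hK : IsIntegralOperator k K) (c : ℂ) :
    IsIntegralOperator (fun x y => c * k x y) (c • K) := by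
  intro f
  constructor
  · filter_upwards [(hK f).1] with x h1
    simpa only [mul_assoc] using h1.const_mul c
  · filter_upwards [(hK f).2, Lp.coeFn_smul c (K f)] with x h3 h5
    rw [smul_apply, h5, Pi.smul_apply, h3, smul_eq_mul, ← integral_const_mul]
    simp only [mul_assoc]

/-- The operator norm is bounded by the Hilbert--Schmidt norm of the kernel. -/
theorem norm_le_hilbertSchmidt (hK : IsIntegralOperator k K)
    (hk : Measurable (Function.uncurry k)) {H : ℝ} (hH : 0 ≤ H)
    (h : ∫⁻ x, ∫⁻ y, ‖k x y‖ₑ ^ 2 ≤ ENNReal.ofReal H ^ 2) : ‖K‖ ≤ H := by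
  refine ContinuousLinearMap.opNorm_le_bound _ hH fun f => ?_
  refine norm_le_of_lintegral_le (by positivity) ?_
  rw [lintegral_congr_ae ((hK f).2.mono fun x hx => by rw [hx])]
  calc ∫⁻ x, ‖∫ y, k x y * f y‖ₑ ^ 2
      ≤ ∫⁻ x, (∫⁻ y, ‖k x y‖ₑ ^ 2) * ‖f‖ₑ ^ 2 := by
        refine lintegral_mono fun x => ?_
        rw [enorm_sq_eq_lintegral]
        refine le_trans ?_ (lintegral_mul_sq_le volume
          (hk.of_uncurry_left (x := x)).enorm.aemeasurable (Lp.memLp f).1.enorm)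
        refine pow_le_pow_left' ?_ 2
        simpa only [enorm_mul] using enorm_integral_le_lintegral_enorm (fun y => k x y * f y)
    _ = (∫⁻ x, ∫⁻ y, ‖k x y‖ₑ ^ 2) * ‖f‖ₑ ^ 2 := lintegral_mul_const' _ _ (by simp)
    _ ≤ ENNReal.ofReal H ^ 2 * ‖f‖ₑ ^ 2 := by gcongr
    _ = ENNReal.ofReal (H * ‖f‖) ^ 2 := by
        rw [ENNReal.ofReal_mul hH, mul_pow, ofReal_norm]

end IsIntegralOperator

/-! ### Gaussian domination and completing the square -/

theorem lintegral_exp_neg_mul_sub_sq {b : ℝ} (hb : 0 < b) (x : ℝ) :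
    ∫⁻ y : ℝ, ENNReal.ofReal (Real.exp (-b * (x - y) ^ 2)) = ENNReal.ofReal √(Real.pi / b) := by
  rw [lintegral_sub_left_eq_self (fun y => ENNReal.ofReal (Real.exp (-b * y ^ 2))) x,
    ← integral_gaussian b, ofReal_integral_eq_lintegral_ofReal (integrable_exp_neg_mul_sq hb)
      (Filter.Eventually.of_forall fun _ => (Real.exp_pos _).le)]

/-- A kernel dominated by a Gaussian convolution kernel is a Schur kernel. -/
theorem SchurKernel.of_gaussian_bound {k : ℝ → ℝ → ℂ} (hk : Measurable (Function.uncurry k))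
    {A b : ℝ} (hA : 0 ≤ A) (hb : 0 < b)
    (h : ∀ x y, ‖k x y‖ ≤ A * Real.exp (-b * (x - y) ^ 2)) :
    SchurKernel k (A * √(Real.pi / b)) := by
  have key : ∀ x, ∫⁻ y, ENNReal.ofReal (A * Real.exp (-b * (x - y) ^ 2)) =
      ENNReal.ofReal (A * √(Real.pi / b)) := by
    intro x
    simp only [ENNReal.ofReal_mul hA]
    rw [lintegral_const_mul' _ _ ENNReal.ofReal_ne_top, lintegral_exp_neg_mul_sub_sq hb]
  refine ⟨hk, by positivity, fun x => ?_, fun y => ?_⟩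
  · rw [← key x]
    refine lintegral_mono fun y => ?_
    rw [← ofReal_norm]
    exact ENNReal.ofReal_le_ofReal (h x y)
  · rw [← key y]
    refine lintegral_mono fun x => ?_
    rw [← ofReal_norm]
    refine ENNReal.ofReal_le_ofReal ((h x y).trans (le_of_eq ?_))
    ring_nf

theorem integral_exp_quadratic {A : ℝ} (hA : 0 < A) (B D : ℝ) :
    ∫ z : ℝ, Real.exp (-A * z ^ 2 + B * z + D) =
      √(Real.pi / A) * Real.exp (D + B ^ 2 / (4 * A)) := by
  rw [← integral_gaussian A, ← integral_mul_const,
    ← integral_sub_right_eq_self (fun z => Real.exp (-A * z ^ 2) * Real.exp _) (B / (2 * A))]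
  congr 1
  ext z
  simp only [← Real.exp_add]
  congr 1
  field_simp
  ring

/-! ### The Mehler kernel and its spectral gap -/

/-- The normalized real Gaussian `g_α`. -/
noncomputable def gaussianReal₁ (α x : ℝ) : ℝ := (2 * α / Real.pi) ^ (1 / 4 : ℝ) * Real.exp (-α * x ^ 2)

theorem gaussianFun_eq (α x : ℝ) : gaussianFun α x = (gaussianReal₁ α x : ℂ) := rfl

theorem gaussianReal₁_mul_self {α : ℝ} (hα : 0 < α) (x : ℝ) :
    gaussianReal₁ α x * gaussianReal₁ α x = √(2 * α / Real.pi) * Real.exp (-(2 * α) * x ^ 2) := by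
  have h : (0:ℝ) < 2 * α / Real.pi := by positivity
  unfold gaussianReal₁
  rw [mul_mul_mul_comm, ← Real.exp_add, ← Real.rpow_add h, Real.sqrt_eq_rpow]
  norm_num
  left
  ring

/-- The Mehler kernel with ground state `g_α` and correlation `ρ`. -/
noncomputable def mehler (α ρ x y : ℝ) : ℝ :=
  √(2 * α / (Real.pi * (1 - ρ ^ 2))) *
    Real.exp (-α * ((1 + ρ ^ 2) * (x ^ 2 + y ^ 2) - 4 * ρ * x * y) / (1 - ρ ^ 2))

section

variable {α ρ : ℝ}

theorem mehler_symm (x y : ℝ) : mehler α ρ x y = mehler α ρ y x := by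
  unfold mehler
  ring_nf

theorem mehler_nonneg (x y : ℝ) : 0 ≤ mehler α ρ x y := by
  unfold mehler
  positivity

/-- The semigroup law in the one case needed: squaring the operator squares ρ, so the powers of
order 2^n stay explicit. -/
theorem integral_mehler_mul_mehler (hα : 0 < α) (h0 : 0 < ρ) (h1 : ρ < 1) (x y : ℝ) :
    ∫ z, mehler α ρ x z * mehler α ρ z y = mehler α (ρ ^ 2) x y := by
  have h2 : 0 < 1 - ρ ^ 2 := by nlinarith
  have h3 : 0 < 1 + ρ ^ 2 := by positivity
  have h4 : 0 < 1 - (ρ ^ 2) ^ 2 := by nlinarith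
  have hA : 0 < 2 * α * (1 + ρ ^ 2) / (1 - ρ ^ 2) := by positivity
  have key : ∀ z, mehler α ρ x z * mehler α ρ z y = (2 * α / (Real.pi * (1 - ρ ^ 2))) *
      Real.exp (-(2 * α * (1 + ρ ^ 2) / (1 - ρ ^ 2)) * z ^ 2 +
        (4 * α * ρ * (x + y) / (1 - ρ ^ 2)) * z +
        (-α * (1 + ρ ^ 2) * (x ^ 2 + y ^ 2) / (1 - ρ ^ 2))) := by
    intro z
    unfold mehler
    rw [mul_mul_mul_comm, ← Real.exp_add, Real.mul_self_sqrt (by positivity)]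
    congr 2
    field_simp
    ring
  simp only [key]
  rw [integral_const_mul, integral_exp_quadratic hA, ← mul_assoc]
  unfold mehler
  congr 1
  · rw [← Real.sqrt_sq (by positivity : 0 ≤ 2 * α / (Real.pi * (1 - ρ ^ 2))),
      ← Real.sqrt_mul (by positivity)]
    congr 1
    have : 1 - (ρ ^ 2) ^ 2 = (1 - ρ ^ 2) * (1 + ρ ^ 2) := by ring
    rw [this]
    field_simp
  · congr 1
    have : 1 - (ρ ^ 2) ^ 2 = (1 - ρ ^ 2) * (1 + ρ ^ 2) := by ring
    rw [this]
    field_simp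
    ring

theorem integrable_mehler_mul_mehler (hα : 0 < α) (h0 : 0 < ρ) (h1 : ρ < 1) (x y : ℝ) :
    Integrable fun z => mehler α ρ x z * mehler α ρ z y := by
  -- A non-integrable function has Bochner integral 0, whereas the computed value is positive.
  by_contra h
  have := integral_mehler_mul_mehler hα h0 h1 x y
  rw [integral_undef h] at this
  have h4 : 0 < 1 - (ρ ^ 2) ^ 2 := by
    have : ρ ^ 2 < 1 := by nlinarith
    nlinarith [sq_nonneg ρ]
  have h5 : 0 < mehler α (ρ ^ 2) x y := by unfold mehler; positivity
  exact h5.ne this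

theorem integral_mehler_mul_gaussian (hα : 0 < α) (h0 : 0 < ρ) (h1 : ρ < 1) (x : ℝ) :
    ∫ z, mehler α ρ x z * gaussianReal₁ α z = gaussianReal₁ α x := by
  have h2 : 0 < 1 - ρ ^ 2 := by nlinarith
  have hA : 0 < 2 * α / (1 - ρ ^ 2) := by positivity
  have key : ∀ z, mehler α ρ x z * gaussianReal₁ α z =
      (√(2 * α / (Real.pi * (1 - ρ ^ 2))) * (2 * α / Real.pi) ^ (1 / 4 : ℝ)) *
      Real.exp (-(2 * α / (1 - ρ ^ 2)) * z ^ 2 + (4 * α * ρ * x / (1 - ρ ^ 2)) * z +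
        (-α * (1 + ρ ^ 2) * x ^ 2 / (1 - ρ ^ 2))) := by
    intro z
    unfold mehler gaussianReal₁
    rw [mul_mul_mul_comm, ← Real.exp_add]
    congr 2
    field_simp
    ring
  simp only [key]
  rw [integral_const_mul, integral_exp_quadratic hA, mul_mul_mul_comm]
  have e1 : √(2 * α / (Real.pi * (1 - ρ ^ 2))) * √(Real.pi / (2 * α / (1 - ρ ^ 2))) = 1 := by
    rw [← Real.sqrt_mul (by positivity), Real.sqrt_eq_one]
    field_simp
  rw [e1, one_mul]
  unfold gaussianReal₁
  congr 2
  field_simp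
  ring

theorem continuous_mehler : Continuous (Function.uncurry fun x y => mehler α ρ x y) := by
  unfold mehler Function.uncurry
  fun_prop

/-- The quadratic form in the exponent is 2ρ(x - y)² + (1 - ρ)²(x² + y²); the last term is dropped.
-/
theorem mehler_le (hα : 0 < α) (h0 : 0 < ρ) (h1 : ρ < 1) (x y : ℝ) :
    mehler α ρ x y ≤ √(2 * α / (Real.pi * (1 - ρ ^ 2))) *
      Real.exp (-(2 * α * ρ / (1 - ρ ^ 2)) * (x - y) ^ 2) := by
  have h2 : 0 < 1 - ρ ^ 2 := by nlinarith
  unfold mehler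
  gcongr
  rw [neg_mul, neg_mul, neg_div, neg_le_neg_iff, div_mul_eq_mul_div, div_le_div_iff_of_pos_right h2]
  nlinarith [mul_nonneg hα.le (mul_nonneg (sq_nonneg (1 - ρ)) (add_nonneg (sq_nonneg x) (sq_nonneg y)))]

theorem schurKernel_mehler (hα : 0 < α) (h0 : 0 < ρ) (h1 : ρ < 1) :
    ∃ S, SchurKernel (fun x y => (mehler α ρ x y : ℂ)) S := by
  have h2 : 0 < 1 - ρ ^ 2 := by nlinarith
  refine ⟨_, SchurKernel.of_gaussian_bound
    (A := √(2 * α / (Real.pi * (1 - ρ ^ 2)))) (b := 2 * α * ρ / (1 - ρ ^ 2)) ?_ (by positivity)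
    (by positivity) ?_⟩
  · exact (Complex.continuous_ofReal.comp (continuous_mehler (α := α) (ρ := ρ))).measurable
  · intro x y
    rw [Complex.norm_real, Real.norm_of_nonneg (mehler_nonneg x y)]
    exact mehler_le hα h0 h1 x y

theorem integral_gaussianReal₁_sq (hα : 0 < α) :
    ∫ x, gaussianReal₁ α x * gaussianReal₁ α x = 1 := by
  simp only [gaussianReal₁_mul_self hα]
  rw [integral_const_mul, integral_gaussian, ← Real.sqrt_mul (by positivity), Real.sqrt_eq_one]
  field_simp

theorem integrable_gaussianReal₁_sq (hα : 0 < α) :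
    Integrable fun x => gaussianReal₁ α x * gaussianReal₁ α x := by
  simp only [gaussianReal₁_mul_self hα]
  exact (integrable_exp_neg_mul_sq (by positivity)).const_mul _

theorem mehler_diag (h0 : 0 < ρ) (h1 : ρ < 1) (x : ℝ) :
    mehler α (ρ ^ 2) x x = √(2 * α / (Real.pi * (1 - (ρ ^ 2) ^ 2))) *
      Real.exp (-(2 * α * (1 - ρ ^ 2) / (1 + ρ ^ 2)) * x ^ 2) := by
  have h2 : 0 < 1 - ρ ^ 2 := by nlinarith
  unfold mehler
  congr 2
  have : 1 - (ρ ^ 2) ^ 2 = (1 - ρ ^ 2) * (1 + ρ ^ 2) := by ring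
  rw [this]
  field_simp
  ring

theorem integrable_mehler_diag (hα : 0 < α) (h0 : 0 < ρ) (h1 : ρ < 1) :
    Integrable fun x => mehler α (ρ ^ 2) x x := by
  have h2 : 0 < 1 - ρ ^ 2 := by nlinarith
  simp only [mehler_diag h0 h1]
  exact (integrable_exp_neg_mul_sq (by positivity)).const_mul _

theorem integral_mehler_diag (hα : 0 < α) (h0 : 0 < ρ) (h1 : ρ < 1) :
    ∫ x, mehler α (ρ ^ 2) x x = 1 / (1 - ρ ^ 2) := by
  have h2 : 0 < 1 - ρ ^ 2 := by nlinarith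
  simp only [mehler_diag h0 h1]
  rw [integral_const_mul, integral_gaussian,
    show 1 - (ρ ^ 2) ^ 2 = (1 - ρ ^ 2) * (1 + ρ ^ 2) by ring, ← Real.sqrt_mul (by positivity),
    ← Real.sqrt_sq (by positivity : 0 ≤ 1 / (1 - ρ ^ 2))]
  congr 1
  field_simp

theorem norm_gaussianL2 (hα : 0 < α) : ‖gaussianL2 α hα‖ = 1 := by
  have h : ⟪gaussianL2 α hα, gaussianL2 α hα⟫_ℂ = 1 := by
    rw [L2.inner_def]
    have : (fun x => ⟪gaussianL2 α hα x, gaussianL2 α hα x⟫_ℂ) =ᵐ[volume]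
        fun x => ((gaussianReal₁ α x * gaussianReal₁ α x : ℝ) : ℂ) := by
      filter_upwards [(memLp_gaussianFun hα).coeFn_toLp] with x hx
      rw [gaussianL2, hx, gaussianFun_eq, RCLike.inner_apply, Complex.conj_ofReal,
        ← Complex.ofReal_mul]
    rw [integral_congr_ae this, integral_complex_ofReal, integral_gaussianReal₁_sq hα]
    simp
  have h' : ‖gaussianL2 α hα‖ ^ 2 = 1 := by
    rw [← inner_self_eq_norm_sq (𝕜 := ℂ), h]
    simp
  nlinarith [norm_nonneg (gaussianL2 α hα), sq_nonneg (‖gaussianL2 α hα‖ - 1)]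

theorem gaussianL2_ae (hα : 0 < α) :
    (gaussianL2 α hα : ℝ → ℂ) =ᵐ[volume] fun x => (gaussianReal₁ α x : ℂ) :=
  (memLp_gaussianFun hα).coeFn_toLp

theorem inner_gaussianL2 (hα : 0 < α) (f : L2R) :
    ⟪gaussianL2 α hα, f⟫_ℂ = ∫ y, (gaussianReal₁ α y : ℂ) * f y := by
  rw [L2.inner_def]
  refine integral_congr_ae ?_
  filter_upwards [gaussianL2_ae hα] with x hx
  rw [hx]
  simp [mul_comm]

theorem isIntegralOperator_rankOne (hα : 0 < α) :
    IsIntegralOperator (fun x y => (gaussianReal₁ α x : ℂ) * gaussianReal₁ α y)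
      (InnerProductSpace.rankOne ℂ (gaussianL2 α hα) (gaussianL2 α hα)) := by
  intro f
  have hi : Integrable fun y => (gaussianReal₁ α y : ℂ) * f y := by
    refine (L2.integrable_inner (gaussianL2 α hα) f (𝕜 := ℂ)).congr ?_
    filter_upwards [gaussianL2_ae hα] with x hx
    rw [hx]
    simp [mul_comm]
  constructor
  · refine Filter.Eventually.of_forall fun x => ?_
    simpa only [mul_assoc] using hi.const_mul _
  · rw [InnerProductSpace.rankOne_apply]
    filter_upwards [gaussianL2_ae hα, Lp.coeFn_smul ⟪gaussianL2 α hα, f⟫_ℂ (gaussianL2 α hα)]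
      with x hx h1
    rw [h1, Pi.smul_apply, hx, inner_gaussianL2 hα]
    simp only [mul_assoc, integral_const_mul, smul_eq_mul]
    ring

variable {P : L2R →L[ℂ] L2R}

theorem mehler_apply_gaussian (hα : 0 < α) (h0 : 0 < ρ) (h1 : ρ < 1)
    (hP : IsIntegralOperator (fun x y => (mehler α ρ x y : ℂ)) P) :
    P (gaussianL2 α hα) = gaussianL2 α hα := by
  refine Lp.ext ?_
  filter_upwards [(hP (gaussianL2 α hα)).2, gaussianL2_ae hα] with x h2 h3
  rw [h2, h3, ← integral_mehler_mul_gaussian hα h0 h1 x, ← integral_complex_ofReal]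
  refine integral_congr_ae ?_
  filter_upwards [gaussianL2_ae hα] with y hy
  rw [hy]
  push_cast
  rfl

theorem mehler_isSelfAdjoint (hα : 0 < α) (h0 : 0 < ρ) (h1 : ρ < 1)
    (hP : IsIntegralOperator (fun x y => (mehler α ρ x y : ℂ)) P) : IsSelfAdjoint P := by
  obtain ⟨S, hS⟩ := schurKernel_mehler hα h0 h1
  rw [ContinuousLinearMap.isSelfAdjoint_iff']
  refine IsIntegralOperator.unique ?_ hP
  have := hP.adjoint hS
  simp only [Complex.conj_ofReal] at this
  simpa only [mehler_symm] using this

theorem mehler_sq (hα : 0 < α) (h0 : 0 < ρ) (h1 : ρ < 1)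
    (hP : IsIntegralOperator (fun x y => (mehler α ρ x y : ℂ)) P) :
    IsIntegralOperator (fun x y => (mehler α (ρ ^ 2) x y : ℂ)) (P * P) := by
  obtain ⟨S, hS⟩ := schurKernel_mehler hα h0 h1
  refine hP.comp hP hS hS fun x y => ?_
  rw [← integral_mehler_mul_mehler hα h0 h1, ← integral_complex_ofReal]
  push_cast
  rfl

/-- A Hilbert–Schmidt computation: the square integral over y is the diagonal of the ρ² kernel minus
g_α(x)², and integrating in x gives 1/(1 - ρ²) - 1 = ρ²/(1 - ρ²). The factor 1/√(1 - ρ²) is removed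
later by taking high powers. -/
theorem norm_mehler_sub_le (hα : 0 < α) (h0 : 0 < ρ) (h1 : ρ < 1)
    (hP : IsIntegralOperator (fun x y => (mehler α ρ x y : ℂ)) P) :
    ‖P - InnerProductSpace.rankOne ℂ (gaussianL2 α hα) (gaussianL2 α hα)‖ ≤
      ρ / √(1 - ρ ^ 2) := by
  have h2 : 0 < 1 - ρ ^ 2 := by nlinarith
  refine (hP.sub (isIntegralOperator_rankOne hα)).norm_le_hilbertSchmidt ?_ (by positivity) ?_
  · refine Continuous.measurable ?_
    have h := continuous_mehler (α := α) (ρ := ρ)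
    have h3 : Continuous (gaussianReal₁ α) := by unfold gaussianReal₁; fun_prop
    exact (Complex.continuous_ofReal.comp h).sub
      ((Complex.continuous_ofReal.comp (h3.comp continuous_fst)).mul
        (Complex.continuous_ofReal.comp (h3.comp continuous_snd)))
  · have e1 : ∀ x, ∫⁻ y, ‖(mehler α ρ x y : ℂ) - gaussianReal₁ α x * gaussianReal₁ α y‖ₑ ^ 2 =
        ENNReal.ofReal (mehler α (ρ ^ 2) x x - gaussianReal₁ α x * gaussianReal₁ α x) := by
      intro x
      have i1 := integrable_mehler_mul_mehler hα h0 h1 x x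
      have hq : Integrable fun y => mehler α ρ x y * gaussianReal₁ α y := by
        by_contra hc
        have := integral_mehler_mul_gaussian hα h0 h1 x
        rw [integral_undef hc] at this
        have h5 : 0 < gaussianReal₁ α x := by unfold gaussianReal₁; positivity
        exact h5.ne this
      have i2 := hq.const_mul (2 * gaussianReal₁ α x)
      have i3 := (integrable_gaussianReal₁_sq hα).const_mul (gaussianReal₁ α x ^ 2)
      have e : ∀ y, (mehler α ρ x y - gaussianReal₁ α x * gaussianReal₁ α y) ^ 2 =
          mehler α ρ x y * mehler α ρ y x - 2 * gaussianReal₁ α x * (mehler α ρ x y *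
          gaussianReal₁ α y) + gaussianReal₁ α x ^ 2 * (gaussianReal₁ α y * gaussianReal₁ α y) := by
        intro y
        rw [mehler_symm y x]
        ring
      have hint : Integrable fun y =>
          (mehler α ρ x y - gaussianReal₁ α x * gaussianReal₁ α y) ^ 2 := by
        simp only [e]
        exact (i1.sub i2).add i3
      have hval : ∫ y, (mehler α ρ x y - gaussianReal₁ α x * gaussianReal₁ α y) ^ 2 =
          mehler α (ρ ^ 2) x x - gaussianReal₁ α x * gaussianReal₁ α x := by
        simp only [e]
        rw [integral_add (by exact i1.sub i2) i3, integral_sub i1 i2, integral_const_mul,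
          integral_const_mul, integral_mehler_mul_mehler hα h0 h1,
          integral_mehler_mul_gaussian hα h0 h1, integral_gaussianReal₁_sq hα]
        ring
      rw [← hval, ofReal_integral_eq_lintegral_ofReal hint
        (Filter.Eventually.of_forall fun _ => sq_nonneg _)]
      refine lintegral_congr fun y => ?_
      rw [← Complex.ofReal_mul, ← Complex.ofReal_sub, ← ofReal_norm, Complex.norm_real,
        ← ENNReal.ofReal_pow (norm_nonneg _), Real.norm_eq_abs, sq_abs]
    simp only [e1]
    have i1 := integrable_mehler_diag hα h0 h1
    have i2 := integrable_gaussianReal₁_sq hα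
    have hnn : ∀ x, 0 ≤ mehler α (ρ ^ 2) x x - gaussianReal₁ α x * gaussianReal₁ α x := by
      intro x
      rw [gaussianReal₁_mul_self hα, mehler_diag h0 h1, sub_nonneg]
      have h4 : 0 < 1 - (ρ ^ 2) ^ 2 := by nlinarith
      refine mul_le_mul (Real.sqrt_le_sqrt ?_) (Real.exp_le_exp.2 ?_) (Real.exp_pos _).le
        (Real.sqrt_nonneg _)
      · refine div_le_div_of_nonneg_left (by positivity) (by positivity) ?_
        nlinarith [Real.pi_pos, mul_nonneg Real.pi_pos.le (sq_nonneg (ρ ^ 2))]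
      · rw [neg_mul, neg_mul, neg_le_neg_iff]
        refine mul_le_mul_of_nonneg_right ?_ (sq_nonneg x)
        rw [div_le_iff₀ (by positivity)]
        nlinarith [mul_pos hα (pow_pos h0 2)]
    rw [← ofReal_integral_eq_lintegral_ofReal (by exact i1.sub i2) (Filter.Eventually.of_forall hnn),
      integral_sub i1 i2, integral_mehler_diag hα h0 h1, integral_gaussianReal₁_sq hα,
      ← ENNReal.ofReal_pow (by positivity)]
    refine ENNReal.ofReal_le_ofReal (le_of_eq ?_)
    rw [div_pow, Real.sq_sqrt h2.le]
    field_simp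
    ring

end

section

variable {α ρ : ℝ} {P : L2R →L[ℂ] L2R}

/-- With Π the projection onto ℂg_α, the relations QΠ = ΠQ = Π = Π² give (Q - Π)² = Q² - Π, so
repeated squaring keeps the form "Mehler minus Π". -/
theorem exists_mehler_pow (hα : 0 < α) (h0 : 0 < ρ) (h1 : ρ < 1)
    (hP : IsIntegralOperator (fun x y => (mehler α ρ x y : ℂ)) P) (n : ℕ) :
    ∃ Q : L2R →L[ℂ] L2R, IsIntegralOperator (fun x y => (mehler α (ρ ^ 2 ^ n) x y : ℂ)) Q ∧
      (P - InnerProductSpace.rankOne ℂ (gaussianL2 α hα) (gaussianL2 α hα)) ^ 2 ^ n =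
        Q - InnerProductSpace.rankOne ℂ (gaussianL2 α hα) (gaussianL2 α hα) := by
  induction n with
  | zero => exact ⟨P, by simpa using hP, by simp⟩
  | succ n ih =>
    obtain ⟨Q, hQ, he⟩ := ih
    have a0 : 0 < ρ ^ 2 ^ n := pow_pos h0 _
    have a1 : ρ ^ 2 ^ n < 1 := pow_lt_one₀ h0.le h1 (by positivity)
    refine ⟨Q * Q, ?_, ?_⟩
    · have := mehler_sq hα a0 a1 hQ
      simpa only [pow_succ 2 n, pow_mul] using this
    · set g := gaussianL2 α hα
      have e1 : Q g = g := mehler_apply_gaussian hα a0 a1 hQ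
      have e2 : Q * InnerProductSpace.rankOne ℂ g g = InnerProductSpace.rankOne ℂ g g := by
        ext1 f
        simp [e1]
      have e3 : InnerProductSpace.rankOne ℂ g g * Q = InnerProductSpace.rankOne ℂ g g := by
        ext1 f
        have hs := mehler_isSelfAdjoint hα a0 a1 hQ
        rw [ContinuousLinearMap.isSelfAdjoint_iff'] at hs
        simp only [mul_apply_eq_comp, InnerProductSpace.rankOne_apply]
        rw [← ContinuousLinearMap.adjoint_inner_left, hs, e1]
      have e4 : InnerProductSpace.rankOne ℂ g g * InnerProductSpace.rankOne ℂ g g =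
          InnerProductSpace.rankOne ℂ g g :=
        InnerProductSpace.isIdempotentElem_rankOne_self (norm_gaussianL2 hα)
      rw [pow_succ 2 n, pow_mul, he, sq, sub_mul, mul_sub, mul_sub, e2, e3, e4, sub_self, sub_zero]

/-- Spectral gap of the Mehler kernel: off the ground state it contracts by `ρ`. -/
theorem norm_mehler_sub_rankOne_le (hα : 0 < α) (h0 : 0 < ρ) (h1 : ρ < 1)
    (hP : IsIntegralOperator (fun x y => (mehler α ρ x y : ℂ)) P) :
    ‖P - InnerProductSpace.rankOne ℂ (gaussianL2 α hα) (gaussianL2 α hα)‖ ≤ ρ := by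
  set T := P - InnerProductSpace.rankOne ℂ (gaussianL2 α hα) (gaussianL2 α hα) with hT
  have h2 : 0 < 1 - ρ ^ 2 := by nlinarith
  have hs : IsSelfAdjoint T := by
    refine (mehler_isSelfAdjoint hα h0 h1 hP).sub ?_
    rw [ContinuousLinearMap.isSelfAdjoint_iff', InnerProductSpace.adjoint_rankOne]
  -- For self-adjoint T the norm of T^(2^n) is ‖T‖^(2^n). The Hilbert–Schmidt bound therefore holds
  -- with a constant independent of n, and ‖T‖ > ρ would make (‖T‖/ρ)^(2^n) unbounded. No Hermite
  -- expansion is needed.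
  have hb : ∀ n : ℕ, ‖T‖ ^ 2 ^ n ≤ ρ ^ 2 ^ n / √(1 - ρ ^ 2) := by
    intro n
    obtain ⟨Q, hQ, he⟩ := exists_mehler_pow hα h0 h1 hP n
    rw [← hs.norm_pow_two_pow, hT, he]
    have a0 : 0 < ρ ^ 2 ^ n := pow_pos h0 _
    have a1 : ρ ^ 2 ^ n < 1 := pow_lt_one₀ h0.le h1 (by positivity)
    have a2 : ρ ^ 2 ^ n ≤ ρ := pow_le_of_le_one h0.le h1.le (by positivity)
    refine (norm_mehler_sub_le hα a0 a1 hQ).trans ?_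
    gcongr
  by_contra! hc
  have hq : 1 < ‖T‖ / ρ := by rwa [one_lt_div h0]
  have hlim := tendsto_pow_atTop_atTop_of_one_lt hq
  have hlim2 := hlim.comp (tendsto_pow_atTop_atTop_of_one_lt (r := (2 : ℕ)) one_lt_two)
  obtain ⟨n, hn⟩ := (hlim2.eventually_gt_atTop (1 / √(1 - ρ ^ 2))).exists
  have := hb n
  simp only [Function.comp_apply, div_pow] at hn
  rw [lt_div_iff₀ (by positivity)] at hn
  rw [div_eq_inv_mul, ← one_div] at this
  linarith

/-- Splitting w along g_α and its complement, P acts as 1 on the first part and with norm at most ρ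
on the second. The form tolerates vectors only nearly orthogonal to g_α, as localization produces.
-/
theorem re_inner_mehler_le (hα : 0 < α) (h0 : 0 < ρ) (h1 : ρ < 1)
    (hP : IsIntegralOperator (fun x y => (mehler α ρ x y : ℂ)) P) (w : L2R) :
    (⟪w, P w⟫_ℂ).re ≤ ρ * ‖w‖ ^ 2 + (1 - ρ) * ‖⟪gaussianL2 α hα, w⟫_ℂ‖ ^ 2 := by
  set g := gaussianL2 α hα with hg
  have hn : ‖g‖ = 1 := norm_gaussianL2 hα
  have hgg : ⟪g, g⟫_ℂ = 1 := by rw [inner_self_eq_norm_sq_to_K, hn]; simp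
  set c := ⟪g, w⟫_ℂ with hc
  set T := P - InnerProductSpace.rankOne ℂ g g with hT
  have hTn : ‖T‖ ≤ ρ := norm_mehler_sub_rankOne_le hα h0 h1 hP
  have hPg : P g = g := mehler_apply_gaussian hα h0 h1 hP
  set v := w - c • g with hv
  have hgv : ⟪g, v⟫_ℂ = 0 := by
    rw [hv, inner_sub_right, inner_smul_right, hgg, ← hc]
    ring
  have hTv : P v = T v := by
    rw [hT, sub_apply, InnerProductSpace.rankOne_apply, hgv]
    simp
  have hw : w = v + c • g := by rw [hv]; abel
  have hs := mehler_isSelfAdjoint hα h0 h1 hP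
  rw [ContinuousLinearMap.isSelfAdjoint_iff'] at hs
  have hvg : ⟪v, g⟫_ℂ = 0 := by rw [← inner_conj_symm, hgv]; simp
  have hgPv : ⟪g, P v⟫_ℂ = 0 := by
    rw [← ContinuousLinearMap.adjoint_inner_left, hs, hPg, hgv]
  have hwn : ‖w‖ ^ 2 = ‖v‖ ^ 2 + ‖c‖ ^ 2 := by
    have := norm_add_sq_eq_norm_sq_add_norm_sq_of_inner_eq_zero v (c • g)
      (by rw [inner_smul_right, hvg, mul_zero] : ⟪v, c • g⟫_ℂ = 0)
    rw [← hw, norm_smul, hn, mul_one] at this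
    nlinarith
  have hin : ⟪w, P w⟫_ℂ = ⟪v, T v⟫_ℂ + conj c * c := by
    rw [hw, map_add, map_smul, hPg, inner_add_left, inner_add_right, inner_add_right,
      inner_smul_left, inner_smul_right, inner_smul_right, inner_smul_left, hgPv, hvg, hgg, hTv]
    ring
  have h3 : (⟪v, T v⟫_ℂ).re ≤ ρ * ‖v‖ ^ 2 := by
    calc (⟪v, T v⟫_ℂ).re ≤ ‖⟪v, T v⟫_ℂ‖ := Complex.re_le_norm _
      _ ≤ ‖v‖ * ‖T v‖ := norm_inner_le_norm _ _
      _ ≤ ‖v‖ * (ρ * ‖v‖) := by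
        gcongr
        exact T.le_of_opNorm_le hTn v
      _ = ρ * ‖v‖ ^ 2 := by ring
  have h4 : (conj c * c).re = ‖c‖ ^ 2 := by
    rw [mul_comm, Complex.mul_conj, Complex.ofReal_re, Complex.normSq_eq_norm_sq]
  rw [hin, Complex.add_re, h4, hwn]
  nlinarith

end

/-! ### Uniform local control of the potential -/

open Set Metric in
/-- If `‖f'‖ ≤ C` wherever `Re f ≤ 1`, then `f` stays in the closed unit disc on a small ball. -/
theorem norm_le_one_of_deriv_bound {F : ℂ → ℂ} {C ρ : ℝ} (hC : 0 < C) (hCρ : C * ρ ≤ 1)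
    (hF : ∀ z ∈ ball (0 : ℂ) ρ, DifferentiableAt ℂ F z) (h0 : F 0 = 0)
    (hd : ∀ z ∈ ball (0 : ℂ) ρ, (F z).re ≤ 1 → ‖deriv F z‖ ≤ C) {z : ℂ}
    (hz : z ∈ ball (0 : ℂ) ρ) : ‖F z‖ ≤ 1 := by
  have hzn : ‖z‖ < ρ := by simpa using hz
  have hmem : ∀ t ∈ Icc (0 : ℝ) 1, (t : ℂ) * z ∈ ball (0 : ℂ) ρ := by
    intro t ht
    simp only [mem_ball_zero_iff, norm_mul, Complex.norm_real, Real.norm_of_nonneg ht.1]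
    nlinarith [norm_nonneg z, ht.2, ht.1]
  have hder : ∀ t ∈ Icc (0 : ℝ) 1,
      HasDerivAt (fun t : ℝ => F (t * z)) (deriv F (t * z) * z) t := by
    intro t ht
    have h1 := (hF _ (hmem t ht)).hasDerivAt
    have h2 : HasDerivAt (fun t : ℝ => (t : ℂ) * z) z t := by
      simpa using (Complex.ofRealCLM.hasDerivAt (x := t)).mul_const z
    exact h1.comp t h2
  -- A barrier argument along the ray: ‖F(tz)‖ ≤ t. At a contact point ‖F‖ = t ≤ 1, so the
  -- derivative bound is available and the speed is at most C‖z‖ < 1, strictly below that of the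
  -- barrier.
  have key := image_norm_le_of_norm_deriv_right_lt_deriv_boundary
    (f := fun t : ℝ => F (t * z)) (a := 0) (b := 1) (B := fun t => t) (B' := fun _ => 1)
    (fun t ht => (hder t ht).continuousAt.continuousWithinAt)
    (fun t ht => (hder t (Ico_subset_Icc_self ht)).hasDerivWithinAt)
    (by simp [h0]) (fun t => hasDerivAt_id t) (by
      intro t ht hn
      have ht' := Ico_subset_Icc_self ht
      have h1 : (F (t * z)).re ≤ 1 := (Complex.re_le_norm _).trans (hn.le.trans ht.2.le)
      have h2 := hd _ (hmem t ht') h1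
      rw [norm_mul]
      nlinarith [norm_nonneg z, norm_nonneg (deriv F (t * z))])
  simpa using key (right_mem_Icc.2 zero_le_one)

open Set Metric in
/-- A holomorphic function bounded by one on a ball, with a double zero at the origin, is
quadratic up to a controlled cubic remainder. -/
theorem exists_quadratic_taylor {F : ℂ → ℂ} {ρ : ℝ} (hρ : 0 < ρ)
    (hF : DifferentiableOn ℂ F (ball 0 ρ)) (h0 : F 0 = 0) (h1 : deriv F 0 = 0)
    (hb : ∀ z ∈ ball (0 : ℂ) ρ, ‖F z‖ ≤ 1) :
    ∃ H : ℂ → ℂ, DifferentiableOn ℂ H (ball 0 ρ) ∧ (∀ z, F z = z ^ 2 * H z) ∧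
      ‖H 0‖ ≤ 1 / ρ / ρ ∧
      ∀ z ∈ ball (0 : ℂ) ρ, ‖H z - H 0‖ ≤ 2 * (1 / ρ / ρ) / ρ * ‖z‖ := by
  have hmem : (0 : ℂ) ∈ ball (0 : ℂ) ρ := mem_ball_self hρ
  have hnhds : ball (0 : ℂ) ρ ∈ nhds (0 : ℂ) := ball_mem_nhds _ hρ
  -- Divide by z twice, using the Schwarz lemma each time at the cost of a factor 1/ρ; a third slope
  -- of F2, whose increments are at most 2/ρ², controls the cubic remainder.
  set F1 := dslope F 0 with hF1
  have d1 : DifferentiableOn ℂ F1 (ball 0 ρ) := (Complex.differentiableOn_dslope hnhds).2 hF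
  have b1 : ∀ z ∈ ball (0 : ℂ) ρ, ‖F1 z‖ ≤ 1 / ρ := fun z hz =>
    Complex.norm_dslope_le_div_of_mapsTo_ball hF
      (fun w hw => by simpa [h0] using hb w hw) hz
  have z1 : F1 0 = 0 := by rw [hF1, dslope_same, h1]
  set F2 := dslope F1 0 with hF2
  have d2 : DifferentiableOn ℂ F2 (ball 0 ρ) := (Complex.differentiableOn_dslope hnhds).2 d1
  have b2 : ∀ z ∈ ball (0 : ℂ) ρ, ‖F2 z‖ ≤ 1 / ρ / ρ := fun z hz =>
    Complex.norm_dslope_le_div_of_mapsTo_ball d1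
      (fun w hw => by simpa [z1] using b1 w hw) hz
  have b3 : ∀ z ∈ ball (0 : ℂ) ρ, ‖dslope F2 0 z‖ ≤ 2 * (1 / ρ / ρ) / ρ := fun z hz =>
    Complex.norm_dslope_le_div_of_mapsTo_ball d2
      (fun w hw => by
        rw [mem_closedBall, dist_eq_norm]
        linarith [norm_sub_le (F2 w) (F2 0), b2 w hw, b2 0 hmem]) hz
  refine ⟨F2, d2, fun z => ?_, b2 0 hmem, fun z hz => ?_⟩
  · have e1 := sub_smul_dslope F 0 z
    have e2 := sub_smul_dslope F1 0 z
    simp only [sub_zero, h0, z1, smul_eq_mul] at e1 e2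
    rw [← e1, ← hF1, ← e2, ← hF2]
    ring
  · have e := sub_smul_dslope F2 0 z
    rw [sub_zero, smul_eq_mul] at e
    rw [← e, norm_mul, mul_comm]
    gcongr
    exact b3 z hz

open Set Metric in
/-- Uniform local control of a saddle potential: lower bounds on `Re ζ²` and `|U''(0)|`, an upper
bound on `|U''(0)|`, and the cubic Taylor remainder, in terms of `C` and `c` only. -/
theorem SaddlePotential.exists_uniform_bounds {C c : ℝ} (hC : 0 < C) (hc : 0 < c) :
    ∃ κ₀ r₀ r₁ ρ₀ C₃ : ℝ, 0 < κ₀ ∧ 0 < r₀ ∧ 0 < r₁ ∧ 0 < ρ₀ ∧ 0 < C₃ ∧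
      ∀ (γ : ℝ) (ζ : ℂ) (U : ℝ → ℂ), ‖ζ‖ = 1 → 0 < (ζ ^ 2).re → SaddlePotential ζ C c γ U →
        κ₀ ≤ (ζ ^ 2).re ∧ r₀ ≤ ‖iteratedDeriv 2 U 0‖ ∧ ‖iteratedDeriv 2 U 0‖ ≤ r₁ ∧
        0 < (iteratedDeriv 2 U 0).re ∧
        iteratedDeriv 2 U 0 = ‖iteratedDeriv 2 U 0‖ * (starRingEnd ℂ) (ζ ^ 2) ∧
        (ζ ^ 2 * iteratedDeriv 2 U 0).re = ‖iteratedDeriv 2 U 0‖ ∧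
        ∀ x : ℝ, |x| ≤ ρ₀ → ‖U x - iteratedDeriv 2 U 0 / 2 * x ^ 2‖ ≤ C₃ * |x| ^ 3 := by
  -- The disc must lie in the strip and be small enough for the barrier argument, Cρ ≤ 1.
  set ρ := min c (1 / C) with hρdef
  have hρ : 0 < ρ := by positivity
  have hCρ : C * ρ ≤ 1 := by
    calc C * ρ ≤ C * (1 / C) := by gcongr; exact min_le_right _ _
      _ = 1 := by field_simp
  set r₁ := 2 * (1 / ρ / ρ) with hr1
  have hr1p : 0 < r₁ := by positivity
  -- The bound κ₀ on Re ζ² is derived, not assumed: 2/C ≤ Re u = |u| Re ζ² ≤ r₁ Re ζ².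
  refine ⟨2 / C / r₁, 2 / C, r₁, ρ / 2, r₁ / ρ, by positivity, by positivity, hr1p, by positivity,
    by positivity, fun γ ζ U hζ hκ hU => ?_⟩
  obtain ⟨F, hFa, hFU, hFd⟩ := hU.extension
  have him : ∀ z ∈ ball (0 : ℂ) ρ, |z.im| ≤ c := fun z hz =>
    (Complex.abs_im_le_norm z).trans ((mem_ball_zero_iff.1 hz).le.trans (min_le_left _ _))
  have hdiff : ∀ z ∈ ball (0 : ℂ) ρ, DifferentiableAt ℂ F z := fun z hz =>
    (hFa z (him z hz)).differentiableAt
  have hF0 : F 0 = 0 := by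
    have := hFU 0
    rwa [Complex.ofReal_zero, hU.map_zero] at this
  have hUF : U = fun x : ℝ => F x := funext fun x => (hFU x).symm
  have hmem0 : (0 : ℂ) ∈ ball (0 : ℂ) ρ := mem_ball_self hρ
  have hderU : ∀ x : ℝ, (x : ℂ) ∈ ball (0 : ℂ) ρ → HasDerivAt U (deriv F x) x := by
    intro x hx
    rw [hUF]
    exact (hdiff _ hx).hasDerivAt.comp_ofReal
  have hF1 : deriv F 0 = 0 := by
    have h := (hderU 0 (by simpa using hρ)).deriv
    rw [hU.deriv_zero] at h
    simpa using h.symm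
  -- U4 is invoked only where Re F ≤ 1. There the maximum equals 1, so no constant depends on γ.
  have hFb : ∀ z ∈ ball (0 : ℂ) ρ, ‖F z‖ ≤ 1 := fun z hz =>
    norm_le_one_of_deriv_bound hC hCρ hdiff hF0 (fun w hw hre => by
      have := hFd w (him w hw)
      rwa [max_eq_left hre, Real.one_rpow, mul_one] at this) hz
  obtain ⟨H, hHd, hHF, hH0, hHl⟩ := exists_quadratic_taylor hρ
    (fun z hz => (hdiff z hz).differentiableWithinAt) hF0 hF1 hFb
  -- identify the second derivative
  have hU2 : iteratedDeriv 2 U 0 = 2 * H 0 := by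
    rw [iteratedDeriv_succ, iteratedDeriv_one]
    have hev : deriv U =ᶠ[nhds 0] fun x : ℝ => deriv F x := by
      have : ∀ᶠ x : ℝ in nhds 0, (x : ℂ) ∈ ball (0 : ℂ) ρ := by
        refine (Complex.continuous_ofReal.tendsto 0).eventually ?_
        rw [Complex.ofReal_zero]
        exact ball_mem_nhds (0 : ℂ) hρ
      filter_upwards [this] with x hx
      exact (hderU x hx).deriv
    rw [hev.deriv_eq]
    have hFan : AnalyticAt ℂ F 0 := hFa 0 (him 0 hmem0)
    have h1 : HasDerivAt (deriv F) (deriv (deriv F) 0) ((0 : ℝ) : ℂ) := by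
      simpa using hFan.deriv.differentiableAt.hasDerivAt
    rw [h1.comp_ofReal.deriv]
    have hHat : ∀ z ∈ ball (0 : ℂ) ρ, DifferentiableAt ℂ H z := fun z hz =>
      hHd.differentiableAt (isOpen_ball.mem_nhds hz)
    have hev2 : deriv F =ᶠ[nhds 0] fun z => 2 * z * H z + z ^ 2 * deriv H z := by
      filter_upwards [ball_mem_nhds (0 : ℂ) hρ] with z hz
      have : F = fun z => z ^ 2 * H z := funext hHF
      rw [this, deriv_fun_mul (by fun_prop) (hHat z hz)]
      simp
    rw [hev2.deriv_eq]
    have hHan : AnalyticAt ℂ H 0 := hHd.analyticAt (ball_mem_nhds _ hρ)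
    have d1 : HasDerivAt H (deriv H 0) 0 := (hHat 0 hmem0).hasDerivAt
    have d2 : HasDerivAt (deriv H) (deriv (deriv H) 0) 0 :=
      hHan.deriv.differentiableAt.hasDerivAt
    have d3 := (((hasDerivAt_id (0 : ℂ)).const_mul 2).mul d1).add
      (((hasDerivAt_id (0 : ℂ)).pow 2).mul d2)
    have := d3.deriv
    simp at this
    refine Eq.trans (congrArg (fun f => deriv f 0) (funext fun z => ?_)) this
    simp
  have hUH : ∀ x : ℝ, U x = x ^ 2 * H x := fun x => by rw [← hFU, hHF]
  have hrem : ∀ x : ℝ, |x| ≤ ρ / 2 →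
      ‖U x - iteratedDeriv 2 U 0 / 2 * x ^ 2‖ ≤ r₁ / ρ * |x| ^ 3 := by
    intro x hx
    have hxm : (x : ℂ) ∈ ball (0 : ℂ) ρ := by
      simp only [mem_ball_zero_iff, Complex.norm_real, Real.norm_eq_abs]
      linarith
    have h := hHl _ hxm
    rw [Complex.norm_real, Real.norm_eq_abs] at h
    rw [hU2, hUH, show (x : ℂ) ^ 2 * H x - 2 * H 0 / 2 * x ^ 2 = x ^ 2 * (H x - H 0) by ring,
      norm_mul, norm_pow, Complex.norm_real, Real.norm_eq_abs]
    calc |x| ^ 2 * ‖H x - H 0‖ ≤ |x| ^ 2 * (r₁ / ρ * |x|) := by gcongr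
      _ = r₁ / ρ * |x| ^ 3 := by ring
  set u := iteratedDeriv 2 U 0 with hu
  have hz2 : ‖ζ ^ 2‖ = 1 := by rw [norm_pow, hζ, one_pow]
  have hreal : ζ ^ 2 * u = ‖u‖ := by
    have h1 : ζ ^ 2 * u = ((ζ ^ 2 * u).re : ℂ) := by
      refine Complex.ext (Complex.ofReal_re _).symm ?_
      rw [Complex.ofReal_im, hu, hU.rotated_im]
    have h2 : ‖ζ ^ 2 * u‖ = (ζ ^ 2 * u).re := by
      rw [h1, Complex.norm_real, Complex.ofReal_re, Real.norm_of_nonneg hU.rotated_pos.le]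
    rw [h1, ← h2, norm_mul, hz2, one_mul]
  have hconj : u = ‖u‖ * (starRingEnd ℂ) (ζ ^ 2) := by
    rw [← hreal, mul_assoc, mul_comm u, ← mul_assoc, Complex.mul_conj, Complex.normSq_eq_norm_sq,
      hz2]
    simp
  have hure : u.re = ‖u‖ * (ζ ^ 2).re := by
    conv_lhs => rw [hconj]
    rw [Complex.re_ofReal_mul, Complex.conj_re]
  have hu1 : ‖u‖ ≤ r₁ := by
    rw [hU2, norm_mul, Complex.norm_ofNat, hr1]
    gcongr
  -- the lower bound on the real part
  have hlow : 2 / C ≤ u.re := by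
    have hten : Filter.Tendsto (fun x : ℝ => (H x).re) (nhdsWithin 0 (Ioi 0)) (nhds (H 0).re) := by
      have hcH : ContinuousAt H ((0 : ℝ) : ℂ) := by
        simpa using (hHd.differentiableAt (ball_mem_nhds _ hρ)).continuousAt
      have := (Complex.continuous_re.continuousAt.comp
        (hcH.comp Complex.continuous_ofReal.continuousAt))
      have h2 := this.tendsto.mono_left (nhdsWithin_le_nhds (s := Ioi (0 : ℝ)))
      simpa [Function.comp_def] using h2
    have hge : ∀ᶠ x : ℝ in nhdsWithin 0 (Ioi 0), 1 / C ≤ (H x).re := by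
      filter_upwards [Ioo_mem_nhdsGT (zero_lt_one (α := ℝ))] with x hx
      have h := hU.lower x
      have hx2 : |x| ^ 2 = x ^ 2 := sq_abs x
      have hx3 : x ^ 2 ≤ 1 := by nlinarith [hx.1, hx.2]
      rw [hx2, min_eq_right hx3, hUH, ← Complex.ofReal_pow, Complex.re_ofReal_mul] at h
      have hx4 : 0 < x ^ 2 := pow_pos hx.1 2
      nlinarith
    have := ge_of_tendsto hten hge
    have e : u.re = 2 * (H 0).re := by rw [hU2]; simp
    rw [e]
    have : 2 / C = 2 * (1 / C) := by ring
    linarith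
  have hnu : 2 / C ≤ ‖u‖ := hlow.trans (Complex.re_le_norm u)
  have h2C : 0 < 2 / C := by positivity
  refine ⟨?_, hnu, hu1, h2C.trans_le hlow, hconj, by rw [hreal, Complex.ofReal_re], hrem⟩
  rw [div_le_iff₀ hr1p]
  calc 2 / C ≤ ‖u‖ * (ζ ^ 2).re := by rw [← hure]; exact hlow
    _ ≤ r₁ * (ζ ^ 2).re := by gcongr
    _ = (ζ ^ 2).re * r₁ := mul_comm _ _

/-! ### Complex exponentials and principal square roots -/

theorem norm_cexp_sub_cexp_le {z w : ℂ} (hz : z.re ≤ 0) (hw : w.re ≤ 0) :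
    ‖Complex.exp z - Complex.exp w‖ ≤ ‖z - w‖ := by
  have h := Convex.norm_image_sub_le_of_norm_deriv_le (𝕜 := ℂ) (f := Complex.exp) (C := 1)
    (s := {z : ℂ | z.re ≤ 0}) (x := w) (y := z)
    (fun x _ => Complex.differentiable_exp x)
    (fun x hx => by
      rw [Complex.deriv_exp, Complex.norm_exp, Real.exp_le_one_iff]
      exact hx)
    (convex_halfSpace_re_le 0) hw hz
  simpa using h

theorem norm_cexp_sub_one_le (z : ℂ) : ‖Complex.exp z - 1‖ ≤ ‖z‖ * Real.exp ‖z‖ := by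
  have := Complex.norm_exp_sub_sum_le_norm_mul_exp z 1
  simpa using this

theorem sq_cpow_half (z : ℂ) : (z ^ (1 / 2 : ℂ)) ^ 2 = z := by
  have := Complex.cpow_nat_inv_pow z two_ne_zero
  rwa [Nat.cast_ofNat, ← one_div] at this

theorem norm_cpow_half_sq (z : ℂ) : ‖z ^ (1 / 2 : ℂ)‖ ^ 2 = ‖z‖ := by
  rw [← norm_pow, sq_cpow_half]

theorem cpow_half_re_nonneg (z : ℂ) : 0 ≤ (z ^ (1 / 2 : ℂ)).re := by
  rw [one_div, Complex.cpow_inv_two_re]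
  positivity

/-- Both roots p, q lie in the sector |arg| ≤ π/4, so their sum cannot cancel: |p + q| ≥ |q|. Then
factor p² - q². -/
theorem norm_cpow_half_sub_le {z w : ℂ} (hz : 0 < z.re) (hw : 0 < w.re) :
    ‖z ^ (1 / 2 : ℂ) - w ^ (1 / 2 : ℂ)‖ * ‖w‖ ≤ ‖w ^ (1 / 2 : ℂ)‖ * ‖z - w‖ := by
  set p := z ^ (1 / 2 : ℂ) with hp
  set q := w ^ (1 / 2 : ℂ) with hq
  have p2 : p ^ 2 = z := sq_cpow_half z
  have q2 : q ^ 2 = w := sq_cpow_half w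
  have p0 : 0 ≤ p.re := cpow_half_re_nonneg z
  have q0 : 0 ≤ q.re := cpow_half_re_nonneg w
  have p3 : p.im ^ 2 ≤ p.re ^ 2 := by
    have := congrArg Complex.re p2
    rw [sq, Complex.mul_re] at this
    nlinarith
  have q3 : q.im ^ 2 ≤ q.re ^ 2 := by
    have := congrArg Complex.re q2
    rw [sq, Complex.mul_re] at this
    nlinarith
  have h1 : ‖q‖ ≤ ‖p + q‖ := by
    rw [← abs_of_nonneg (norm_nonneg q), ← abs_of_nonneg (norm_nonneg (p + q)), ← sq_le_sq,
      ← Complex.normSq_eq_norm_sq, ← Complex.normSq_eq_norm_sq, Complex.normSq_apply,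
      Complex.normSq_apply, Complex.add_re, Complex.add_im]
    have h2 : |p.im * q.im| ≤ p.re * q.re := by
      rw [abs_mul]
      exact mul_le_mul (abs_le_of_sq_le_sq p3 p0) (abs_le_of_sq_le_sq q3 q0) (abs_nonneg _) p0
    nlinarith [neg_abs_le (p.im * q.im), sq_nonneg p.re, sq_nonneg p.im]
  rw [← q2, ← p2, show p ^ 2 - q ^ 2 = (p + q) * (p - q) by ring, norm_mul, norm_pow]
  nlinarith [norm_nonneg q, norm_nonneg (p - q), mul_nonneg (norm_nonneg q) (norm_nonneg (p - q))]

/-! ### The Gaussian as an approximate eigenfunction -/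

/-- Global cubic comparison of `exp (-U/2)` with its Gaussian approximation. -/
theorem norm_exp_sub_gaussian_le {U : ℝ → ℂ} {u : ℂ} {ρ₀ C₃ : ℝ} (hρ : 0 < ρ₀) (hC₃ : 0 < C₃)
    (hU : ∀ x, 0 ≤ (U x).re) (hu : 0 ≤ u.re)
    (hT : ∀ x : ℝ, |x| ≤ ρ₀ → ‖U x - u / 2 * x ^ 2‖ ≤ C₃ * |x| ^ 3) (x : ℝ) :
    ‖Complex.exp (-(U x / 2)) - Complex.exp (-(u / 4 * x ^ 2))‖ ≤
      (C₃ + 2 / ρ₀ ^ 3) * |x| ^ 3 := by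
  have r1 : (-(U x / 2)).re ≤ 0 := by
    have : (-(U x / 2)).re = -((U x).re / 2) := by simp
    rw [this]
    linarith [hU x]
  have r2 : (-(u / 4 * x ^ 2)).re ≤ 0 := by
    have : (-(u / 4 * x ^ 2)).re = -(u.re / 4 * x ^ 2) := by
      rw [Complex.neg_re, ← Complex.ofReal_pow, Complex.re_mul_ofReal]
      simp
    rw [this]
    have := mul_nonneg hu (sq_nonneg x)
    linarith
  have a0 : 0 ≤ |x| ^ 3 := by positivity
  -- Near 0, `exp` is 1-Lipschitz on the left half-plane and the Taylor bound applies; beyond ρ₀ the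
  -- trivial bound 2 is at most 2|x|³/ρ₀³.
  rcases le_total |x| ρ₀ with hx | hx
  · refine (norm_cexp_sub_cexp_le r1 r2).trans ?_
    rw [show -(U x / 2) - -(u / 4 * x ^ 2) = -(1 / 2) * (U x - u / 2 * x ^ 2) by ring, norm_mul]
    have h := hT x hx
    have h2 : ‖(-(1 / 2) : ℂ)‖ = 1 / 2 := by simp
    rw [h2]
    have : 0 ≤ 2 / ρ₀ ^ 3 * |x| ^ 3 := by positivity
    nlinarith [mul_nonneg hC₃.le a0]
  · have e1 : ‖Complex.exp (-(U x / 2))‖ ≤ 1 := by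
      rw [Complex.norm_exp, Real.exp_le_one_iff]; exact r1
    have e2 : ‖Complex.exp (-(u / 4 * x ^ 2))‖ ≤ 1 := by
      rw [Complex.norm_exp, Real.exp_le_one_iff]; exact r2
    have h3 : 2 ≤ 2 / ρ₀ ^ 3 * |x| ^ 3 := by
      rw [div_mul_eq_mul_div, le_div_iff₀ (by positivity)]
      gcongr
    calc _ ≤ 1 + 1 := (norm_sub_le _ _).trans (add_le_add e1 e2)
      _ ≤ _ := by nlinarith [mul_nonneg hC₃.le a0]

/-- From y³/6 ≤ e^y at y = αx²/2 one gets α³x⁶ ≤ 48e^y, and 48 < 7². This trades |x|³ for α^(-3/2)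
and a fraction of the Gaussian decay. -/
theorem abs_cube_le {α : ℝ} (hα : 0 < α) (x : ℝ) :
    |x| ^ 3 ≤ 7 / (α * √α) * Real.exp (α / 4 * x ^ 2) := by
  have h := Real.pow_div_factorial_le_exp (α / 2 * x ^ 2) (by positivity) 3
  have h2 : (|x| ^ 3) ^ 2 ≤ (7 / (α * √α) * Real.exp (α / 4 * x ^ 2)) ^ 2 := by
    rw [mul_pow, div_pow, mul_pow, Real.sq_sqrt hα.le, ← Real.exp_nat_mul]
    have e1 : (|x| ^ 3) ^ 2 = x ^ 6 := by rw [← pow_mul]; exact Even.pow_abs (by decide) x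
    have e2 : ((2 : ℕ) : ℝ) * (α / 4 * x ^ 2) = α / 2 * x ^ 2 := by push_cast; ring
    rw [e1, e2, div_mul_eq_mul_div, le_div_iff₀ (by positivity)]
    norm_num [Nat.factorial] at h
    have h3 : x ^ 6 * (α ^ 2 * α) = 8 * (α / 2 * x ^ 2) ^ 3 := by ring
    rw [h3]
    nlinarith [Real.exp_pos (α / 2 * x ^ 2)]
  exact le_of_sq_le_sq h2 (by positivity)

/-- The dominating profile has squared norm 2B², rounded up to 4B². The slower rate α/4 leaves room
for polynomial factors absorbed into exponentials. -/
theorem norm_le_of_ae_gaussian_bound {α B : ℝ} (hα : 0 < α) (hB : 0 ≤ B) {f : L2R}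
    (h : ∀ᵐ x : ℝ, ‖f x‖ ≤ B * ((2 * α / Real.pi) ^ (1 / 4 : ℝ) * Real.exp (-(α / 4) * x ^ 2))) :
    ‖f‖ ≤ 2 * B := by
  refine norm_le_of_lintegral_le (by positivity) ?_
  have hn : (0 : ℝ) < 2 * α / Real.pi := by positivity
  have hsq : ∀ x : ℝ, (B * ((2 * α / Real.pi) ^ (1 / 4 : ℝ) * Real.exp (-(α / 4) * x ^ 2))) ^ 2 =
      B ^ 2 * √(2 * α / Real.pi) * Real.exp (-(α / 2) * x ^ 2) := by
    intro x
    rw [mul_pow, mul_pow, ← Real.exp_nat_mul, ← Real.rpow_natCast ((2 * α / Real.pi) ^ (1 / 4 : ℝ)),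
      ← Real.rpow_mul hn.le, Real.sqrt_eq_rpow]
    have e2 : ((2 : ℕ) : ℝ) * (-(α / 4) * x ^ 2) = -(α / 2) * x ^ 2 := by push_cast; ring
    rw [e2]
    norm_num
    ring
  calc ∫⁻ y, ‖f y‖ₑ ^ 2
      ≤ ∫⁻ x, ENNReal.ofReal (B ^ 2 * √(2 * α / Real.pi) * Real.exp (-(α / 2) * x ^ 2)) := by
        refine lintegral_mono_ae ?_
        filter_upwards [h] with x hx
        rw [← hsq, ← ofReal_norm, ← ENNReal.ofReal_pow (norm_nonneg _)]
        refine ENNReal.ofReal_le_ofReal ?_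
        gcongr
    _ = ENNReal.ofReal (B ^ 2 * 2) := by
        rw [← ofReal_integral_eq_lintegral_ofReal
          ((integrable_exp_neg_mul_sq (by positivity)).const_mul _)
          (Filter.Eventually.of_forall fun x => by positivity), integral_const_mul,
          integral_gaussian, mul_assoc, ← Real.sqrt_mul hn.le]
        congr 2
        rw [show 2 * α / Real.pi * (Real.pi / (α / 2)) = 2 ^ 2 by field_simp]
        exact Real.sqrt_sq (by norm_num)
    _ ≤ ENNReal.ofReal (2 * B) ^ 2 := by
        rw [← ENNReal.ofReal_pow (by positivity)]
        refine ENNReal.ofReal_le_ofReal ?_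
        nlinarith [sq_nonneg B]

theorem continuous_gaussianReal₁ (α : ℝ) : Continuous (gaussianReal₁ α) := by
  unfold gaussianReal₁
  fun_prop

/-- A Gaussian smoothed by a complex Gaussian convolution kernel. -/
theorem integral_gaussian_convolution {a b : ℂ} {α : ℝ} (h : 0 < (a + b + α).re) (x : ℝ) :
    ∫ y : ℝ, Complex.exp (-(a * ((x : ℂ) - y) ^ 2)) *
      (Complex.exp (-(b * y ^ 2)) * (gaussianReal₁ α y : ℂ)) =
      ((2 * α / Real.pi) ^ (1 / 4 : ℝ) : ℝ) * (Real.pi / (a + b + α)) ^ (1 / 2 : ℂ) *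
        Complex.exp (-((α + b ^ 2 / (a + b + α) + (2 * a * b - α ^ 2) / (a + b + α) - b) * x ^ 2)) := by
  have hne : a + b + α ≠ 0 := fun h0 => by simp [h0] at h
  have key : ∀ y : ℝ, Complex.exp (-(a * ((x : ℂ) - y) ^ 2)) *
      (Complex.exp (-(b * y ^ 2)) * (gaussianReal₁ α y : ℂ)) =
      ((2 * α / Real.pi) ^ (1 / 4 : ℝ) : ℝ) *
        Complex.exp (-(a + b + α) * y ^ 2 + 2 * a * x * y + -(a * x ^ 2)) := by
    intro y
    unfold gaussianReal₁
    push_cast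
    rw [mul_left_comm (Complex.exp (-(b * y ^ 2))), mul_left_comm (Complex.exp (-(a * _))),
      ← Complex.exp_add, ← Complex.exp_add]
    congr 2
    ring
  simp only [key]
  rw [integral_const_mul, integral_cexp_quadratic (by rw [Complex.neg_re]; linarith), neg_neg, ← mul_assoc]
  congr 2
  field_simp
  ring

/-- Three replacements: E by its Gaussian model (cubic error), the prefactor s by μ, and the
exponent α + ε by α. The last two are O(δ), and every factor e^{αx²/4} lost on the way is paid for
by e^{-αx²}. -/
theorem norm_gaussian_error_le {E b ε s μ : ℂ} {α n C₄ δ : ℝ} {x : ℝ} (hα : 1 ≤ α) (hn : 0 ≤ n)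
    (hE : ‖E - Complex.exp (-(b * x ^ 2))‖ ≤ C₄ * |x| ^ 3) (hs : ‖s - μ‖ ≤ ‖μ‖ * δ)
    (hε : ‖ε‖ ≤ δ) (hδ : δ ≤ 1) (hδb : δ + ‖b‖ ≤ α / 4) (hC₄ : 0 ≤ C₄) :
    ‖E * (n * s * Complex.exp (-((α + ε - b) * x ^ 2))) -
        μ * (n * Complex.exp (-(α * x ^ 2)))‖ ≤
      ‖μ‖ * (14 * C₄ / (α * √α) + 5 * δ) * (n * Real.exp (-(α / 4) * x ^ 2)) := by
  have hα0 : 0 < α := by linarith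
  have hδ0 : 0 ≤ δ := (norm_nonneg _).trans hε
  have hx2 : 0 ≤ x ^ 2 := sq_nonneg x
  have hs2 : ‖s‖ ≤ 2 * ‖μ‖ := by
    have : ‖s‖ ≤ ‖s - μ‖ + ‖μ‖ := by simpa using norm_add_le (s - μ) μ
    nlinarith [norm_nonneg μ]
  have hre : ∀ z : ℂ, (z * (x : ℂ) ^ 2).re = z.re * x ^ 2 := fun z => by
    rw [← Complex.ofReal_pow, Complex.re_mul_ofReal]
  have dec : E * (n * s * Complex.exp (-((α + ε - b) * x ^ 2))) -
      μ * (n * Complex.exp (-(α * x ^ 2))) =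
      (E - Complex.exp (-(b * x ^ 2))) * (n * s * Complex.exp (-((α + ε - b) * x ^ 2))) +
      n * Complex.exp (-(α * x ^ 2)) * ((s - μ) * Complex.exp (-(ε * x ^ 2)) +
        μ * (Complex.exp (-(ε * x ^ 2)) - 1)) := by
    have e1 : Complex.exp (-((α + ε - b) * x ^ 2)) * Complex.exp (-(b * x ^ 2)) =
        Complex.exp (-(α * x ^ 2)) * Complex.exp (-(ε * x ^ 2)) := by
      rw [← Complex.exp_add, ← Complex.exp_add]
      congr 1
      ring
    linear_combination n * s * e1
  rw [dec]
  have t1 : ‖(E - Complex.exp (-(b * x ^ 2))) * (n * s * Complex.exp (-((α + ε - b) * x ^ 2)))‖ ≤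
      ‖μ‖ * (14 * C₄ / (α * √α)) * (n * Real.exp (-(α / 4) * x ^ 2)) := by
    have e2 : ‖Complex.exp (-((α + ε - b) * x ^ 2))‖ ≤ Real.exp (-(α / 2) * x ^ 2) := by
      rw [Complex.norm_exp, Real.exp_le_exp, Complex.neg_re, hre, neg_mul, neg_le_neg_iff]
      gcongr
      have h1 := (abs_le.1 (Complex.abs_re_le_norm ε)).1
      have h2 := (abs_le.1 (Complex.abs_re_le_norm b)).2
      simp only [Complex.sub_re, Complex.add_re, Complex.ofReal_re]
      linarith
    have e3 := abs_cube_le hα0 x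
    rw [norm_mul, norm_mul, norm_mul, Complex.norm_real, Real.norm_of_nonneg hn]
    calc ‖E - Complex.exp (-(b * x ^ 2))‖ * (n * ‖s‖ * ‖Complex.exp (-((α + ε - b) * x ^ 2))‖)
        ≤ (C₄ * (7 / (α * √α) * Real.exp (α / 4 * x ^ 2))) *
            (n * (2 * ‖μ‖) * Real.exp (-(α / 2) * x ^ 2)) := by
          gcongr
          exact hE.trans (by gcongr)
      _ = ‖μ‖ * (14 * C₄ / (α * √α)) *
            (n * (Real.exp (α / 4 * x ^ 2) * Real.exp (-(α / 2) * x ^ 2))) := by ring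
      _ = _ := by
          rw [← Real.exp_add]
          ring_nf
  have t2 : ‖(n : ℂ) * Complex.exp (-(α * x ^ 2)) * ((s - μ) * Complex.exp (-(ε * x ^ 2)) +
        μ * (Complex.exp (-(ε * x ^ 2)) - 1))‖ ≤
      ‖μ‖ * (5 * δ) * (n * Real.exp (-(α / 4) * x ^ 2)) := by
    have hεx : ‖-(ε * (x : ℂ) ^ 2)‖ ≤ δ * x ^ 2 := by
      rw [norm_neg, norm_mul, norm_pow, Complex.norm_real, Real.norm_eq_abs, sq_abs]
      gcongr
    have hδx : δ * x ^ 2 ≤ α / 4 * x ^ 2 := by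
      gcongr
      linarith [norm_nonneg b]
    have f1 : ‖Complex.exp (-(ε * x ^ 2))‖ ≤ Real.exp (α / 4 * x ^ 2) :=
      (Complex.norm_exp_le_exp_norm _).trans (Real.exp_le_exp.2 (hεx.trans hδx))
    have f2 : ‖Complex.exp (-(ε * x ^ 2)) - 1‖ ≤ δ * x ^ 2 * Real.exp (α / 4 * x ^ 2) := by
      refine (norm_cexp_sub_one_le _).trans ?_
      gcongr
      exact hεx.trans hδx
    have f3 : 1 + x ^ 2 ≤ 5 * Real.exp (α / 4 * x ^ 2) := by
      have := Real.add_one_le_exp (α / 4 * x ^ 2)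
      nlinarith
    have f4 : ‖Complex.exp (-(α * x ^ 2 : ℂ))‖ = Real.exp (-α * x ^ 2) := by
      rw [Complex.norm_exp, Complex.neg_re, hre, Complex.ofReal_re, neg_mul]
    rw [norm_mul, norm_mul, Complex.norm_real, Real.norm_of_nonneg hn, f4]
    have f5 : ‖(s - μ) * Complex.exp (-(ε * x ^ 2)) + μ * (Complex.exp (-(ε * x ^ 2)) - 1)‖ ≤
        ‖μ‖ * (5 * δ) * (Real.exp (α / 4 * x ^ 2) * Real.exp (α / 4 * x ^ 2)) := by
      refine (norm_add_le _ _).trans ?_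
      rw [norm_mul, norm_mul]
      calc ‖s - μ‖ * ‖Complex.exp (-(ε * x ^ 2))‖ + ‖μ‖ * ‖Complex.exp (-(ε * x ^ 2)) - 1‖
          ≤ ‖μ‖ * δ * Real.exp (α / 4 * x ^ 2) + ‖μ‖ * (δ * x ^ 2 * Real.exp (α / 4 * x ^ 2)) := by
            gcongr
        _ = ‖μ‖ * δ * Real.exp (α / 4 * x ^ 2) * (1 + x ^ 2) := by ring
        _ ≤ ‖μ‖ * δ * Real.exp (α / 4 * x ^ 2) * (5 * Real.exp (α / 4 * x ^ 2)) := by gcongr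
        _ = _ := by ring
    calc n * Real.exp (-α * x ^ 2) * _
        ≤ n * Real.exp (-α * x ^ 2) *
          (‖μ‖ * (5 * δ) * (Real.exp (α / 4 * x ^ 2) * Real.exp (α / 4 * x ^ 2))) := by gcongr
      _ = ‖μ‖ * (5 * δ) * (n * Real.exp (-(α / 2) * x ^ 2)) := by
          rw [show -(α / 2) * x ^ 2 = -α * x ^ 2 + (α / 4 * x ^ 2 + α / 4 * x ^ 2) by ring,
            Real.exp_add, Real.exp_add]
          ring
      _ ≤ _ := by
          gcongr
          linarith
  calc _ ≤ _ := norm_add_le _ _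
    _ ≤ _ := add_le_add t1 t2
    _ = _ := by ring

/-- The shift b in the denominator appears in the exact Gaussian integral but not in μ; relatively
to μ it costs only |b|/|z + b|. -/
theorem norm_cpow_half_div_sub_le {z b : ℂ} (hz : 0 < z.re) (hzb : 0 < (z + b).re) :
    ‖(Real.pi / (z + b)) ^ (1 / 2 : ℂ) - (Real.pi / z) ^ (1 / 2 : ℂ)‖ ≤
      ‖(Real.pi / z) ^ (1 / 2 : ℂ)‖ * (‖b‖ / ‖z + b‖) := by
  have hz0 : z ≠ 0 := fun h => by simp [h] at hz
  have hzb0 : z + b ≠ 0 := fun h => by simp [h] at hzb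
  have hpos : ∀ w : ℂ, 0 < w.re → 0 < (Real.pi / w).re := by
    intro w hw
    have hw0 : w ≠ 0 := fun h => by simp [h] at hw
    have : 0 < Complex.normSq w := Complex.normSq_pos.2 hw0
    rw [Complex.div_re]
    have := Real.pi_pos
    simp only [Complex.ofReal_re, Complex.ofReal_im, zero_mul, zero_div, add_zero]
    positivity
  have h := norm_cpow_half_sub_le (hpos _ hzb) (hpos _ hz)
  have hd : (Real.pi : ℂ) / (z + b) - Real.pi / z = Real.pi / z * (-(b / (z + b))) := by
    field_simp
    ring
  rw [hd, norm_mul, norm_neg, norm_div b] at h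
  have hw : 0 < ‖(Real.pi : ℂ) / z‖ := by
    rw [norm_pos_iff]
    exact div_ne_zero (by exact_mod_cast Real.pi_ne_zero) hz0
  refine le_of_mul_le_mul_right ?_ hw
  linarith

/-- The Gaussian `g_α` is an approximate eigenfunction of the operator with kernel
`exp (-W² v (x - y)² - U(x)/2 - U(y)/2)`, with eigenvalue `μ = √(π / (W² v + α))`. -/
theorem norm_apply_gaussian_sub_le {v u : ℂ} {U : ℝ → ℂ} {W α κ₀ r₁ C₄ : ℝ} {K : L2R →L[ℂ] L2R}
    (hα : 0 < α) (hW : 1 ≤ W) (hκ₀ : 0 < κ₀) (hv1 : ‖v‖ = 1) (hv : κ₀ ≤ v.re)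
    (hu : 0 ≤ u.re) (hur : ‖u‖ ≤ r₁) (h2 : (W : ℂ) ^ 2 * v * u = 2 * (α : ℂ) ^ 2)
    (hUc : Continuous U) (hU : ∀ x, 0 ≤ (U x).re) (hC₄ : 0 ≤ C₄)
    (hcub : ∀ x : ℝ, ‖Complex.exp (-(U x / 2)) - Complex.exp (-(u / 4 * x ^ 2))‖ ≤ C₄ * |x| ^ 3)
    (hcW : r₁ / (4 * κ₀) + r₁ ^ 2 / (16 * κ₀) ≤ W) (hαr : 4 + r₁ ≤ α)
    (hK : IsIntegralOperator (fun x y : ℝ =>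
      Complex.exp (-((W : ℂ) ^ 2 * v * ((x : ℂ) - (y : ℂ)) ^ 2) - U x / 2 - U y / 2)) K) :
    ‖((Real.pi / ((W : ℂ) ^ 2 * v + α)) ^ (1 / 2 : ℂ))⁻¹ • K (gaussianL2 α hα) -
        gaussianL2 α hα‖ ≤
      14 * C₄ * (√((W ^ 2 + α) / (W ^ 2 * κ₀)) + 2) / (α * √α) +
        10 * ((r₁ / (4 * κ₀) + r₁ ^ 2 / (16 * κ₀)) / W ^ 2) := by
  have hW0 : 0 < W := by linarith
  have hr₁ : 0 ≤ r₁ := (norm_nonneg u).trans hur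
  set g := gaussianL2 α hα with hg
  set n : ℝ := (2 * α / Real.pi) ^ (1 / 4 : ℝ) with hn
  have hn0 : 0 < n := by rw [hn]; positivity
  set a : ℂ := (W : ℂ) ^ 2 * v with ha
  set b : ℂ := u / 4 with hb
  set c : ℝ := r₁ / (4 * κ₀) + r₁ ^ 2 / (16 * κ₀) with hc
  have hc0 : 0 ≤ c := by positivity
  have hare : W ^ 2 * κ₀ ≤ a.re := by
    rw [ha, ← Complex.ofReal_pow, Complex.re_ofReal_mul]
    gcongr
  have hnorma : ‖a‖ = W ^ 2 := by rw [ha, norm_mul, hv1]; simp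
  have hWκ : 0 < W ^ 2 * κ₀ := by positivity
  have hbn : ‖b‖ ≤ r₁ / 4 := by
    rw [hb, norm_div]
    simp only [Complex.norm_ofNat]
    gcongr
  have hbre : 0 ≤ b.re := by
    have : b.re = u.re / 4 := by rw [hb]; simp
    rw [this]
    linarith
  -- This is the equation that determines α. It cancels the leading defect in the exponent of the
  -- smoothed Gaussian and leaves only ε = b²/(a + b + α) = O(W^(-2)).
  have h2ab : 2 * a * b - (α : ℂ) ^ 2 = 0 := by
    rw [hb]
    linear_combination (1 / 2 : ℂ) * h2
  have hsre : W ^ 2 * κ₀ ≤ (a + b + α).re := by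
    rw [Complex.add_re, Complex.add_re, Complex.ofReal_re]
    linarith
  have hs1re : 0 < (a + α).re := by
    rw [Complex.add_re, Complex.ofReal_re]; linarith
  have hsn : W ^ 2 * κ₀ ≤ ‖a + b + α‖ := hsre.trans (Complex.re_le_norm _)
  have hspos : 0 < ‖a + b + α‖ := hWκ.trans_le hsn
  have hs1ne : a + α ≠ 0 := fun h0 => by simp [h0] at hs1re
  set μ : ℂ := (Real.pi / (a + α)) ^ (1 / 2 : ℂ) with hμ
  set s : ℂ := (Real.pi / (a + b + α)) ^ (1 / 2 : ℂ) with hs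
  have hμ2 : ‖μ‖ ^ 2 = Real.pi / ‖a + α‖ := by
    rw [hμ, norm_cpow_half_sq, norm_div, Complex.norm_real, Real.norm_of_nonneg Real.pi_pos.le]
  have hμpos : 0 < ‖μ‖ := by
    have h1 : 0 < ‖μ‖ ^ 2 := by
      rw [hμ2]
      have := norm_pos_iff.2 hs1ne
      positivity
    exact (norm_nonneg _).lt_of_ne' (fun h0 => by simp [h0] at h1)
  have hμne : μ ≠ 0 := norm_pos_iff.1 hμpos
  set δ := c / W ^ 2 with hδ
  have hbs : ‖b‖ / ‖a + b + α‖ ≤ r₁ / (4 * κ₀) / W ^ 2 := by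
    calc ‖b‖ / ‖a + b + α‖ ≤ (r₁ / 4) / (W ^ 2 * κ₀) := by gcongr
      _ = r₁ / (4 * κ₀) / W ^ 2 := by field_simp
  have hsμ : ‖s - μ‖ ≤ ‖μ‖ * δ := by
    have h := norm_cpow_half_div_sub_le (z := a + α) (b := b) hs1re
      (by rw [add_right_comm]; exact hWκ.trans_le hsre)
    rw [add_right_comm, ← hs, ← hμ] at h
    refine h.trans ?_
    gcongr
    refine hbs.trans ?_
    rw [hδ]
    gcongr
    rw [hc]
    have : 0 ≤ r₁ ^ 2 / (16 * κ₀) := by positivity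
    linarith
  set ε : ℂ := b ^ 2 / (a + b + α) with hε
  have hεn : ‖ε‖ ≤ δ := by
    rw [hε, norm_div, norm_pow]
    calc ‖b‖ ^ 2 / ‖a + b + α‖ ≤ (r₁ / 4) ^ 2 / (W ^ 2 * κ₀) := by gcongr
      _ = r₁ ^ 2 / (16 * κ₀) / W ^ 2 := by field_simp; norm_num
      _ ≤ δ := by
        rw [hδ]
        gcongr
        rw [hc]
        have : 0 ≤ r₁ / (4 * κ₀) := by positivity
        linarith
  have hδ1 : δ ≤ 1 := by
    rw [hδ, div_le_one (by positivity)]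
    nlinarith
  -- The origin of the threshold 4 + r₁ ≤ α: here δ ≤ 1 and ‖b‖ ≤ r₁/4.
  have hδb : δ + ‖b‖ ≤ α / 4 := by linarith
  have hα1 : 1 ≤ α := by linarith
  -- the Gaussian convolution operator
  set k₀ : ℝ → ℝ → ℂ := fun x y => Complex.exp (-(a * ((x : ℂ) - y) ^ 2)) with hk₀
  have hk₀S : SchurKernel k₀ (1 * √(Real.pi / (W ^ 2 * κ₀))) := by
    refine SchurKernel.of_gaussian_bound ?_ zero_le_one hWκ fun x y => ?_
    · refine Continuous.measurable ?_
      simp only [hk₀]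
      fun_prop
    · have : ((x : ℂ) - y) ^ 2 = (((x - y) ^ 2 : ℝ) : ℂ) := by push_cast; ring
      rw [hk₀, Complex.norm_exp, one_mul, Real.exp_le_exp, Complex.neg_re, this,
        Complex.re_mul_ofReal]
      nlinarith [sq_nonneg (x - y)]
  obtain ⟨G, hG, hGn⟩ := hk₀S.exists_isIntegralOperator
  rw [one_mul] at hGn
  set e : ℝ → ℂ := fun x => Complex.exp (-(U x / 2)) with he
  have hec : Continuous e := by rw [he]; fun_prop
  have he1 : ∀ x, ‖e x‖ ≤ 1 := by
    intro x
    have : (-(U x / 2)).re = -((U x).re / 2) := by simp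
    rw [he, Complex.norm_exp, Real.exp_le_one_iff, this]
    linarith [hU x]
  -- The right-hand factor e^{-U(y)/2} is replaced by its Gaussian model. The error φ is small in L₂
  -- and is pushed through the bounded convolution G; the left-hand factor is replaced pointwise
  -- afterwards.
  set φ : ℝ → ℂ := fun x => (e x - Complex.exp (-(b * x ^ 2))) * (gaussianReal₁ α x : ℂ) with hφ
  have hgl : MemLp (fun x => (gaussianReal₁ α x : ℂ)) 2 volume := memLp_gaussianFun hα
  have he0c : Continuous fun x : ℝ => Complex.exp (-(b * x ^ 2)) := by fun_prop
  have he01 : ∀ x : ℝ, ‖Complex.exp (-(b * x ^ 2))‖ ≤ 1 := by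
    intro x
    rw [Complex.norm_exp, Real.exp_le_one_iff, Complex.neg_re, ← Complex.ofReal_pow,
      Complex.re_mul_ofReal]
    have := mul_nonneg hbre (sq_nonneg x)
    linarith
  have hgc : Continuous fun x => (gaussianReal₁ α x : ℂ) :=
    Complex.continuous_ofReal.comp (continuous_gaussianReal₁ α)
  have hφl : MemLp φ 2 volume := by
    refine hgl.of_le_mul (c := 2) ((hec.sub he0c).mul hgc).aestronglyMeasurable
      (Filter.Eventually.of_forall fun x => ?_)
    rw [hφ, norm_mul]
    gcongr
    exact (norm_sub_le _ _).trans (by linarith [he1 x, he01 x])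
  have hφn : ‖hφl.toLp φ‖ ≤ 2 * (7 * C₄ / (α * √α)) := by
    refine norm_le_of_ae_gaussian_bound hα (by positivity) ?_
    filter_upwards [hφl.coeFn_toLp] with x hx
    have hgn : ‖(gaussianReal₁ α x : ℂ)‖ = n * Real.exp (-α * x ^ 2) := by
      rw [Complex.norm_real, Real.norm_of_nonneg]
      · rfl
      · unfold gaussianReal₁; positivity
    rw [hx, hφ, norm_mul, hgn]
    calc ‖e x - Complex.exp (-(b * x ^ 2))‖ * (n * Real.exp (-α * x ^ 2))
        ≤ (C₄ * (7 / (α * √α) * Real.exp (α / 4 * x ^ 2))) * (n * Real.exp (-α * x ^ 2)) := by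
          gcongr
          exact (hcub x).trans (by gcongr; exact abs_cube_le hα x)
      _ = 7 * C₄ / (α * √α) * (n * Real.exp (-(3 * α / 4) * x ^ 2)) := by
          rw [show -(3 * α / 4) * x ^ 2 = α / 4 * x ^ 2 + -α * x ^ 2 by ring, Real.exp_add]
          ring
      _ ≤ _ := by
          gcongr
          linarith
  set q := G (hφl.toLp φ) with hq
  have hqn : ‖q‖ ≤ √(Real.pi / (W ^ 2 * κ₀)) * (2 * (7 * C₄ / (α * √α))) :=
    (G.le_opNorm _).trans (by gcongr)
  have hhl : MemLp (fun x => e x * q x) 2 volume := by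
    refine (Lp.memLp q).of_le_mul (c := 1) (hec.aestronglyMeasurable.mul (Lp.memLp q).1)
      (Filter.Eventually.of_forall fun x => ?_)
    rw [norm_mul]
    gcongr
    exact he1 x
  have hhn : ‖hhl.toLp _‖ ≤ ‖q‖ := by
    refine Lp.norm_le_norm_of_ae_le ?_
    filter_upwards [hhl.coeFn_toLp] with x hx
    rw [hx, norm_mul]
    exact mul_le_of_le_one_left (norm_nonneg _) (he1 x)
  -- the remaining part is explicit
  have hJ : ∀ x : ℝ, ∫ y, k₀ x y * (Complex.exp (-(b * y ^ 2)) * (gaussianReal₁ α y : ℂ)) =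
      n * s * Complex.exp (-((α + ε - b) * x ^ 2)) := by
    intro x
    rw [hk₀, integral_gaussian_convolution (hWκ.trans_le hsre), h2ab, zero_div, add_zero]
  have hKg : ∀ᵐ x : ℝ, K g x = e x * q x +
      e x * (n * s * Complex.exp (-((α + ε - b) * x ^ 2))) := by
    have hml : MemLp (fun y : ℝ => Complex.exp (-(b * y ^ 2)) * (gaussianReal₁ α y : ℂ)) 2
        volume := by
      refine hgl.of_le_mul (c := 1) (he0c.mul hgc).aestronglyMeasurable
        (Filter.Eventually.of_forall fun x => ?_)
      rw [norm_mul]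
      gcongr
      exact he01 x
    filter_upwards [(hK g).2, (hG (hφl.toLp φ)).2, hk₀S.ae_integrable hφl,
      hk₀S.ae_integrable hml] with x h3 h4 i1 i2
    rw [h3, hq, h4, ← hJ]
    have h5 : ∫ y, k₀ x y * (hφl.toLp φ) y = ∫ y, k₀ x y * φ y := by
      refine integral_congr_ae ?_
      filter_upwards [hφl.coeFn_toLp] with y hy
      rw [hy]
    rw [h5, ← mul_add, ← integral_add i1 i2, ← integral_const_mul]
    refine integral_congr_ae ?_
    filter_upwards [gaussianL2_ae hα] with y hy
    rw [hg, hy, hk₀, he, hφ]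
    have e1 : Complex.exp (-(a * ((x : ℂ) - y) ^ 2) - U x / 2 - U y / 2) =
        Complex.exp (-(a * ((x : ℂ) - y) ^ 2)) * Complex.exp (-(U x / 2)) *
          Complex.exp (-(U y / 2)) := by
      rw [← Complex.exp_add, ← Complex.exp_add]
      congr 1
    simp only [e1]
    ring
  set d := K g - μ • g - hhl.toLp _ with hd
  have hdn : ‖d‖ ≤ 2 * (‖μ‖ * (14 * C₄ / (α * √α) + 5 * δ)) := by
    refine norm_le_of_ae_gaussian_bound hα (by positivity) ?_
    filter_upwards [hKg, Lp.coeFn_sub (K g - μ • g) (hhl.toLp _), Lp.coeFn_sub (K g) (μ • g),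
      Lp.coeFn_smul μ g, gaussianL2_ae hα, hhl.coeFn_toLp] with x h1 h3 h4 h5 h6 h7
    rw [hd, h3, Pi.sub_apply, h4, Pi.sub_apply, h5, Pi.smul_apply, hg, h6, ← hg, h7, h1,
      smul_eq_mul]
    have h8 := norm_gaussian_error_le (μ := μ) (x := x) hα1 hn0.le (hcub x) hsμ hεn hδ1 hδb hC₄
    refine le_trans (le_of_eq ?_) h8
    congr 1
    unfold gaussianReal₁
    push_cast
    rw [neg_mul]
    ring
  have hmain : μ⁻¹ • K g - g = μ⁻¹ • (hhl.toLp _ + d) := by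
    rw [hd, add_sub_cancel, smul_sub, smul_smul, inv_mul_cancel₀ hμne, one_smul]
  rw [hmain, norm_smul, norm_inv]
  -- The norm bound for G loses Re v against |v|, so its ratio to |μ| is not 1, but it stays
  -- bounded.
  have hfac : ‖μ‖⁻¹ * √(Real.pi / (W ^ 2 * κ₀)) ≤ √((W ^ 2 + α) / (W ^ 2 * κ₀)) := by
    have e1 : ‖μ‖⁻¹ = √(‖a + α‖ / Real.pi) := by
      rw [← inv_div, ← hμ2, ← inv_pow, Real.sqrt_sq (by positivity)]
    rw [e1, ← Real.sqrt_mul (by positivity)]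
    refine Real.sqrt_le_sqrt ?_
    have e2 : ‖a + α‖ ≤ W ^ 2 + α := by
      refine (norm_add_le _ _).trans ?_
      rw [hnorma, Complex.norm_real, Real.norm_of_nonneg hα.le]
    have hpi := Real.pi_pos
    rw [div_mul_div_comm, mul_comm Real.pi, mul_div_mul_right _ _ hpi.ne']
    gcongr
  calc ‖μ‖⁻¹ * ‖hhl.toLp _ + d‖
      ≤ ‖μ‖⁻¹ * (√(Real.pi / (W ^ 2 * κ₀)) * (2 * (7 * C₄ / (α * √α))) +
          2 * (‖μ‖ * (14 * C₄ / (α * √α) + 5 * δ))) := by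
        gcongr
        exact (norm_add_le _ _).trans (add_le_add (hhn.trans hqn) hdn)
    _ = (‖μ‖⁻¹ * √(Real.pi / (W ^ 2 * κ₀))) * (14 * C₄ / (α * √α)) +
          2 * (14 * C₄ / (α * √α) + 5 * δ) := by
        field_simp
        ring
    _ ≤ √((W ^ 2 + α) / (W ^ 2 * κ₀)) * (14 * C₄ / (α * √α)) +
          2 * (14 * C₄ / (α * √α) + 5 * δ) := by gcongr
    _ = _ := by ring

/-! ### Localization of the Gaussian quadratic form -/

/-- Moving multiplication operators between the vectors and the kernel in a quadratic form. -/
theorem IsIntegralOperator.inner_mul_eq {k k' : ℝ → ℝ → ℂ} {S S' : ℝ} {K K' : L2R →L[ℂ] L2R}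
    (hK : IsIntegralOperator k K) (h : SchurKernel k S) (hK' : IsIntegralOperator k' K')
    (h' : SchurKernel k' S') {c : ℝ → ℂ} {f φ : L2R}
    (hφ : ∀ᵐ x : ℝ, φ x = c x * f x) (hk : ∀ x y, k' x y = conj (c x) * k x y * c y) :
    ⟪φ, K φ⟫_ℂ = ⟪f, K' f⟫_ℂ := by
  rw [hK.inner_eq_integral h, hK'.inner_eq_integral h']
  refine integral_congr_ae ?_
  rw [Measure.volume_eq_prod]
  filter_upwards [Measure.quasiMeasurePreserving_fst.ae hφ,
    Measure.quasiMeasurePreserving_snd.ae hφ] with p h1 h2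
  rw [h1, h2, hk, map_mul]
  ring

/-- The Gaussian convolution kernel. -/
noncomputable def gaussKernel (a x y : ℝ) : ℂ := (Real.exp (-a * (x - y) ^ 2) : ℝ)

theorem norm_gaussKernel (a x y : ℝ) : ‖gaussKernel a x y‖ = Real.exp (-a * (x - y) ^ 2) := by
  rw [gaussKernel, Complex.norm_real, Real.norm_of_nonneg (Real.exp_pos _).le]

theorem continuous_gaussKernel (a : ℝ) : Continuous (Function.uncurry (gaussKernel a)) := by
  unfold gaussKernel Function.uncurry
  fun_prop

theorem schurKernel_gaussKernel {a : ℝ} (ha : 0 < a) :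
    SchurKernel (gaussKernel a) (1 * √(Real.pi / a)) :=
  SchurKernel.of_gaussian_bound (continuous_gaussKernel a).measurable zero_le_one ha
    fun x y => by rw [norm_gaussKernel, one_mul]

theorem schurKernel_conj_mul_gaussKernel {a : ℝ} (ha : 0 < a) {c : ℝ → ℂ} (hc : Measurable c)
    (hc1 : ∀ x, ‖c x‖ ≤ 1) :
    SchurKernel (fun x y => conj (c x) * gaussKernel a x y * c y) (1 * √(Real.pi / a)) := by
  refine SchurKernel.of_gaussian_bound ?_ zero_le_one ha fun x y => ?_
  · exact ((Complex.continuous_conj.measurable.comp (hc.comp measurable_fst)).mul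
      (continuous_gaussKernel a).measurable).mul (hc.comp measurable_snd)
  · rw [norm_mul, norm_mul, RCLike.norm_conj, norm_gaussKernel]
    calc ‖c x‖ * Real.exp (-a * (x - y) ^ 2) * ‖c y‖
        ≤ 1 * Real.exp (-a * (x - y) ^ 2) * 1 := by
          gcongr
          exacts [hc1 x, hc1 y]
      _ = _ := by ring

/-- Localization of the quadratic form of a Gaussian convolution by a partition of unity
`cos² θ + sin² θ = 1` with `θ` Lipschitz. -/
theorem re_inner_gaussKernel_localize {a L : ℝ} (ha : 0 < a) {θ : ℝ → ℝ}
    (hθ : Continuous θ) (hL : ∀ x y, |θ x - θ y| ≤ L * |x - y|) {G : L2R →L[ℂ] L2R}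
    (hG : IsIntegralOperator (gaussKernel a) G) {φ φ₀ φ₁ : L2R}
    (h₀ : ∀ᵐ x : ℝ, φ₀ x = (Real.cos (θ x) : ℂ) * φ x)
    (h₁ : ∀ᵐ x : ℝ, φ₁ x = (Real.sin (θ x) : ℂ) * φ x) :
    (⟪φ, G φ⟫_ℂ).re ≤ (⟪φ₀, G φ₀⟫_ℂ).re + (⟪φ₁, G φ₁⟫_ℂ).re +
      L ^ 2 / (2 * a) * √(2 * (Real.pi / a)) * ‖φ‖ ^ 2 := by
  have hS := schurKernel_gaussKernel ha
  have c0 : Continuous fun x => (Real.cos (θ x) : ℂ) := by fun_prop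
  have c1 : Continuous fun x => (Real.sin (θ x) : ℂ) := by fun_prop
  have hS0 := schurKernel_conj_mul_gaussKernel ha c0.measurable fun x => by
    rw [Complex.norm_real]; exact Real.abs_cos_le_one _
  have hS1 := schurKernel_conj_mul_gaussKernel ha c1.measurable fun x => by
    rw [Complex.norm_real]; exact Real.abs_sin_le_one _
  obtain ⟨G0, hG0, -⟩ := hS0.exists_isIntegralOperator
  obtain ⟨G1, hG1, -⟩ := hS1.exists_isIntegralOperator
  have e0 := hG.inner_mul_eq hS hG0 hS0 h₀ (fun _ _ => rfl)
  have e1 := hG.inner_mul_eq hS hG1 hS1 h₁ (fun _ _ => rfl)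
  have hE := (hG.sub hG0).sub hG1
  have hker : ∀ x y, ‖gaussKernel a x y - conj (Real.cos (θ x) : ℂ) * gaussKernel a x y *
      (Real.cos (θ y) : ℂ) - conj (Real.sin (θ x) : ℂ) * gaussKernel a x y *
      (Real.sin (θ y) : ℂ)‖ ≤ L ^ 2 / (2 * a) * Real.exp (-(a / 2) * (x - y) ^ 2) := by
    intro x y
    -- The addition formula turns the commutator error into 1 - cos(θ(x) - θ(y)), which is quadratic
    -- in x - y: first-order terms never appear.
    have e : gaussKernel a x y - conj (Real.cos (θ x) : ℂ) * gaussKernel a x y *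
        (Real.cos (θ y) : ℂ) - conj (Real.sin (θ x) : ℂ) * gaussKernel a x y *
        (Real.sin (θ y) : ℂ) = ((1 - Real.cos (θ x - θ y) : ℝ) : ℂ) * gaussKernel a x y := by
      rw [Real.cos_sub, Complex.conj_ofReal, Complex.conj_ofReal]
      push_cast
      ring
    rw [e, norm_mul, norm_gaussKernel, Complex.norm_real,
      Real.norm_of_nonneg (by linarith [Real.cos_le_one (θ x - θ y)])]
    have h1 : 1 - Real.cos (θ x - θ y) ≤ L ^ 2 / 2 * (x - y) ^ 2 := by
      have h2 := Real.one_sub_sq_div_two_le_cos (x := θ x - θ y)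
      have h3 : (θ x - θ y) ^ 2 ≤ (L * |x - y|) ^ 2 := by
        rw [← sq_abs (θ x - θ y)]
        gcongr
        exact hL x y
      rw [mul_pow, sq_abs] at h3
      linarith
    -- Half of the Gaussian rate absorbs the quadratic factor, so the Schur test applies with rate
    -- a/2.
    have h4 : a * (x - y) ^ 2 ≤ Real.exp (a / 2 * (x - y) ^ 2) := by
      have h5 := Real.quadratic_le_exp_of_nonneg
        (by positivity : 0 ≤ a / 2 * (x - y) ^ 2)
      nlinarith [sq_nonneg (a / 2 * (x - y) ^ 2 - 1)]
    calc (1 - Real.cos (θ x - θ y)) * Real.exp (-a * (x - y) ^ 2)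
        ≤ L ^ 2 / 2 * (x - y) ^ 2 * Real.exp (-a * (x - y) ^ 2) := by gcongr
      _ = L ^ 2 / (2 * a) * (a * (x - y) ^ 2 * Real.exp (-a * (x - y) ^ 2)) := by
          field_simp
      _ ≤ L ^ 2 / (2 * a) *
            (Real.exp (a / 2 * (x - y) ^ 2) * Real.exp (-a * (x - y) ^ 2)) := by gcongr
      _ = _ := by
          rw [← Real.exp_add]
          ring_nf
  have hES := SchurKernel.of_gaussian_bound (k := fun x y => gaussKernel a x y -
      conj (Real.cos (θ x) : ℂ) * gaussKernel a x y * (Real.cos (θ y) : ℂ) -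
      conj (Real.sin (θ x) : ℂ) * gaussKernel a x y * (Real.sin (θ y) : ℂ))
    (A := L ^ 2 / (2 * a)) (b := a / 2)
    ((hS.measurable.sub hS0.measurable).sub hS1.measurable) (by positivity) (by positivity) hker
  have hn := hES.norm_le hE
  have e2 : Real.pi / (a / 2) = 2 * (Real.pi / a) := by field_simp
  rw [e2] at hn
  have e3 : ⟪φ, G φ⟫_ℂ = ⟪φ₀, G φ₀⟫_ℂ + ⟪φ₁, G φ₁⟫_ℂ + ⟪φ, (G - G0 - G1) φ⟫_ℂ := by
    rw [e0, e1, sub_apply, sub_apply, inner_sub_right, inner_sub_right]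
    ring
  rw [e3, Complex.add_re, Complex.add_re]
  gcongr
  calc (⟪φ, (G - G0 - G1) φ⟫_ℂ).re ≤ ‖⟪φ, (G - G0 - G1) φ⟫_ℂ‖ := Complex.re_le_norm _
    _ ≤ ‖φ‖ * ‖(G - G0 - G1) φ‖ := norm_inner_le_norm _ _
    _ ≤ ‖φ‖ * (L ^ 2 / (2 * a) * √(2 * (Real.pi / a)) * ‖φ‖) := by
      gcongr
      exact ContinuousLinearMap.le_of_opNorm_le _ hn φ
    _ = _ := by ring

theorem norm_sq_add_norm_sq_of_cos_sin {θ : ℝ → ℝ} {f f₀ f₁ : L2R}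
    (h₀ : ∀ᵐ x : ℝ, f₀ x = (Real.cos (θ x) : ℂ) * f x)
    (h₁ : ∀ᵐ x : ℝ, f₁ x = (Real.sin (θ x) : ℂ) * f x) :
    ‖f₀‖ ^ 2 + ‖f₁‖ ^ 2 = ‖f‖ ^ 2 := by
  have key : ∀ φ : L2R, ‖φ‖ ^ 2 = (⟪φ, φ⟫_ℂ).re := fun φ => by
    rw [← inner_self_eq_norm_sq (𝕜 := ℂ)]; rfl
  rw [key, key, key, ← Complex.add_re, L2.inner_def, L2.inner_def, L2.inner_def,
    ← integral_add (L2.integrable_inner f₀ f₀) (L2.integrable_inner f₁ f₁)]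
  congr 1
  refine integral_congr_ae ?_
  filter_upwards [h₀, h₁] with x h2 h3
  rw [h2, h3]
  simp only [RCLike.inner_apply, map_mul, Complex.conj_ofReal]
  have := Real.cos_sq_add_sin_sq (θ x)
  have h4 : (Real.cos (θ x) : ℂ) ^ 2 + (Real.sin (θ x) : ℂ) ^ 2 = 1 := by exact_mod_cast this
  linear_combination (f x * conj (f x)) * h4

theorem exists_mul_L2 {c : ℝ → ℂ} (hc : Measurable c) {B : ℝ} (hB : ∀ x, ‖c x‖ ≤ B) (f : L2R) :
    ∃ φ : L2R, ∀ᵐ x : ℝ, φ x = c x * f x := by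
  have h : MemLp (fun x => c x * f x) 2 volume := by
    refine (Lp.memLp f).of_le_mul (c := B) (hc.aestronglyMeasurable.mul (Lp.memLp f).1)
      (Filter.Eventually.of_forall fun x => ?_)
    rw [norm_mul]
    gcongr
    exact hB x
  exact ⟨h.toLp _, h.coeFn_toLp⟩

/-- The angle of the localization: `0` for `|x| ≤ R` and `π/2` for `|x| ≥ 2R`. -/
noncomputable def cutoffAngle (R x : ℝ) : ℝ := Real.pi / 2 * max 0 (min 1 (|x| / R - 1))

theorem continuous_cutoffAngle (R : ℝ) : Continuous (cutoffAngle R) := by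
  unfold cutoffAngle
  fun_prop

theorem cutoffAngle_lipschitz {R : ℝ} (hR : 0 < R) (x y : ℝ) :
    |cutoffAngle R x - cutoffAngle R y| ≤ Real.pi / (2 * R) * |x - y| := by
  unfold cutoffAngle
  rw [← mul_sub, abs_mul, abs_of_pos (by positivity : 0 < Real.pi / 2)]
  have h1 : |max 0 (min 1 (|x| / R - 1)) - max 0 (min 1 (|y| / R - 1))| ≤ |x - y| / R := by
    refine (abs_max_sub_max_le_max _ _ _ _).trans ?_
    rw [sub_self, abs_zero]
    refine max_le (by positivity) ((abs_min_sub_min_le_max _ _ _ _).trans ?_)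
    rw [sub_self, abs_zero]
    refine max_le (by positivity) ?_
    rw [sub_sub_sub_cancel_right, ← sub_div, abs_div, abs_of_pos hR]
    exact div_le_div_of_nonneg_right (abs_abs_sub_abs_le x y) hR.le
  calc _ ≤ Real.pi / 2 * (|x - y| / R) := by gcongr
    _ = _ := by field_simp

theorem cutoffAngle_of_le {R x : ℝ} (hR : 0 < R) (h : |x| ≤ R) : cutoffAngle R x = 0 := by
  have : |x| / R ≤ 1 := (div_le_one hR).2 h
  rw [cutoffAngle, max_eq_left ((min_le_right _ _).trans (by linarith)), mul_zero]

theorem cutoffAngle_of_ge {R x : ℝ} (hR : 0 < R) (h : 2 * R ≤ |x|) :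
    cutoffAngle R x = Real.pi / 2 := by
  have : 2 ≤ |x| / R := by rwa [le_div_iff₀ hR]
  rw [cutoffAngle, min_eq_left (by linarith), max_eq_right zero_le_one, mul_one]

/-! ### Half-kernels and the reduction to a real Gaussian form -/

/-- Parameters of convolved Gaussians combine as pq/(p + q). For p = 2W²v and q its conjugate this
is W²|v|²/Re v: all phases disappear, since |v| = 1. -/
theorem integral_conj_gaussian_mul_gaussian {v : ℂ} {W : ℝ} (hW : 0 < W) (hv1 : ‖v‖ = 1)
    (hv : 0 < v.re) (x y : ℝ) :
    ∫ z : ℝ, conj (Complex.exp (-(2 * (W : ℂ) ^ 2 * v * ((z : ℂ) - x) ^ 2))) *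
      Complex.exp (-(2 * (W : ℂ) ^ 2 * v * ((z : ℂ) - y) ^ 2)) =
      (√(Real.pi / (4 * W ^ 2 * v.re)) : ℝ) * gaussKernel (W ^ 2 / v.re) x y := by
  have hpq : conj v * v = 1 := by
    rw [mul_comm, Complex.mul_conj, Complex.normSq_eq_norm_sq, hv1]; simp
  have hsum : conj v + v = 2 * (v.re : ℂ) := by
    rw [add_comm, Complex.add_conj]; push_cast; ring
  have hκ : (v.re : ℂ) ≠ 0 := by exact_mod_cast hv.ne'
  have hWne : (W : ℂ) ≠ 0 := by exact_mod_cast hW.ne'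
  have key : ∀ z : ℝ, conj (Complex.exp (-(2 * (W : ℂ) ^ 2 * v * ((z : ℂ) - x) ^ 2))) *
      Complex.exp (-(2 * (W : ℂ) ^ 2 * v * ((z : ℂ) - y) ^ 2)) =
      Complex.exp (((-(4 * W ^ 2 * v.re) : ℝ) : ℂ) * z ^ 2 +
        (4 * (W : ℂ) ^ 2 * (conj v * x + v * y)) * z +
        (-(2 * (W : ℂ) ^ 2 * (conj v * x ^ 2 + v * y ^ 2)))) := by
    intro z
    rw [← Complex.exp_conj, ← Complex.exp_add]
    congr 1
    simp only [map_neg, map_mul, map_pow, map_sub, Complex.conj_ofReal, map_ofNat]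
    push_cast
    linear_combination (-(2 * (W : ℂ) ^ 2 * z ^ 2)) * hsum
  simp only [key]
  rw [integral_cexp_quadratic (by
    rw [Complex.ofReal_re]
    have : 0 < 4 * W ^ 2 * v.re := by positivity
    linarith)]
  congr 1
  · rw [Real.sqrt_eq_rpow, Complex.ofReal_cpow (by positivity)]
    push_cast
    rw [neg_neg]
  · rw [gaussKernel, Complex.ofReal_exp]
    congr 1
    push_cast
    field_simp
    rw [show (v.re : ℂ) = (conj v + v) / 2 by rw [hsum]; ring]
    linear_combination (-(x - y : ℂ) ^ 2) * hpq

/-- The half-kernel in the factorization `K = Tᵗ T`. -/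
noncomputable def halfKernel (W : ℝ) (v : ℂ) (U : ℝ → ℂ) (z y : ℝ) : ℂ :=
  Complex.exp (-(2 * (W : ℂ) ^ 2 * v * ((z : ℂ) - y) ^ 2)) * Complex.exp (-(U y / 2))

theorem norm_exp_neg_half_le {U : ℝ → ℂ} (hU : ∀ x, 0 ≤ (U x).re) (x : ℝ) :
    ‖Complex.exp (-(U x / 2))‖ ≤ 1 := by
  have : (-(U x / 2)).re = -((U x).re / 2) := by simp
  rw [Complex.norm_exp, Real.exp_le_one_iff, this]
  linarith [hU x]

theorem schurKernel_halfKernel {W : ℝ} {v : ℂ} {U : ℝ → ℂ} (hW : 0 < W) (hv : 0 < v.re)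
    (hUc : Continuous U) (hU : ∀ x, 0 ≤ (U x).re) :
    SchurKernel (halfKernel W v U) (1 * √(Real.pi / (2 * W ^ 2 * v.re))) := by
  refine SchurKernel.of_gaussian_bound ?_ zero_le_one (by positivity) fun x y => ?_
  · refine Continuous.measurable ?_
    unfold halfKernel Function.uncurry
    fun_prop
  · have e : (2 * (W : ℂ) ^ 2 * v * ((x : ℂ) - y) ^ 2) = ((2 * W ^ 2 * (x - y) ^ 2 : ℝ) : ℂ) * v := by
      push_cast; ring
    rw [halfKernel, norm_mul, e, Complex.norm_exp, Complex.neg_re, Complex.re_ofReal_mul]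
    calc _ ≤ Real.exp (-(2 * W ^ 2 * (x - y) ^ 2 * v.re)) * 1 := by
          gcongr
          exact norm_exp_neg_half_le hU y
      _ = _ := by
          rw [mul_one, one_mul]
          congr 1
          ring

/-- T*T is a real Gaussian convolution sandwiched between multiplication by e^{-U/2} and its
conjugate, so self-adjoint methods become available. -/
theorem norm_sq_halfKernel_apply {W : ℝ} {v : ℂ} {U : ℝ → ℂ} (hW : 0 < W) (hv1 : ‖v‖ = 1)
    (hv : 0 < v.re) (hUc : Continuous U) (hU : ∀ x, 0 ≤ (U x).re) {T G : L2R →L[ℂ] L2R}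
    (hT : IsIntegralOperator (halfKernel W v U) T)
    (hG : IsIntegralOperator (gaussKernel (W ^ 2 / v.re)) G) {f φ : L2R}
    (hφ : ∀ᵐ x : ℝ, φ x = Complex.exp (-(U x / 2)) * f x) :
    ‖T f‖ ^ 2 = √(Real.pi / (4 * W ^ 2 * v.re)) * (⟪φ, G φ⟫_ℂ).re := by
  have hS := schurKernel_halfKernel hW hv hUc hU
  have ha : 0 < W ^ 2 / v.re := by positivity
  have hec : Measurable fun x => Complex.exp (-(U x / 2)) := by fun_prop
  have hGS := schurKernel_gaussKernel ha
  have hQS := schurKernel_conj_mul_gaussKernel ha hec (norm_exp_neg_half_le hU)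
  obtain ⟨Q, hQ, -⟩ := hQS.exists_isIntegralOperator
  set c₀ : ℝ := √(Real.pi / (4 * W ^ 2 * v.re)) with hc₀
  have h1 : ContinuousLinearMap.adjoint T * T = (c₀ : ℂ) • Q := by
    refine IsIntegralOperator.unique ((hT.adjoint hS).comp hT hS.adjoint hS (fun x y => ?_))
      (hQ.const_smul c₀)
    have := integral_conj_gaussian_mul_gaussian hW hv1 hv x y
    have e : ∀ z : ℝ, conj (halfKernel W v U z x) * halfKernel W v U z y =
        (conj (Complex.exp (-(U x / 2))) * Complex.exp (-(U y / 2))) *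
        (conj (Complex.exp (-(2 * (W : ℂ) ^ 2 * v * ((z : ℂ) - x) ^ 2))) *
          Complex.exp (-(2 * (W : ℂ) ^ 2 * v * ((z : ℂ) - y) ^ 2))) := by
      intro z
      rw [halfKernel, halfKernel, map_mul]
      ring
    simp only [e]
    rw [integral_const_mul, this]
    ring
  have h2 : ((‖T f‖ ^ 2 : ℝ) : ℂ) = c₀ * ⟪φ, G φ⟫_ℂ := by
    have h3 : ⟪f, (ContinuousLinearMap.adjoint T * T) f⟫_ℂ = ((‖T f‖ ^ 2 : ℝ) : ℂ) := by
      rw [mul_apply_eq_comp, ContinuousLinearMap.adjoint_inner_right, inner_self_eq_norm_sq_to_K]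
      push_cast
      rfl
    rw [← h3, h1, smul_apply, inner_smul_right,
      hG.inner_mul_eq hGS hQ hQS hφ (fun _ _ => rfl)]
  have h4 := congrArg Complex.re h2
  rwa [Complex.ofReal_re, Complex.re_ofReal_mul] at h4

/-! ### Matching the Gaussian form with a Mehler kernel -/

/-- Correlation coefficient of the Mehler kernel proportional to
`exp (-a (x - y)² - b (x² + y²))` with ground state `g_α`. -/
noncomputable def mehlerRho (a α : ℝ) : ℝ := a / (√(a ^ 2 + α ^ 2) + α)

section

variable {a α : ℝ}

theorem mehlerRho_pos (ha : 0 < a) (hα : 0 < α) : 0 < mehlerRho a α := by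
  unfold mehlerRho
  positivity

theorem mehlerRho_le (ha : 0 < a) (hα : 0 < α) : mehlerRho a α ≤ 1 / (1 + α / a) := by
  have h : a ≤ √(a ^ 2 + α ^ 2) := Real.le_sqrt_of_sq_le (by nlinarith)
  rw [mehlerRho, show 1 / (1 + α / a) = a / (a + α) by field_simp]
  gcongr

theorem mehlerRho_lt_one (ha : 0 < a) (hα : 0 < α) : mehlerRho a α < 1 := by
  refine (mehlerRho_le ha hα).trans_lt ?_
  rw [div_lt_one (by positivity)]
  have : 0 < α / a := by positivity
  linarith

theorem one_sub_mehlerRho_le (ha : 0 < a) (hα : 0 < α) : 1 - mehlerRho a α ≤ 2 * (α / a) := by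
  have h1 : a ≤ √(a ^ 2 + α ^ 2) := Real.le_sqrt_of_sq_le (by nlinarith)
  have h2 : √(a ^ 2 + α ^ 2) ≤ a + α := by
    rw [Real.sqrt_le_left (by positivity)]
    nlinarith
  have h3 : 1 - mehlerRho a α = (√(a ^ 2 + α ^ 2) + α - a) / (√(a ^ 2 + α ^ 2) + α) := by
    rw [mehlerRho, eq_div_iff (by positivity)]
    field_simp
  rw [h3, div_le_iff₀ (by positivity)]
  have h4 : 2 * (α / a) * a = 2 * α := by field_simp
  have h5 : 0 ≤ α / a := by positivity
  nlinarith [mul_nonneg h5 (sub_nonneg.2 h1), mul_nonneg h5 hα.le]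

/-- The Mehler factorization needs the weight e^{-βx²} with β = √(a² + α²) - a. When α²/a ≤ Re u/2
this gives β ≤ Re u/4, so |e^{-ux²/4}| decays at least as fast. -/
theorem sqrt_sub_le (ha : 0 < a) : √(a ^ 2 + α ^ 2) - a ≤ α ^ 2 / (2 * a) := by
  have : √(a ^ 2 + α ^ 2) ≤ a + α ^ 2 / (2 * a) := by
    rw [Real.sqrt_le_left (by positivity)]
    have e : (a + α ^ 2 / (2 * a)) ^ 2 = a ^ 2 + α ^ 2 + (α ^ 2 / (2 * a)) ^ 2 := by
      field_simp
      ring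
    rw [e]
    nlinarith [sq_nonneg (α ^ 2 / (2 * a))]
  linarith

/-- With N = √(a² + α²), the choice of ρ yields a(1 - ρ²) = 2αρ and N(1 - ρ²) = α(1 + ρ²), which
match the exponents. The prefactor √ρ is the ground-state energy; with the gap ρ it makes the
decisive ρ^(3/2). -/
theorem gaussian_eq_mehler (ha : 0 < a) (hα : 0 < α) (x y : ℝ) :
    Real.exp (-(√(a ^ 2 + α ^ 2) - a) * x ^ 2) * Real.exp (-a * (x - y) ^ 2) *
      Real.exp (-(√(a ^ 2 + α ^ 2) - a) * y ^ 2) =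
    √(Real.pi / a) * (√(mehlerRho a α) * mehler α (mehlerRho a α) x y) := by
  set N := √(a ^ 2 + α ^ 2) with hN
  have hN2 : N ^ 2 = a ^ 2 + α ^ 2 := Real.sq_sqrt (by positivity)
  have hNpos : 0 < N := by rw [hN]; positivity
  set ρ := mehlerRho a α with hρ
  have hρ0 : 0 < ρ := mehlerRho_pos ha hα
  have hρ1 : ρ < 1 := mehlerRho_lt_one ha hα
  have hρe : ρ * (N + α) = a := by
    rw [hρ, mehlerRho, ← hN]
    field_simp
  have h2 : 0 < 1 - ρ ^ 2 := by nlinarith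
  have hNα : 0 < N + α := by positivity
  have f0 : N - α = a * ρ := by
    refine mul_right_cancel₀ hNα.ne' ?_
    linear_combination hN2 - a * hρe
  have f1 : a * (1 - ρ ^ 2) = 2 * α * ρ := by
    refine mul_right_cancel₀ hNα.ne' ?_
    linear_combination a * f0 - (a * ρ + 2 * α) * hρe
  have f2 : N * (1 - ρ ^ 2) = α * (1 + ρ ^ 2) := by
    linear_combination f0 - ρ * hρe
  have e1 : √(Real.pi / a) * (√ρ * √(2 * α / (Real.pi * (1 - ρ ^ 2)))) = 1 := by
    rw [← Real.sqrt_mul hρ0.le, ← Real.sqrt_mul (by positivity), Real.sqrt_eq_one]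
    have hpi := Real.pi_ne_zero
    have h2' := h2.ne'
    field_simp
    linarith
  have e2 : -α * ((1 + ρ ^ 2) * (x ^ 2 + y ^ 2) - 4 * ρ * x * y) / (1 - ρ ^ 2) =
      -N * (x ^ 2 + y ^ 2) + 2 * a * x * y := by
    rw [div_eq_iff h2.ne']
    linear_combination (x ^ 2 + y ^ 2) * f2 - 2 * x * y * f1
  rw [mehler, e2, ← mul_assoc (√ρ), ← mul_assoc (√(Real.pi / a)), e1, one_mul, ← Real.exp_add,
    ← Real.exp_add]
  congr 1
  ring

end

/-! ### Inner and outer estimates of the localized form -/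

/-- The multiplier turning a vector into its localized, ground-state-normalized part. -/
noncomputable def innerMultiplier (β R : ℝ) (U : ℝ → ℂ) (x : ℝ) : ℂ :=
  (Real.exp (β * x ^ 2) : ℂ) * Complex.exp (-(U x / 2)) * (Real.cos (cutoffAngle R x) : ℂ)

section

variable {β R r₁ C₃ : ℝ} {u : ℂ} {U : ℝ → ℂ}

/-- The quadratic parts of the exponent cancel favourably on the support |x| ≤ 2R; the cubic
remainder is C₃(2R)³/2 = 4C₃R³. -/
theorem norm_innerMultiplier_le (hR : 0 < R) (hC₃ : 0 ≤ C₃) (hβ : 2 * β ≤ u.re / 2)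
    (hT : ∀ x : ℝ, |x| ≤ 2 * R → ‖U x - u / 2 * x ^ 2‖ ≤ C₃ * |x| ^ 3) (x : ℝ) :
    ‖innerMultiplier β R U x‖ ≤
      Real.exp (4 * C₃ * R ^ 3) * ‖(Real.cos (cutoffAngle R x) : ℂ)‖ := by
  unfold innerMultiplier
  rcases le_total (2 * R) |x| with hx | hx
  · rw [cutoffAngle_of_ge hR hx, Real.cos_pi_div_two]
    simp
  · rw [norm_mul]
    gcongr
    rw [norm_mul, Complex.norm_real, Real.norm_of_nonneg (Real.exp_pos _).le, Complex.norm_exp,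
      ← Real.exp_add, Real.exp_le_exp]
    have h1 : (-(U x / 2)).re = -((U x).re / 2) := by simp
    have h2 := (abs_le.1 ((Complex.abs_re_le_norm _).trans (hT x hx))).1
    have h3 : (U x - u / 2 * x ^ 2).re = (U x).re - u.re / 2 * x ^ 2 := by
      rw [Complex.sub_re, ← Complex.ofReal_pow, Complex.re_mul_ofReal]
      simp
    have h4 : |x| ^ 3 ≤ (2 * R) ^ 3 := by gcongr
    rw [h1]
    rw [h3] at h2
    nlinarith [mul_le_mul_of_nonneg_right hβ (sq_nonneg x), mul_le_mul_of_nonneg_left h4 hC₃]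

/-- For |x| ≤ R the cutoff is inactive and the exponent is O(x²). For |x| ≥ R the multiplier is
merely bounded, but there x²/R² ≥ 1. -/
theorem norm_innerMultiplier_sub_one_le (hR : 0 < R) (hR1 : 2 * R ≤ 1) (hC₃ : 0 ≤ C₃)
    (hβ0 : 0 ≤ β) (hβ : 2 * β ≤ u.re / 2) (hur : ‖u‖ ≤ r₁)
    (hT : ∀ x : ℝ, |x| ≤ 2 * R → ‖U x - u / 2 * x ^ 2‖ ≤ C₃ * |x| ^ 3) (x : ℝ) :
    ‖innerMultiplier β R U x - 1‖ ≤
      (r₁ + C₃ + 2) * Real.exp (r₁ + C₃) * (x ^ 2 / R ^ 2) := by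
  have hr₁ : 0 ≤ r₁ := (norm_nonneg u).trans hur
  set D := r₁ + C₃ with hD
  have hD0 : 0 ≤ D := by positivity
  have hDe : 1 ≤ Real.exp D := Real.one_le_exp hD0
  have hxR : 0 ≤ x ^ 2 / R ^ 2 := by positivity
  have hz : |x| ≤ 2 * R → ‖((β * x ^ 2 : ℝ) : ℂ) - U x / 2‖ ≤ D * x ^ 2 := by
    intro hx
    have e : ((β * x ^ 2 : ℝ) : ℂ) - U x / 2 =
        ((β * x ^ 2 : ℝ) : ℂ) - u / 4 * x ^ 2 - 1 / 2 * (U x - u / 2 * x ^ 2) := by ring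
    have hx3 : |x| ^ 3 ≤ x ^ 2 := by
      rw [← sq_abs x]
      exact pow_le_pow_of_le_one (abs_nonneg x) (hx.trans hR1) (by norm_num)
    have n1 : ‖((β * x ^ 2 : ℝ) : ℂ)‖ = β * x ^ 2 := by
      rw [Complex.norm_real, Real.norm_of_nonneg (by positivity)]
    have n2 : ‖u / 4 * (x : ℂ) ^ 2‖ ≤ r₁ / 4 * x ^ 2 := by
      rw [norm_mul, norm_div, norm_pow, Complex.norm_real, Real.norm_eq_abs, sq_abs,
        Complex.norm_ofNat]
      gcongr
    have n3 : ‖(1 / 2 : ℂ) * (U x - u / 2 * x ^ 2)‖ ≤ 1 / 2 * (C₃ * |x| ^ 3) := by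
      rw [norm_mul]
      have : ‖(1 / 2 : ℂ)‖ = 1 / 2 := by simp
      rw [this]
      gcongr
      exact hT x hx
    have hβr : β ≤ r₁ / 4 := by
      have := (Complex.re_le_norm u).trans hur
      linarith
    rw [e]
    refine (norm_sub_le _ _).trans ((add_le_add (norm_sub_le _ _) n3).trans ?_)
    rw [n1]
    nlinarith [mul_le_mul_of_nonneg_right hβr (sq_nonneg x), mul_nonneg hr₁ (sq_nonneg x),
      mul_le_mul_of_nonneg_left hx3 hC₃, mul_nonneg hC₃ (sq_nonneg x)]
  have hexp : (Real.exp (β * x ^ 2) : ℂ) * Complex.exp (-(U x / 2)) =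
      Complex.exp (((β * x ^ 2 : ℝ) : ℂ) - U x / 2) := by
    rw [Complex.ofReal_exp, ← Complex.exp_add, sub_eq_add_neg]
  have hx1 : |x| ≤ 2 * R → D * x ^ 2 ≤ D := by
    intro hx
    have : x ^ 2 ≤ 1 := by
      rw [← sq_abs]
      exact pow_le_one₀ (abs_nonneg x) (hx.trans hR1)
    nlinarith
  unfold innerMultiplier
  rw [hexp]
  rcases le_total |x| R with hx | hx
  · rw [cutoffAngle_of_le hR hx, Real.cos_zero, Complex.ofReal_one, mul_one]
    have hx2 : |x| ≤ 2 * R := by linarith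
    have hx3 : x ^ 2 ≤ x ^ 2 / R ^ 2 := by
      refine le_div_self (sq_nonneg x) (by positivity) ?_
      nlinarith
    calc _ ≤ _ := norm_cexp_sub_one_le _
      _ ≤ D * x ^ 2 * Real.exp D := by
        gcongr
        · exact hz hx2
        · exact (hz hx2).trans (hx1 hx2)
      _ ≤ D * (x ^ 2 / R ^ 2) * Real.exp D := by gcongr
      _ ≤ _ := by nlinarith [mul_nonneg (Real.exp_pos D).le hxR]
  · have hx3 : 1 ≤ x ^ 2 / R ^ 2 := by
      rw [le_div_iff₀ (by positivity), one_mul, ← sq_abs x]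
      gcongr
    have hm : ‖Complex.exp (((β * x ^ 2 : ℝ) : ℂ) - U x / 2) *
        (Real.cos (cutoffAngle R x) : ℂ)‖ ≤ Real.exp D := by
      rcases le_total (2 * R) |x| with hx4 | hx4
      · rw [cutoffAngle_of_ge hR hx4, Real.cos_pi_div_two]
        simpa using (Real.exp_pos D).le
      · rw [norm_mul, Complex.norm_real]
        calc _ ≤ Real.exp D * 1 := by
              gcongr
              · exact (Complex.norm_exp_le_exp_norm _).trans
                  (Real.exp_le_exp.2 ((hz hx4).trans (hx1 hx4)))
              · exact Real.abs_cos_le_one _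
          _ = _ := mul_one _
    calc _ ≤ Real.exp D + 1 := (norm_sub_le _ _).trans (by rw [norm_one]; gcongr)
      _ ≤ (D + 2) * Real.exp D * 1 := by nlinarith
      _ ≤ _ := by gcongr

theorem norm_sin_mul_exp_le {C : ℝ} (hR : 0 < R) (hR1 : R ≤ 1) (hC : 0 < C)
    (hlow : ∀ x : ℝ, 1 / C * min 1 (|x| ^ 2) ≤ (U x).re) (x : ℝ) :
    ‖(Real.sin (cutoffAngle R x) : ℂ) * Complex.exp (-(U x / 2))‖ ≤
      Real.exp (-(R ^ 2 / (2 * C))) * ‖(Real.sin (cutoffAngle R x) : ℂ)‖ := by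
  rw [norm_mul, mul_comm]
  rcases le_total |x| R with hx | hx
  · rw [cutoffAngle_of_le hR hx, Real.sin_zero]
    simp
  · gcongr
    have h1 : (-(U x / 2)).re = -((U x).re / 2) := by simp
    rw [Complex.norm_exp, Real.exp_le_exp, h1, neg_le_neg_iff]
    have h2 : R ^ 2 ≤ min 1 (|x| ^ 2) := le_min (pow_le_one₀ hR.le hR1) (by gcongr)
    calc R ^ 2 / (2 * C) = 1 / C * R ^ 2 / 2 := by field_simp
      _ ≤ 1 / C * min 1 (|x| ^ 2) / 2 := by gcongr
      _ ≤ _ := by gcongr; exact hlow x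

end

/-- Let w = mf with m the multiplier. Orthogonality of f to g_α lets m - 1 replace m; moved onto
g_α, its bound x²/R² becomes 1/(αR²). -/
theorem norm_inner_gaussian_le {α β R r₁ C₃ : ℝ} {u : ℂ} {U : ℝ → ℂ} (hα : 0 < α) (hR : 0 < R)
    (hR1 : 2 * R ≤ 1) (hC₃ : 0 ≤ C₃) (hUc : Continuous U)
    (hβ0 : 0 ≤ β) (hβ : 2 * β ≤ u.re / 2) (hur : ‖u‖ ≤ r₁)
    (hT : ∀ x : ℝ, |x| ≤ 2 * R → ‖U x - u / 2 * x ^ 2‖ ≤ C₃ * |x| ^ 3) {f w : L2R}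
    (hf : ⟪gaussianL2 α hα, f⟫_ℂ = 0) (hw : ∀ᵐ x : ℝ, w x = innerMultiplier β R U x * f x) :
    ‖⟪gaussianL2 α hα, w⟫_ℂ‖ ≤
      8 * ((r₁ + C₃ + 2) * Real.exp (r₁ + C₃)) / (α * R ^ 2) * ‖f‖ := by
  have hr₁ : 0 ≤ r₁ := (norm_nonneg u).trans hur
  set g := gaussianL2 α hα with hg
  set D := (r₁ + C₃ + 2) * Real.exp (r₁ + C₃) with hD
  have hD0 : 0 ≤ D := by positivity
  have hm : Continuous (innerMultiplier β R U) := by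
    have := continuous_cutoffAngle R
    unfold innerMultiplier
    fun_prop
  have hmb : ∀ x, ‖conj (innerMultiplier β R U x) - 1‖ ≤ Real.exp (4 * C₃ * R ^ 3) + 1 := by
    intro x
    refine (norm_sub_le _ _).trans ?_
    rw [RCLike.norm_conj, norm_one]
    gcongr
    refine (norm_innerMultiplier_le hR hC₃ hβ hT x).trans (mul_le_of_le_one_right
      (Real.exp_pos _).le ?_)
    rw [Complex.norm_real]
    exact Real.abs_cos_le_one _
  obtain ⟨ψ, hψ⟩ := exists_mul_L2
    (c := fun x => conj (innerMultiplier β R U x) - 1)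
    ((Complex.continuous_conj.comp hm).sub continuous_const).measurable hmb g
  have h1 : ⟪g, w⟫_ℂ = ⟪ψ, f⟫_ℂ := by
    rw [← sub_zero ⟪g, w⟫_ℂ, ← hf, ← inner_sub_right, L2.inner_def, L2.inner_def]
    refine integral_congr_ae ?_
    filter_upwards [hψ, hw, Lp.coeFn_sub w f] with x h2 h3 h4
    rw [h2, h4, Pi.sub_apply, h3]
    simp only [RCLike.inner_apply, map_mul, map_sub, map_one, Complex.conj_conj]
    ring
  have h2 : ‖ψ‖ ≤ 2 * (4 * D / (α * R ^ 2)) := by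
    refine norm_le_of_ae_gaussian_bound hα (by positivity) ?_
    filter_upwards [hψ, gaussianL2_ae hα] with x h3 h4
    have h5 := norm_innerMultiplier_sub_one_le hR hR1 hC₃ hβ0 hβ hur hT x
    have h6 : ‖conj (innerMultiplier β R U x) - 1‖ = ‖innerMultiplier β R U x - 1‖ := by
      rw [← RCLike.norm_conj, map_sub, Complex.conj_conj, map_one]
    have h7 : x ^ 2 ≤ 4 / α * Real.exp (α / 4 * x ^ 2) := by
      rw [div_mul_eq_mul_div, le_div_iff₀ hα]
      have := Real.add_one_le_exp (α / 4 * x ^ 2)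
      linarith
    have h8 : ‖(gaussianReal₁ α x : ℂ)‖ =
        (2 * α / Real.pi) ^ (1 / 4 : ℝ) * Real.exp (-α * x ^ 2) := by
      rw [Complex.norm_real, Real.norm_of_nonneg]
      · rfl
      · unfold gaussianReal₁; positivity
    rw [h3, norm_mul, h6, hg, h4, h8]
    calc ‖innerMultiplier β R U x - 1‖ * ((2 * α / Real.pi) ^ (1 / 4 : ℝ) *
          Real.exp (-α * x ^ 2))
        ≤ (D * (4 / α * Real.exp (α / 4 * x ^ 2) / R ^ 2)) *
          ((2 * α / Real.pi) ^ (1 / 4 : ℝ) * Real.exp (-α * x ^ 2)) := by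
          gcongr
          exact h5.trans (by gcongr)
      _ = 4 * D / (α * R ^ 2) * ((2 * α / Real.pi) ^ (1 / 4 : ℝ) *
          Real.exp (-(3 * α / 4) * x ^ 2)) := by
          rw [show -(3 * α / 4) * x ^ 2 = α / 4 * x ^ 2 + -α * x ^ 2 by ring, Real.exp_add]
          field_simp
      _ ≤ _ := by
          gcongr
          linarith
  rw [h1]
  calc _ ≤ ‖ψ‖ * ‖f‖ := norm_inner_le_norm _ _
    _ ≤ 2 * (4 * D / (α * R ^ 2)) * ‖f‖ := by gcongr
    _ = _ := by ring

/-- The quadratic form of the Gaussian convolution on `exp (-U/2) f` with `f ⊥ g_α`. -/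
theorem re_inner_gaussKernel_le {a α R r₁ C₃ C X : ℝ} {u : ℂ} {U : ℝ → ℂ} (ha : 0 < a)
    (hα : 0 < α) (hR : 0 < R) (hR1 : 2 * R ≤ 1) (hC : 0 < C) (hC₃ : 0 ≤ C₃) (hUc : Continuous U)
    (hlow : ∀ x : ℝ, 1 / C * min 1 (|x| ^ 2) ≤ (U x).re) (hαu : α ^ 2 / a ≤ u.re / 2)
    (hur : ‖u‖ ≤ r₁)
    (hT : ∀ x : ℝ, |x| ≤ 2 * R → ‖U x - u / 2 * x ^ 2‖ ≤ C₃ * |x| ^ 3)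
    (hX₀ : √(mehlerRho a α) * mehlerRho a α * Real.exp (8 * C₃ * R ^ 3) ≤ X)
    (hX₁ : Real.exp (-(R ^ 2 / C)) ≤ X) {G : L2R →L[ℂ] L2R}
    (hG : IsIntegralOperator (gaussKernel a) G) {f φ : L2R}
    (hf : ⟪gaussianL2 α hα, f⟫_ℂ = 0) (hφ : ∀ᵐ x : ℝ, φ x = Complex.exp (-(U x / 2)) * f x) :
    (⟪φ, G φ⟫_ℂ).re ≤ √(Real.pi / a) * (X + √(mehlerRho a α) * (1 - mehlerRho a α) *
      (8 * ((r₁ + C₃ + 2) * Real.exp (r₁ + C₃)) / (α * R ^ 2)) ^ 2 +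
      (Real.pi / (2 * R)) ^ 2 / (2 * a) * √2) * ‖f‖ ^ 2 := by
  have hU : ∀ x, 0 ≤ (U x).re := fun x => le_trans (by positivity) (hlow x)
  have hS := schurKernel_gaussKernel ha
  have hGn : ‖G‖ ≤ √(Real.pi / a) := by simpa using hS.norm_le hG
  have hθ := continuous_cutoffAngle R
  have cc : Continuous fun x => (Real.cos (cutoffAngle R x) : ℂ) := by fun_prop
  have cs : Continuous fun x => (Real.sin (cutoffAngle R x) : ℂ) := by fun_prop
  have bc : ∀ x, ‖(Real.cos (cutoffAngle R x) : ℂ)‖ ≤ 1 := fun x => by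
    rw [Complex.norm_real]; exact Real.abs_cos_le_one _
  have bs : ∀ x, ‖(Real.sin (cutoffAngle R x) : ℂ)‖ ≤ 1 := fun x => by
    rw [Complex.norm_real]; exact Real.abs_sin_le_one _
  obtain ⟨φ₀, hφ₀⟩ := exists_mul_L2 cc.measurable bc φ
  obtain ⟨φ₁, hφ₁⟩ := exists_mul_L2 cs.measurable bs φ
  obtain ⟨f₀, hf₀⟩ := exists_mul_L2 cc.measurable bc f
  obtain ⟨f₁, hf₁⟩ := exists_mul_L2 cs.measurable bs f
  have hpyth := norm_sq_add_norm_sq_of_cos_sin hf₀ hf₁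
  have hloc := re_inner_gaussKernel_localize ha hθ (cutoffAngle_lipschitz hR) hG hφ₀ hφ₁
  set ρ := mehlerRho a α with hρ
  have hρ0 : 0 < ρ := mehlerRho_pos ha hα
  have hρ1 : ρ < 1 := mehlerRho_lt_one ha hα
  set β := √(a ^ 2 + α ^ 2) - a with hβ
  have hβ0 : 0 ≤ β := sub_nonneg.2 (Real.le_sqrt_of_sq_le (by nlinarith))
  have hβu : 2 * β ≤ u.re / 2 := by
    have h1 := sqrt_sub_le (α := α) ha
    have h2 : 2 * (α ^ 2 / (2 * a)) = α ^ 2 / a := by field_simp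
    linarith
  -- the inner part
  have hmc : Continuous (innerMultiplier β R U) := by
    unfold innerMultiplier
    fun_prop
  have hmb := norm_innerMultiplier_le hR hC₃ hβu hT
  obtain ⟨w, hw⟩ := exists_mul_L2 hmc.measurable
    (fun x => (hmb x).trans (mul_le_of_le_one_right (Real.exp_pos _).le (bc x))) f
  have hgw := norm_inner_gaussian_le hα hR hR1 hC₃ hUc hβ0 hβu hur hT hf hw
  have hwn : ‖w‖ ≤ Real.exp (4 * C₃ * R ^ 3) * ‖f₀‖ := by
    refine Lp.norm_le_mul_norm_of_ae_le_mul ?_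
    filter_upwards [hw, hf₀] with x h1 h2
    rw [h1, h2, norm_mul, norm_mul, ← mul_assoc]
    gcongr
    exact hmb x
  have hinner : (⟪φ₀, G φ₀⟫_ℂ).re ≤ √(Real.pi / a) * (√ρ *
      (ρ * ‖w‖ ^ 2 + (1 - ρ) * ‖⟪gaussianL2 α hα, w⟫_ℂ‖ ^ 2)) := by
    obtain ⟨S, hPS⟩ := schurKernel_mehler hα hρ0 hρ1
    obtain ⟨P, hP, -⟩ := hPS.exists_isIntegralOperator
    have cg : Continuous fun x : ℝ => (Real.exp (-β * x ^ 2) : ℂ) := by fun_prop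
    have hQS := schurKernel_conj_mul_gaussKernel ha cg.measurable fun x => by
      rw [Complex.norm_real, Real.norm_of_nonneg (Real.exp_pos _).le, Real.exp_le_one_iff]
      nlinarith [sq_nonneg x]
    obtain ⟨Q, hQ, -⟩ := hQS.exists_isIntegralOperator
    -- Since φ₀ = e^{-βx²}w, the weight moves into the kernel, which becomes exactly the Mehler
    -- kernel up to a scalar.
    have e1 : ⟪φ₀, G φ₀⟫_ℂ = ⟪w, Q w⟫_ℂ := by
      refine hG.inner_mul_eq hS hQ hQS ?_ (fun _ _ => rfl)
      filter_upwards [hφ₀, hφ, hw] with x h1 h2 h3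
      have h4 : (Real.exp (-β * x ^ 2) : ℂ) * (Real.exp (β * x ^ 2) : ℂ) = 1 := by
        rw [← Complex.ofReal_mul, ← Real.exp_add]
        simp
      rw [h1, h2, h3, innerMultiplier]
      linear_combination (-(Real.cos (cutoffAngle R x) * Complex.exp (-(U x / 2)) * f x)) * h4
    have e2 : Q = ((√(Real.pi / a) * √ρ : ℝ) : ℂ) • P := by
      refine hQ.unique ?_
      have := hP.const_smul ((√(Real.pi / a) * √ρ : ℝ) : ℂ)
      convert this using 3 with x y
      rw [Complex.conj_ofReal, gaussKernel, ← Complex.ofReal_mul, ← Complex.ofReal_mul,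
        gaussian_eq_mehler ha hα, ← Complex.ofReal_mul, mul_assoc]
    rw [e1, e2, smul_apply, inner_smul_right, Complex.re_ofReal_mul, mul_assoc]
    gcongr
    exact re_inner_mehler_le hα hρ0 hρ1 hP w
  -- the outer part
  have hφ₁n : ‖φ₁‖ ≤ Real.exp (-(R ^ 2 / (2 * C))) * ‖f₁‖ := by
    refine Lp.norm_le_mul_norm_of_ae_le_mul ?_
    filter_upwards [hφ₁, hφ, hf₁] with x h1 h2 h3
    rw [h1, h2, h3, ← mul_assoc, norm_mul, norm_mul _ (f x), ← mul_assoc]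
    gcongr
    exact norm_sin_mul_exp_le hR (by linarith) hC hlow x
  have hφn : ‖φ‖ ≤ ‖f‖ := by
    refine Lp.norm_le_norm_of_ae_le ?_
    filter_upwards [hφ] with x h1
    rw [h1, norm_mul]
    exact mul_le_of_le_one_left (norm_nonneg _) (norm_exp_neg_half_le hU x)
  have houter : (⟪φ₁, G φ₁⟫_ℂ).re ≤ √(Real.pi / a) * (X * ‖f₁‖ ^ 2) := by
    calc (⟪φ₁, G φ₁⟫_ℂ).re ≤ ‖⟪φ₁, G φ₁⟫_ℂ‖ := Complex.re_le_norm _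
      _ ≤ ‖φ₁‖ * ‖G φ₁‖ := norm_inner_le_norm _ _
      _ ≤ ‖φ₁‖ * (√(Real.pi / a) * ‖φ₁‖) := by
        gcongr
        exact G.le_of_opNorm_le hGn φ₁
      _ = √(Real.pi / a) * ‖φ₁‖ ^ 2 := by ring
      _ ≤ √(Real.pi / a) * (Real.exp (-(R ^ 2 / (2 * C))) * ‖f₁‖) ^ 2 := by gcongr
      _ = √(Real.pi / a) * (Real.exp (-(R ^ 2 / C)) * ‖f₁‖ ^ 2) := by
        rw [mul_pow, ← Real.exp_nat_mul]
        congr 4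
        push_cast
        field_simp
      _ ≤ _ := by gcongr
  have hinner2 : √ρ * (ρ * ‖w‖ ^ 2) ≤ X * ‖f₀‖ ^ 2 := by
    calc √ρ * (ρ * ‖w‖ ^ 2) ≤ √ρ * (ρ * (Real.exp (4 * C₃ * R ^ 3) * ‖f₀‖) ^ 2) := by gcongr
      _ = √ρ * ρ * Real.exp (8 * C₃ * R ^ 3) * ‖f₀‖ ^ 2 := by
        rw [mul_pow, ← Real.exp_nat_mul]
        have : ((2 : ℕ) : ℝ) * (4 * C₃ * R ^ 3) = 8 * C₃ * R ^ 3 := by push_cast; ring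
        rw [this]
        ring
      _ ≤ _ := by gcongr
  set E := 8 * ((r₁ + C₃ + 2) * Real.exp (r₁ + C₃)) / (α * R ^ 2) with hE
  have hinner3 : √ρ * ((1 - ρ) * ‖⟪gaussianL2 α hα, w⟫_ℂ‖ ^ 2) ≤
      √ρ * (1 - ρ) * E ^ 2 * ‖f‖ ^ 2 := by
    have h1 : 0 ≤ 1 - ρ := by linarith
    calc _ ≤ √ρ * ((1 - ρ) * (E * ‖f‖) ^ 2) := by gcongr
      _ = _ := by ring
  have hlast : (Real.pi / (2 * R)) ^ 2 / (2 * a) * √(2 * (Real.pi / a)) * ‖φ‖ ^ 2 ≤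
      √(Real.pi / a) * ((Real.pi / (2 * R)) ^ 2 / (2 * a) * √2 * ‖f‖ ^ 2) := by
    rw [Real.sqrt_mul zero_le_two]
    calc _ ≤ (Real.pi / (2 * R)) ^ 2 / (2 * a) * (√2 * √(Real.pi / a)) * ‖f‖ ^ 2 := by gcongr
      _ = _ := by ring
  calc (⟪φ, G φ⟫_ℂ).re ≤ _ := hloc
    _ ≤ √(Real.pi / a) * (X * ‖f₀‖ ^ 2 + √ρ * (1 - ρ) * E ^ 2 * ‖f‖ ^ 2) +
        √(Real.pi / a) * (X * ‖f₁‖ ^ 2) +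
        √(Real.pi / a) * ((Real.pi / (2 * R)) ^ 2 / (2 * a) * √2 * ‖f‖ ^ 2) := by
      gcongr
      refine hinner.trans ?_
      gcongr
      rw [mul_add]
      gcongr
    _ = _ := by
      rw [← hpyth]
      ring

/-! ### Balancing the error terms at scale R = W^(-2/5) -/

theorem sqrt_mul_self_le_of_le {ρ t : ℝ} (h0 : 0 ≤ ρ) (ht : 0 ≤ t) (ht1 : t ≤ 1)
    (h : ρ ≤ 1 / (1 + t)) : √ρ * ρ ≤ 1 - 3 / 2 * t + 2 * t ^ 2 := by
  have h1 : ρ ≤ 1 - t + t ^ 2 := by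
    refine h.trans ?_
    rw [div_le_iff₀ (by positivity)]
    have : 0 ≤ t ^ 3 := by positivity
    nlinarith
  have h2 : √ρ ≤ 1 - t / 2 + t ^ 2 / 2 := by
    refine Real.sqrt_le_iff.2 ⟨by nlinarith, h.trans ?_⟩
    rw [div_le_iff₀ (by positivity)]
    have e : (1 - t / 2 + t ^ 2 / 2) ^ 2 * (1 + t) =
        1 + t ^ 2 / 4 + t ^ 3 * (3 / 4 - t / 4) + t ^ 5 / 4 := by ring
    rw [e]
    have a1 : 0 ≤ t ^ 3 * (3 / 4 - t / 4) := mul_nonneg (by positivity) (by linarith)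
    have a2 : 0 ≤ t ^ 5 / 4 := by positivity
    nlinarith [sq_nonneg t]
  calc √ρ * ρ ≤ (1 - t / 2 + t ^ 2 / 2) * (1 - t + t ^ 2) :=
        mul_le_mul h2 h1 h0 (by nlinarith)
    _ = 1 - 3 / 2 * t + 2 * t ^ 2 - t ^ 3 * (1 - t / 2) := by ring
    _ ≤ _ := by
      have : 0 ≤ t ^ 3 * (1 - t / 2) := mul_nonneg (by positivity) (by linarith)
      linarith

theorem exp_neg_le_one_sub_half {y : ℝ} (h0 : 0 ≤ y) (h1 : y ≤ 1) :
    Real.exp (-y) ≤ 1 - y / 2 := by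
  rw [Real.exp_neg]
  have h2 : 1 + y ≤ Real.exp y := by linarith [Real.add_one_le_exp y]
  refine (inv_anti₀ (by positivity) h2).trans ?_
  rw [inv_le_iff_one_le_mul₀ (by positivity)]
  nlinarith

theorem mehler_inner_coefficient_le {ρ t R C₃ : ℝ} (hρ0 : 0 < ρ) (hρ1 : ρ < 1) (ht0 : 0 ≤ t)
    (ht1 : t ≤ 1) (hρt : ρ ≤ 1 / (1 + t)) (hC₃ : 0 < C₃) (hR0 : 0 < R) (hRle : R ≤ 1)
    (hRC₃ : 8 * C₃ * R ≤ 1) :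
    √ρ * ρ * Real.exp (8 * C₃ * R ^ 3) ≤ 1 - 3 / 2 * t + 2 * t ^ 2 + 16 * C₃ * R ^ 3 := by
  have hsρ1 : √ρ ≤ 1 := Real.sqrt_le_one.2 hρ1.le
  have hR3R : R ^ 3 ≤ R := by
    have : R ^ 2 ≤ 1 := pow_le_one₀ hR0.le hRle
    nlinarith
  have h1 := sqrt_mul_self_le_of_le hρ0.le ht0 ht1 hρt
  have hy0 : 0 ≤ 8 * C₃ * R ^ 3 := by positivity
  have hy1 : 8 * C₃ * R ^ 3 ≤ 1 := by nlinarith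
  have h2 := Real.abs_exp_sub_one_le (x := 8 * C₃ * R ^ 3) (by rwa [abs_of_nonneg hy0])
  rw [abs_of_nonneg hy0] at h2
  have h3 := (abs_le.1 h2).2
  have h4 : √ρ * ρ ≤ 1 := mul_le_one₀ hsρ1 hρ0.le hρ1.le
  have h5 : 0 ≤ √ρ * ρ := by positivity
  calc √ρ * ρ * Real.exp (8 * C₃ * R ^ 3) ≤ √ρ * ρ * (1 + 2 * (8 * C₃ * R ^ 3)) := by
        gcongr
        linarith
    _ ≤ _ := by nlinarith

/-- Outside the saddle the loss R²/(2C) exceeds 3t/2 because R² is large compared with 1/W; this is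
the condition 3Cq ≤ WR². -/
theorem outer_coefficient_le {t R C₃ C q W : ℝ} (htq : t ≤ q / W) (hC₃ : 0 < C₃)
    (hC : 0 < C) (hR0 : 0 < R) (hRle : R ≤ 1) (hRC : R ≤ C) (hW0 : 0 < W)
    (hWRC : 3 * C * q ≤ W * R ^ 2) :
    Real.exp (-(R ^ 2 / C)) ≤ 1 - 3 / 2 * t + 2 * t ^ 2 + 16 * C₃ * R ^ 3 := by
  have hy1 : R ^ 2 / C ≤ 1 := by
    rw [div_le_one hC]
    nlinarith
  have h1 := exp_neg_le_one_sub_half (by positivity) hy1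
  have h2 : 3 / 2 * t ≤ R ^ 2 / C / 2 := by
    have h3 : q / W ≤ R ^ 2 / (3 * C) := by
      rw [div_le_div_iff₀ hW0 (by positivity)]
      linarith
    calc 3 / 2 * t ≤ 3 / 2 * (R ^ 2 / (3 * C)) := by gcongr; exact htq.trans h3
      _ = R ^ 2 / C / 2 := by field_simp
  have h4 : 0 ≤ 16 * C₃ * R ^ 3 := by positivity
  nlinarith [sq_nonneg t]

/-- By R⁵W² = 1, the localization error W^(-2)R^(-2) is R³, and the overlap term t/(αR²)² is of
order R/W, at most R³ since WR² ≥ 1. -/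
theorem total_coefficient_le {κ ρ t R C₃ D a α p q W : ℝ} (hκ : 0 < κ) (hκ1 : κ ≤ 1)
    (ha : a = W ^ 2 / κ) (htα : α / a = t) (ht0 : 0 ≤ t) (htq : t ≤ q / W) (hρ1 : ρ < 1)
    (h1ρ : 1 - ρ ≤ 2 * t) (hp0 : 0 < p) (hD0 : 0 < D) (hα : 0 < α) (h1 : p * W ≤ α)
    (hR0 : 0 < R) (hRle : R ≤ 1) (hW0 : 0 < W) (hR5 : R ^ 5 * W ^ 2 = 1)
    (hWR1 : 1 ≤ W * R ^ 2) :
    1 - 3 / 2 * t + 2 * t ^ 2 + 16 * C₃ * R ^ 3 + √ρ * (1 - ρ) * (8 * D / (α * R ^ 2)) ^ 2 +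
      (Real.pi / (2 * R)) ^ 2 / (2 * a) * √2 ≤
      1 - 3 / 2 * t + (2 * q ^ 2 + 16 * C₃ + 128 * D ^ 2 / p + 2) * R ^ 3 := by
  have hsρ1 : √ρ ≤ 1 := Real.sqrt_le_one.2 hρ1.le
  have ha0 : 0 < a := by rw [ha]; positivity
  have hinvW2 : 1 / W ^ 2 = R ^ 5 := by
    rw [div_eq_iff (by positivity)]
    exact hR5.symm
  have t1 : 2 * t ^ 2 ≤ 2 * q ^ 2 * R ^ 3 := by
    have h1 : t ^ 2 ≤ q ^ 2 * R ^ 5 := by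
      calc t ^ 2 ≤ (q / W) ^ 2 := by gcongr
        _ = q ^ 2 * (1 / W ^ 2) := by field_simp
        _ = _ := by rw [hinvW2]
    have h2 : R ^ 5 ≤ R ^ 3 := pow_le_pow_of_le_one hR0.le hRle (by norm_num)
    nlinarith [mul_le_mul_of_nonneg_left h2 (sq_nonneg q)]
  have t2 : √ρ * (1 - ρ) * (8 * D / (α * R ^ 2)) ^ 2 ≤ 128 * D ^ 2 / p * R ^ 3 := by
    have h0 : 0 ≤ 1 - ρ := by linarith
    have h2 : 1 / (a * α) ≤ R ^ 5 / (p * W) := by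
      calc 1 / (a * α) = 1 / W ^ 2 * (κ / α) := by rw [ha]; field_simp
        _ ≤ 1 / W ^ 2 * (1 / (p * W)) := by gcongr
        _ = _ := by rw [hinvW2]; ring
    calc √ρ * (1 - ρ) * (8 * D / (α * R ^ 2)) ^ 2
        ≤ 1 * (2 * t) * (8 * D / (α * R ^ 2)) ^ 2 := by gcongr
      _ = 128 * D ^ 2 / R ^ 4 * (1 / (a * α)) := by
          rw [← htα]
          field_simp
          norm_num
      _ ≤ 128 * D ^ 2 / R ^ 4 * (R ^ 5 / (p * W)) := by gcongr
      _ = 128 * D ^ 2 / p * (R / W) := by field_simp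
      _ ≤ 128 * D ^ 2 / p * R ^ 3 := by
          gcongr
          rw [div_le_iff₀ hW0]
          nlinarith
  have t3 : (Real.pi / (2 * R)) ^ 2 / (2 * a) * √2 ≤ 2 * R ^ 3 := by
    have h1 : (Real.pi / (2 * R)) ^ 2 / (2 * a) * √2 =
        Real.pi ^ 2 * √2 / 8 * κ * (1 / W ^ 2 / R ^ 2) := by
      rw [ha]
      field_simp
      norm_num
    have h2 : Real.pi ^ 2 ≤ 10 := by
      have := Real.pi_lt_d2
      have := Real.pi_pos
      nlinarith
    have h3 : √2 ≤ 3 / 2 := by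
      rw [Real.sqrt_le_left (by norm_num)]
      norm_num
    rw [h1, hinvW2]
    have h4 : R ^ 5 / R ^ 2 = R ^ 3 := by field_simp
    rw [h4]
    gcongr
    calc Real.pi ^ 2 * √2 / 8 * κ ≤ 10 * (3 / 2) / 8 * 1 := by gcongr
      _ ≤ 2 := by norm_num
  linarith

theorem exists_halfKernel_bound {κ₀ r₀ r₁ ρ₀ C₃ C : ℝ} (hκ₀ : 0 < κ₀) (hr₀ : 0 < r₀)
    (hr₁ : 0 < r₁) (hρ₀ : 0 < ρ₀) (hC₃ : 0 < C₃) (hC : 0 < C) :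
    ∃ M W₀ : ℝ, 0 < M ∧ 1 ≤ W₀ ∧ ∀ (v u : ℂ) (U : ℝ → ℂ) (W α : ℝ) (hα : 0 < α),
      ‖v‖ = 1 → κ₀ ≤ v.re → r₀ ≤ ‖u‖ → ‖u‖ ≤ r₁ → u.re = ‖u‖ * v.re → Continuous U →
      (∀ x : ℝ, 1 / C * min 1 (|x| ^ 2) ≤ (U x).re) →
      (∀ x : ℝ, |x| ≤ ρ₀ → ‖U x - u / 2 * x ^ 2‖ ≤ C₃ * |x| ^ 3) →
      W₀ ≤ W → α = W * √(‖u‖ / 2) →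
      ∀ T : L2R →L[ℂ] L2R, IsIntegralOperator (halfKernel W v U) T → ∀ f : L2R,
        ⟪gaussianL2 α hα, f⟫_ℂ = 0 →
        ‖T f‖ ^ 2 ≤ Real.pi / (2 * W ^ 2) * (1 - 3 / 2 * (√(‖u‖ / 2) * v.re / W) +
          M * W ^ (-6 / 5 : ℝ)) * ‖f‖ ^ 2 := by
  set q := √(r₁ / 2) with hq
  set p := √(r₀ / 2) with hp
  have hq0 : 0 < q := by rw [hq]; positivity
  have hp0 : 0 < p := by rw [hp]; positivity
  set D := (r₁ + C₃ + 2) * Real.exp (r₁ + C₃) with hD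
  have hD0 : 0 < D := by positivity
  have hlim0 : Filter.Tendsto (fun W : ℝ => W ^ (-2 / 5 : ℝ)) Filter.atTop (nhds 0) := by
    have := tendsto_rpow_neg_atTop (show (0 : ℝ) < 2 / 5 by norm_num)
    simpa [neg_div] using this
  have hlim1 : Filter.Tendsto (fun W : ℝ => W ^ (1 / 5 : ℝ)) Filter.atTop Filter.atTop :=
    tendsto_rpow_atTop (by norm_num)
  -- The four bounds on R give, in order: 2R ≤ 1, the Taylor bound on |x| ≤ 2R, 8C₃R³ ≤ 1, and R²/C
  -- ≤ 1.
  set η := min (min (1 / 2) (ρ₀ / 2)) (min (1 / (8 * C₃)) C) with hη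
  have hη0 : 0 < η := by positivity
  obtain ⟨W₀, hW₀⟩ := Filter.eventually_atTop.1
    (((hlim0.eventually (gt_mem_nhds hη0)).and
      (hlim1.eventually_ge_atTop (max 1 (3 * C * q)))).and
      (Filter.eventually_ge_atTop (max 1 q)))
  refine ⟨2 * q ^ 2 + 16 * C₃ + 128 * D ^ 2 / p + 2, max 1 W₀, by positivity, le_max_left _ _, ?_⟩
  intro v u U W α hα hv1 hv hu0 hu1 hure hUc hlow hT hW hαW T hTop f hf
  obtain ⟨⟨hRη, hWR⟩, hWq⟩ := hW₀ W ((le_max_right _ _).trans hW)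
  set R := W ^ (-2 / 5 : ℝ) with hR
  have hW1 : 1 ≤ W := (le_max_left _ _).trans hWq
  have hWq : q ≤ W := (le_max_right _ _).trans hWq
  have hW0 : 0 < W := by linarith
  have hR0 : 0 < R := Real.rpow_pos_of_pos hW0 _
  have hRhalf : 2 * R ≤ 1 := by
    have : η ≤ 1 / 2 := (min_le_left _ _).trans (min_le_left _ _)
    linarith
  have hRρ : 2 * R ≤ ρ₀ := by
    have : η ≤ ρ₀ / 2 := (min_le_left _ _).trans (min_le_right _ _)
    linarith
  have hRC₃ : 8 * C₃ * R ≤ 1 := by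
    have h1 : R ≤ 1 / (8 * C₃) := hRη.le.trans ((min_le_right _ _).trans (min_le_left _ _))
    rwa [le_div_iff₀ (by positivity), mul_comm] at h1
  have hRC : R ≤ C := hRη.le.trans ((min_le_right _ _).trans (min_le_right _ _))
  have hRle : R ≤ 1 := by linarith
  have hR5 : R ^ 5 * W ^ 2 = 1 := by
    rw [hR, ← Real.rpow_natCast, ← Real.rpow_mul hW0.le, ← Real.rpow_natCast W 2,
      ← Real.rpow_add hW0]
    norm_num
  have hR3 : W ^ (-6 / 5 : ℝ) = R ^ 3 := by
    rw [hR, ← Real.rpow_natCast, ← Real.rpow_mul hW0.le]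
    norm_num
  have hWR2 : W * R ^ 2 = W ^ (1 / 5 : ℝ) := by
    rw [hR, ← Real.rpow_natCast, ← Real.rpow_mul hW0.le]
    nth_rewrite 1 [← Real.rpow_one W]
    rw [← Real.rpow_add hW0]
    norm_num
  rw [← hWR2] at hWR
  have hWR1 : 1 ≤ W * R ^ 2 := (le_max_left _ _).trans hWR
  have hWRC : 3 * C * q ≤ W * R ^ 2 := (le_max_right _ _).trans hWR
  have hκ : 0 < v.re := hκ₀.trans_le hv
  have hκ1 : v.re ≤ 1 := (Complex.re_le_norm v).trans hv1.le
  set a := W ^ 2 / v.re with ha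
  have ha0 : 0 < a := by positivity
  set t := √(‖u‖ / 2) * v.re / W with ht
  have hsq : √(‖u‖ / 2) ≤ q := Real.sqrt_le_sqrt (by linarith)
  have hsp : p ≤ √(‖u‖ / 2) := Real.sqrt_le_sqrt (by linarith)
  have hs2 : √(‖u‖ / 2) ^ 2 = ‖u‖ / 2 := Real.sq_sqrt (by positivity)
  have htα : α / a = t := by
    rw [hαW, ha, ht]
    field_simp
  have ht0 : 0 ≤ t := by positivity
  have htq : t ≤ q / W := by
    rw [ht]
    gcongr
    nlinarith
  have ht1 : t ≤ 1 := htq.trans ((div_le_one hW0).2 hWq)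
  -- An equality, by Re u = |u| Re v: the real comparison form selects the same α as the complex
  -- saddle.
  have hαu : α ^ 2 / a ≤ u.re / 2 := by
    rw [hαW, ha, hure, mul_pow, hs2]
    apply le_of_eq
    field_simp
  have hρ0 := mehlerRho_pos ha0 hα
  have hρt : mehlerRho a α ≤ 1 / (1 + t) := by rw [← htα]; exact mehlerRho_le ha0 hα
  have hρ1 := mehlerRho_lt_one ha0 hα
  have h1ρ : 1 - mehlerRho a α ≤ 2 * t := by rw [← htα]; exact one_sub_mehlerRho_le ha0 hα
  set ρ := mehlerRho a α with hρ
  set X := 1 - 3 / 2 * t + 2 * t ^ 2 + 16 * C₃ * R ^ 3 with hX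
  have hX₀ : √ρ * ρ * Real.exp (8 * C₃ * R ^ 3) ≤ X :=
    mehler_inner_coefficient_le hρ0 hρ1 ht0 ht1 hρt hC₃ hR0 hRle hRC₃
  have hX₁ : Real.exp (-(R ^ 2 / C)) ≤ X :=
    outer_coefficient_le htq hC₃ hC hR0 hRle hRC hW0 hWRC
  obtain ⟨φ, hφ⟩ := exists_mul_L2 (c := fun x => Complex.exp (-(U x / 2))) (by fun_prop)
    (norm_exp_neg_half_le fun x => le_trans (by positivity) (hlow x)) f
  have hU : ∀ x, 0 ≤ (U x).re := fun x => le_trans (by positivity) (hlow x)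
  obtain ⟨G, hG, -⟩ := (schurKernel_gaussKernel ha0).exists_isIntegralOperator
  have hform := re_inner_gaussKernel_le ha0 hα hR0 hRhalf hC hC₃.le hUc hlow hαu hu1
    (fun x hx => hT x (hx.trans hRρ)) hX₀ hX₁ hG hf hφ
  rw [norm_sq_halfKernel_apply hW0 hv1 hκ hUc hU hTop hG hφ]
  have hconst : √(Real.pi / (4 * W ^ 2 * v.re)) * √(Real.pi / a) = Real.pi / (2 * W ^ 2) := by
    rw [← Real.sqrt_mul (by positivity), ha,
      show Real.pi / (4 * W ^ 2 * v.re) * (Real.pi / (W ^ 2 / v.re)) =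
        (Real.pi / (2 * W ^ 2)) ^ 2 by field_simp; norm_num]
    exact Real.sqrt_sq (by positivity)
  have hfin : X + √ρ * (1 - ρ) * (8 * D / (α * R ^ 2)) ^ 2 +
      (Real.pi / (2 * R)) ^ 2 / (2 * a) * √2 ≤
      1 - 3 / 2 * t + (2 * q ^ 2 + 16 * C₃ + 128 * D ^ 2 / p + 2) * W ^ (-6 / 5 : ℝ) := by
    rw [hR3]
    exact total_coefficient_le hκ hκ1 ha htα ht0 htq hρ1 h1ρ hp0 hD0 hα
      (by rw [hαW, mul_comm]; gcongr) hR0 hRle hW0 hR5 hWR1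
  calc _ ≤ √(Real.pi / (4 * W ^ 2 * v.re)) * (√(Real.pi / a) * (X + √ρ * (1 - ρ) *
        (8 * D / (α * R ^ 2)) ^ 2 + (Real.pi / (2 * R)) ^ 2 / (2 * a) * √2) * ‖f‖ ^ 2) := by
        gcongr
    _ = Real.pi / (2 * W ^ 2) * (X + √ρ * (1 - ρ) *
        (8 * D / (α * R ^ 2)) ^ 2 + (Real.pi / (2 * R)) ^ 2 / (2 * a) * √2) * ‖f‖ ^ 2 := by
        rw [← hconst]
        ring
    _ ≤ _ := by gcongr

/-! ### Factorization of the transfer operator -/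

/-- The transfer kernel as a function of `v = ζ²`. -/
noncomputable def saddleKernel (W : ℝ) (v : ℂ) (U : ℝ → ℂ) (x y : ℝ) : ℂ :=
  Complex.exp (-((W : ℂ) ^ 2 * v * ((x : ℂ) - (y : ℂ)) ^ 2) - U x / 2 - U y / 2)

theorem conj_saddleKernel (W : ℝ) (v : ℂ) (U : ℝ → ℂ) (x y : ℝ) :
    conj (saddleKernel W v U y x) = saddleKernel W (conj v) (fun x => conj (U x)) x y := by
  unfold saddleKernel
  rw [← Complex.exp_conj]
  congr 1
  simp only [map_sub, map_neg, map_mul, map_pow, map_div₀, Complex.conj_ofReal, map_ofNat]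
  ring

theorem schurKernel_saddleKernel {W : ℝ} {v : ℂ} {U : ℝ → ℂ} (hW : 0 < W) (hv : 0 < v.re)
    (hUc : Continuous U) (hU : ∀ x, 0 ≤ (U x).re) :
    SchurKernel (saddleKernel W v U) (1 * √(Real.pi / (W ^ 2 * v.re))) := by
  refine SchurKernel.of_gaussian_bound ?_ zero_le_one (by positivity) fun x y => ?_
  · refine Continuous.measurable ?_
    unfold saddleKernel Function.uncurry
    fun_prop
  · have e : ((W : ℂ) ^ 2 * v * ((x : ℂ) - y) ^ 2) = ((W ^ 2 * (x - y) ^ 2 : ℝ) : ℂ) * v := by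
      push_cast; ring
    have e2 : ∀ z : ℂ, (z / 2).re = z.re / 2 := fun z => by simp
    rw [saddleKernel, e, Complex.norm_exp, one_mul, Real.exp_le_exp, Complex.sub_re,
      Complex.sub_re, Complex.neg_re, Complex.re_ofReal_mul, e2, e2]
    linarith [hU x, hU y]

/-- Two Gaussians with parameter 2W²v convolve to one with W²v. Conjugated data in T' are undone by
the adjoint, so this is a transpose factorization rather than T*T. -/
theorem adjoint_halfKernel_mul {W : ℝ} {v : ℂ} {U : ℝ → ℂ} (hW : 0 < W) (hv : 0 < v.re)
    (hUc : Continuous U) (hU : ∀ x, 0 ≤ (U x).re) {K T T' : L2R →L[ℂ] L2R}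
    (hK : IsIntegralOperator (saddleKernel W v U) K)
    (hT : IsIntegralOperator (halfKernel W v U) T)
    (hT' : IsIntegralOperator (halfKernel W (conj v) fun x => conj (U x)) T') :
    ContinuousLinearMap.adjoint T' * T =
      ((Real.pi / (4 * (W : ℂ) ^ 2 * v)) ^ (1 / 2 : ℂ)) • K := by
  have hS := schurKernel_halfKernel hW hv hUc hU
  have hS' := schurKernel_halfKernel (v := conj v) (U := fun x => conj (U x)) hW
    (by rwa [Complex.conj_re]) (by fun_prop) (fun x => by rw [Complex.conj_re]; exact hU x)
  have hv0 : v ≠ 0 := fun h => by simp [h] at hv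
  have hWne : (W : ℂ) ≠ 0 := by exact_mod_cast hW.ne'
  refine IsIntegralOperator.unique ((hT'.adjoint hS').comp hT hS'.adjoint hS fun x y => ?_)
    (hK.const_smul _)
  have key : ∀ z : ℝ, conj (halfKernel W (conj v) (fun x => conj (U x)) z x) *
      halfKernel W v U z y = Complex.exp (-(4 * (W : ℂ) ^ 2 * v) * z ^ 2 +
        (4 * (W : ℂ) ^ 2 * v * (x + y)) * z +
        (-(2 * (W : ℂ) ^ 2 * v * (x ^ 2 + y ^ 2)) - U x / 2 - U y / 2)) := by
    intro z
    unfold halfKernel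
    rw [map_mul, ← Complex.exp_conj, ← Complex.exp_conj, ← Complex.exp_add, ← Complex.exp_add,
      ← Complex.exp_add]
    congr 1
    simp only [map_sub, map_neg, map_mul, map_pow, map_div₀, Complex.conj_ofReal, map_ofNat,
      Complex.conj_conj]
    ring
  simp only [key]
  rw [integral_cexp_quadratic, neg_neg]
  · unfold saddleKernel
    congr 2
    field_simp
    ring
  · have : (-(4 * (W : ℂ) ^ 2 * v)).re = -(4 * W ^ 2 * v.re) := by
      rw [show 4 * (W : ℂ) ^ 2 * v = ((4 * W ^ 2 : ℝ) : ℂ) * v by push_cast; ring,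
        Complex.neg_re, Complex.re_ofReal_mul]
    rw [this]
    have : 0 < 4 * W ^ 2 * v.re := by positivity
    linarith

/-- Sesquilinear bound for the transfer operator from quadratic bounds on its half-kernels. -/
theorem norm_inner_saddleKernel_le {W Λ : ℝ} {v : ℂ} {U : ℝ → ℂ} (hW : 0 < W) (hv1 : ‖v‖ = 1)
    (hv : 0 < v.re) (hUc : Continuous U) (hU : ∀ x, 0 ≤ (U x).re) (hΛ : 0 ≤ Λ)
    {K T T' : L2R →L[ℂ] L2R} (hK : IsIntegralOperator (saddleKernel W v U) K)
    (hT : IsIntegralOperator (halfKernel W v U) T)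
    (hT' : IsIntegralOperator (halfKernel W (conj v) fun x => conj (U x)) T') {f h : L2R}
    (hf : ‖T f‖ ^ 2 ≤ Real.pi / (2 * W ^ 2) * Λ * ‖f‖ ^ 2)
    (hh : ‖T' h‖ ^ 2 ≤ Real.pi / (2 * W ^ 2) * Λ * ‖h‖ ^ 2) :
    ‖⟪h, K f⟫_ℂ‖ ≤ √Real.pi / W * Λ * (‖h‖ * ‖f‖) := by
  set s : ℂ := (Real.pi / (4 * (W : ℂ) ^ 2 * v)) ^ (1 / 2 : ℂ) with hs
  have hpi := Real.pi_pos
  have hsn : ‖s‖ = √Real.pi / (2 * W) := by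
    have h1 : ‖s‖ ^ 2 = (√Real.pi / (2 * W)) ^ 2 := by
      rw [hs, norm_cpow_half_sq, norm_div, norm_mul, norm_mul, norm_pow, hv1, Complex.norm_real,
        Complex.norm_real, Real.norm_of_nonneg hpi.le, Real.norm_of_nonneg hW.le, div_pow,
        Real.sq_sqrt hpi.le, Complex.norm_ofNat]
      ring
    exact (pow_left_inj₀ (norm_nonneg _) (by positivity) two_ne_zero).1 h1
  have hmul := adjoint_halfKernel_mul hW hv hUc hU hK hT hT'
  have h1 : s * ⟪h, K f⟫_ℂ = ⟪T' h, T f⟫_ℂ := by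
    rw [← inner_smul_right, ← smul_apply, ← hmul, mul_apply_eq_comp,
      ContinuousLinearMap.adjoint_inner_right]
  have h2 : ‖T' h‖ * ‖T f‖ ≤ Real.pi / (2 * W ^ 2) * Λ * (‖h‖ * ‖f‖) := by
    refine le_of_sq_le_sq ?_ (by positivity)
    calc (‖T' h‖ * ‖T f‖) ^ 2 = ‖T' h‖ ^ 2 * ‖T f‖ ^ 2 := by ring
      _ ≤ (Real.pi / (2 * W ^ 2) * Λ * ‖h‖ ^ 2) * (Real.pi / (2 * W ^ 2) * Λ * ‖f‖ ^ 2) := by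
        gcongr
      _ = _ := by ring
  have h3 : ‖s‖ * ‖⟪h, K f⟫_ℂ‖ ≤ Real.pi / (2 * W ^ 2) * Λ * (‖h‖ * ‖f‖) := by
    rw [← norm_mul, h1]
    exact (norm_inner_le_norm _ _).trans h2
  have hspos : 0 < √Real.pi / (2 * W) := by positivity
  rw [hsn] at h3
  refine le_of_mul_le_mul_left (h3.trans (le_of_eq ?_)) hspos
  have h4 : √Real.pi * √Real.pi = Real.pi := Real.mul_self_sqrt hpi.le
  nth_rewrite 1 [← h4]
  field_simp

/-! ### Block norms from vectors and sesquilinear forms -/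

section Blocks

variable {g : L2R}

theorem one_sub_perpProj (hg : ‖g‖ = 1) : 1 - perpProj g = InnerProductSpace.rankOne ℂ g g := by
  ext1 f
  rw [perpProj, Submodule.starProjection_orthogonal', sub_sub_cancel,
    Submodule.starProjection_unit_singleton ℂ hg, InnerProductSpace.rankOne_apply]

theorem perpProj_apply_self : perpProj g g = 0 := by
  rw [perpProj, Submodule.starProjection_apply_eq_zero_iff, Submodule.orthogonal_orthogonal]
  exact Submodule.mem_span_singleton_self g

theorem inner_perpProj (f : L2R) : ⟪g, perpProj g f⟫_ℂ = 0 :=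
  Submodule.mem_orthogonal_singleton_iff_inner_right.1 (Submodule.starProjection_apply_mem _ f)

theorem norm_perpProj_le (f : L2R) : ‖perpProj g f‖ ≤ ‖f‖ :=
  Submodule.norm_starProjection_apply_le _ f

theorem norm_one_sub_perpProj_le (hg : ‖g‖ = 1) (f : L2R) : ‖(1 - perpProj g) f‖ ≤ ‖f‖ := by
  rw [one_sub_perpProj hg, InnerProductSpace.rankOne_apply, norm_smul, hg, mul_one]
  simpa [hg] using norm_inner_le_norm (𝕜 := ℂ) g f

theorem norm_blockA_sub_le {T : L2R →L[ℂ] L2R} {ε : ℝ} (hg : ‖g‖ = 1) (hε : ‖T g - g‖ ≤ ε) :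
    ‖blockA g T - (1 - perpProj g)‖ ≤ ε := by
  refine ContinuousLinearMap.opNorm_le_bound _ ((norm_nonneg _).trans hε) fun f => ?_
  have e1 : (1 - perpProj g) f = ⟪g, f⟫_ℂ • g := by
    rw [one_sub_perpProj hg, InnerProductSpace.rankOne_apply]
  have e2 : (1 - perpProj g) g = g := by
    rw [sub_apply, perpProj_apply_self, sub_zero, one_apply_eq_self]
  have e3 : (blockA g T - (1 - perpProj g)) f =
      ⟪g, f⟫_ℂ • (1 - perpProj g) (T g - g) := by
    rw [sub_apply, blockA, mul_apply_eq_comp, mul_apply_eq_comp, e1, map_smul, map_smul,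
      map_sub, e2, smul_sub]
  rw [e3, norm_smul, mul_comm]
  refine mul_le_mul ((norm_one_sub_perpProj_le hg _).trans hε) ?_ (norm_nonneg _)
    ((norm_nonneg _).trans hε)
  simpa [hg] using norm_inner_le_norm (𝕜 := ℂ) g f

theorem norm_blockC_le {T : L2R →L[ℂ] L2R} {ε : ℝ} (hg : ‖g‖ = 1) (hε : ‖T g - g‖ ≤ ε) :
    ‖blockC g T‖ ≤ ε := by
  refine ContinuousLinearMap.opNorm_le_bound _ ((norm_nonneg _).trans hε) fun f => ?_
  have e3 : blockC g T f = ⟪g, f⟫_ℂ • perpProj g (T g - g) := by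
    rw [blockC, mul_apply_eq_comp, mul_apply_eq_comp, one_sub_perpProj hg,
      InnerProductSpace.rankOne_apply, map_smul, map_smul, map_sub, perpProj_apply_self, sub_zero]
  rw [e3, norm_smul, mul_comm]
  refine mul_le_mul ((norm_perpProj_le _).trans hε) ?_ (norm_nonneg _)
    ((norm_nonneg _).trans hε)
  simpa [hg] using norm_inner_le_norm (𝕜 := ℂ) g f

/-- The row functional ⟨g, T ·⟩ on the complement is represented by T*g, from which g may be
subtracted freely. -/
theorem norm_blockB_le {T : L2R →L[ℂ] L2R} {ε : ℝ} (hg : ‖g‖ = 1)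
    (hε : ‖ContinuousLinearMap.adjoint T g - g‖ ≤ ε) : ‖blockB g T‖ ≤ ε := by
  refine ContinuousLinearMap.opNorm_le_bound _ ((norm_nonneg _).trans hε) fun f => ?_
  rw [blockB, mul_apply_eq_comp, mul_apply_eq_comp, one_sub_perpProj hg,
    InnerProductSpace.rankOne_apply, norm_smul, hg, mul_one]
  have e : ⟪g, T (perpProj g f)⟫_ℂ = ⟪ContinuousLinearMap.adjoint T g - g, perpProj g f⟫_ℂ := by
    rw [inner_sub_left, inner_perpProj, sub_zero, ContinuousLinearMap.adjoint_inner_left]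
  rw [e]
  refine (norm_inner_le_norm _ _).trans ?_
  exact mul_le_mul hε (norm_perpProj_le f) (norm_nonneg _) ((norm_nonneg _).trans hε)

theorem norm_blockD_le {T : L2R →L[ℂ] L2R} {B : ℝ} (hB : 0 ≤ B)
    (h : ∀ f h : L2R, ⟪g, f⟫_ℂ = 0 → ⟪g, h⟫_ℂ = 0 → ‖⟪h, T f⟫_ℂ‖ ≤ B * (‖h‖ * ‖f‖)) :
    ‖blockD g T‖ ≤ B := by
  refine ContinuousLinearMap.opNorm_le_bound _ hB fun f => ?_
  rw [blockD, mul_apply_eq_comp, mul_apply_eq_comp]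
  set y := perpProj g (T (perpProj g f)) with hy
  have h1 : ⟪y, y⟫_ℂ = ⟪y, T (perpProj g f)⟫_ℂ := by
    have h2 : perpProj g y = y := by
      rw [hy]
      exact Submodule.starProjection_eq_self_iff.2 (Submodule.starProjection_apply_mem _ _)
    nth_rewrite 2 [hy]
    rw [perpProj, ← Submodule.inner_starProjection_left_eq_right, ← perpProj, h2]
  have h3 : ‖y‖ * ‖y‖ ≤ B * ‖f‖ * ‖y‖ := by
    have h4 : ‖⟪y, y⟫_ℂ‖ = ‖y‖ * ‖y‖ := by
      rw [inner_self_eq_norm_sq_to_K, norm_pow, sq]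
      simp
    rw [← h4, h1]
    refine (h _ _ (inner_perpProj f) (inner_perpProj _)).trans ?_
    have := norm_perpProj_le (g := g) f
    calc B * (‖y‖ * ‖perpProj g f‖) ≤ B * (‖y‖ * ‖f‖) := by gcongr
      _ = _ := by ring
  rcases (norm_nonneg y).eq_or_lt with h5 | h5
  · rw [← h5]
    positivity
  · exact le_of_mul_le_mul_right h3 h5

end Blocks

/-! ### Powers of W and the normalization μ -/

theorem one_div_mul_sqrt_le {p W α : ℝ} (hp : 0 < p) (hW : 1 ≤ W) (h : p * W ≤ α) :
    1 / (α * √α) ≤ 1 / (p * √p) * W ^ (-6 / 5 : ℝ) := by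
  have hW0 : 0 < W := by linarith
  have hα : 0 ≤ α := le_trans (by positivity) h
  have h1 : p * √p * W ^ (6 / 5 : ℝ) ≤ α * √α := by
    have e1 : W ^ (6 / 5 : ℝ) ≤ W * √W := by
      rw [Real.sqrt_eq_rpow]
      nth_rewrite 2 [← Real.rpow_one W]
      rw [← Real.rpow_add hW0]
      exact Real.rpow_le_rpow_of_exponent_le hW (by norm_num)
    calc p * √p * W ^ (6 / 5 : ℝ) ≤ p * √p * (W * √W) := by gcongr
      _ = (p * W) * √(p * W) := by rw [Real.sqrt_mul hp.le]; ring
      _ ≤ α * √α := by gcongr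
  have e2 : W ^ (-6 / 5 : ℝ) = 1 / W ^ (6 / 5 : ℝ) := by
    rw [neg_div, Real.rpow_neg hW0.le, one_div]
  rw [e2, one_div_mul_one_div]
  gcongr

theorem one_div_sq_le {W : ℝ} (hW : 1 ≤ W) : 1 / W ^ 2 ≤ W ^ (-6 / 5 : ℝ) := by
  have hW0 : 0 < W := by linarith
  rw [one_div, ← Real.rpow_natCast, ← Real.rpow_neg hW0.le]
  exact Real.rpow_le_rpow_of_exponent_le hW (by norm_num)

/-- The normalization constant `‖μ‖⁻¹ √π / W` to second order. -/
theorem norm_saddleMu_inv_mul_le {v : ℂ} {W α : ℝ} (hW : 0 < W) (hv1 : ‖v‖ = 1) (hv : 0 < v.re)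
    (hα : 0 < α) :
    ‖(Real.pi / ((W : ℂ) ^ 2 * v + α)) ^ (1 / 2 : ℂ)‖⁻¹ * (√Real.pi / W) ≤
      1 + α / W ^ 2 * v.re / 2 + (α / W ^ 2) ^ 2 / 4 := by
  set τ := α / W ^ 2 with hτ
  have hτ0 : 0 < τ := by positivity
  have hpi := Real.pi_pos
  have hWne : (W : ℂ) ≠ 0 := by exact_mod_cast hW.ne'
  have e : (W : ℂ) ^ 2 * v + α = ((W ^ 2 : ℝ) : ℂ) * (v + τ) := by
    rw [hτ]
    push_cast
    field_simp
  have hn : ‖v + τ‖ ^ 2 = 1 + 2 * (τ * v.re) + τ ^ 2 := by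
    have h1 : v.re ^ 2 + v.im ^ 2 = 1 := by
      have := Complex.normSq_eq_norm_sq v
      rw [hv1, Complex.normSq_apply] at this
      linarith
    rw [← Complex.normSq_eq_norm_sq, Complex.normSq_apply]
    simp only [Complex.add_re, Complex.add_im, Complex.ofReal_re, Complex.ofReal_im]
    linear_combination h1
  set z := 1 + τ * v.re / 2 + τ ^ 2 / 4 with hz
  have hz1 : 0 ≤ τ * v.re / 2 + τ ^ 2 / 4 := by positivity
  have hz0 : 0 ≤ z := by linarith
  -- The quantity to bound is |v + τ|^(1/2), and |v + τ|² = 1 + 2τ Re v + τ² is at most z⁴ by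
  -- Bernoulli's inequality.
  have hb : ‖v + τ‖ ≤ z ^ 2 := by
    refine le_of_sq_le_sq ?_ (by positivity)
    rw [hn]
    have : 1 + 4 * (τ * v.re / 2 + τ ^ 2 / 4) ≤ (z ^ 2) ^ 2 := by
      have h1 : z = 1 + (τ * v.re / 2 + τ ^ 2 / 4) := by rw [hz]; ring
      rw [h1]
      generalize τ * v.re / 2 + τ ^ 2 / 4 = w at hz1
      nlinarith [sq_nonneg (w ^ 2), sq_nonneg w, mul_nonneg hz1 (sq_nonneg w)]
    linarith
  have hne : 0 < ‖v + τ‖ := by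
    rw [norm_pos_iff]
    intro h0
    have := congrArg Complex.re h0
    simp at this
    linarith
  refine le_of_sq_le_sq (le_trans (le_of_eq ?_) hb) hz0
  rw [mul_pow, inv_pow, norm_cpow_half_sq, e, norm_div, norm_mul, Complex.norm_real,
    Complex.norm_real, Real.norm_of_nonneg hpi.le, Real.norm_of_nonneg (sq_nonneg W), div_pow,
    Real.sq_sqrt hpi.le]
  field_simp

/-- The radicand has positive real part, away from the branch cut, so the principal root commutes
with conjugation. -/
theorem saddleMu_conj {v : ℂ} {W α : ℝ} (hW : 0 < W) (hv : 0 < v.re) (hα : 0 < α) :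
    (Real.pi / ((W : ℂ) ^ 2 * conj v + α)) ^ (1 / 2 : ℂ) =
      conj ((Real.pi / ((W : ℂ) ^ 2 * v + α)) ^ (1 / 2 : ℂ)) := by
  have hre : 0 < (Real.pi / ((W : ℂ) ^ 2 * v + α)).re := by
    have h1 : 0 < ((W : ℂ) ^ 2 * v + α).re := by
      rw [Complex.add_re, ← Complex.ofReal_pow, Complex.re_ofReal_mul, Complex.ofReal_re]
      positivity
    have h2 : 0 < Complex.normSq ((W : ℂ) ^ 2 * v + α) :=
      Complex.normSq_pos.2 fun h => by simp [h] at h1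
    have := Real.pi_pos
    rw [Complex.div_re]
    simp only [Complex.ofReal_re, Complex.ofReal_im, zero_mul, zero_div, add_zero]
    positivity
  have harg : (Real.pi / ((W : ℂ) ^ 2 * v + α)).arg ≠ Real.pi := by
    intro h
    have h1 := Complex.abs_arg_le_pi_div_two_iff.2 hre.le
    rw [h, abs_of_pos Real.pi_pos] at h1
    linarith [Real.pi_pos]
  have h := Complex.conj_cpow _ (1 / 2 : ℂ) harg
  have e1 : conj (1 / 2 : ℂ) = 1 / 2 := by rw [map_div₀, map_one, map_ofNat]
  rw [e1] at h
  rw [← h]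
  simp

/-! ### Uniform estimates and conclusion -/

/-- Quantitative form of the local hypotheses on a potential `U` with `U(x) ≈ u x² / 2` at the
origin, for the direction `v = ζ²` in the kernel. -/
structure QuadraticSaddle (κ₀ r₀ r₁ ρ₀ C₃ C : ℝ) (v u : ℂ) (U : ℝ → ℂ) : Prop where
  norm_dir : ‖v‖ = 1
  le_re : κ₀ ≤ v.re
  le_norm : r₀ ≤ ‖u‖
  norm_le : ‖u‖ ≤ r₁
  eq_conj : u = ‖u‖ * conj v
  continuous : Continuous U
  lower : ∀ x : ℝ, 1 / C * min 1 (|x| ^ 2) ≤ (U x).re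
  taylor : ∀ x : ℝ, |x| ≤ ρ₀ → ‖U x - u / 2 * x ^ 2‖ ≤ C₃ * |x| ^ 3

namespace QuadraticSaddle

variable {κ₀ r₀ r₁ ρ₀ C₃ C : ℝ} {v u : ℂ} {U : ℝ → ℂ}

/-- The same constants survive conjugation, so a single estimate serves both K and its adjoint, and
both half-kernels. -/
theorem conjugate (h : QuadraticSaddle κ₀ r₀ r₁ ρ₀ C₃ C v u U) :
    QuadraticSaddle κ₀ r₀ r₁ ρ₀ C₃ C (conj v) (conj u) (fun x => conj (U x)) where
  norm_dir := by rw [RCLike.norm_conj, h.norm_dir]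
  le_re := by rw [Complex.conj_re]; exact h.le_re
  le_norm := by rw [RCLike.norm_conj]; exact h.le_norm
  norm_le := by rw [RCLike.norm_conj]; exact h.norm_le
  eq_conj := by
    conv_lhs => rw [h.eq_conj]
    rw [map_mul, Complex.conj_ofReal, RCLike.norm_conj]
  continuous := Complex.continuous_conj.comp h.continuous
  lower x := by rw [Complex.conj_re]; exact h.lower x
  taylor x hx := by
    refine le_trans (le_of_eq ?_) (h.taylor x hx)
    rw [← RCLike.norm_conj (U x - _)]
    simp only [map_sub, map_mul, map_div₀, map_pow, Complex.conj_ofReal, map_ofNat]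

theorem re_eq (h : QuadraticSaddle κ₀ r₀ r₁ ρ₀ C₃ C v u U) : u.re = ‖u‖ * v.re := by
  conv_lhs => rw [h.eq_conj]
  rw [Complex.re_ofReal_mul, Complex.conj_re]

theorem re_nonneg (h : QuadraticSaddle κ₀ r₀ r₁ ρ₀ C₃ C v u U) (hC : 0 < C) (x : ℝ) :
    0 ≤ (U x).re :=
  le_trans (by positivity) (h.lower x)

theorem sq_mul_mul (h : QuadraticSaddle κ₀ r₀ r₁ ρ₀ C₃ C v u U) {W α : ℝ}
    (hα : α = W * √(‖u‖ / 2)) : (W : ℂ) ^ 2 * v * u = 2 * (α : ℂ) ^ 2 := by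
  have hvv : v * (starRingEnd ℂ) v = 1 := by
    rw [Complex.mul_conj, Complex.normSq_eq_norm_sq, h.norm_dir]; simp
  have hα2 : (α : ℂ) ^ 2 = (W : ℂ) ^ 2 * (‖u‖ / 2) := by
    have : α ^ 2 = W ^ 2 * (‖u‖ / 2) := by rw [hα, mul_pow, Real.sq_sqrt (by positivity)]
    exact_mod_cast congrArg (fun x : ℝ => (x : ℂ)) this
  have e : v * u = ‖u‖ := by
    conv_lhs => rw [h.eq_conj]
    linear_combination (‖u‖ : ℂ) * hvv
  rw [hα2]
  linear_combination (W : ℂ) ^ 2 * e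

theorem le_alpha (h : QuadraticSaddle κ₀ r₀ r₁ ρ₀ C₃ C v u U) {W α : ℝ} (hW : 0 ≤ W)
    (hα : α = W * √(‖u‖ / 2)) : √(r₀ / 2) * W ≤ α := by
  rw [hα, mul_comm]
  have := h.le_norm
  gcongr

theorem alpha_le (h : QuadraticSaddle κ₀ r₀ r₁ ρ₀ C₃ C v u U) {W α : ℝ} (hW : 0 ≤ W)
    (hα : α = W * √(‖u‖ / 2)) : α ≤ √(r₁ / 2) * W := by
  rw [hα, mul_comm]
  have := h.norm_le
  gcongr

end QuadraticSaddle

theorem eigenfunction_error_le {W α p q κ₀ C₄ d : ℝ} (hW : 1 ≤ W) (hp : 0 < p) (hq : 0 < q)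
    (hκ₀ : 0 < κ₀) (hC₄ : 0 ≤ C₄) (hd : 0 ≤ d) (hpα : p * W ≤ α) (hαq : α ≤ q * W) :
    14 * C₄ * (√((W ^ 2 + α) / (W ^ 2 * κ₀)) + 2) / (α * √α) + 10 * (d / W ^ 2) ≤
      (14 * C₄ * (√((1 + q) / κ₀) + 2) * (1 / (p * √p)) + 10 * d) * W ^ (-6 / 5 : ℝ) := by
  have hα : 0 < α := lt_of_lt_of_le (by positivity) hpα
  have e1 : (W ^ 2 + α) / (W ^ 2 * κ₀) ≤ (1 + q) / κ₀ := by
    have h1 : α ≤ q * W ^ 2 := hαq.trans (by gcongr; nlinarith)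
    rw [← div_div]
    gcongr
    rw [div_le_iff₀ (by positivity)]
    linarith
  have e2 := one_div_mul_sqrt_le hp hW hpα
  have e3 := one_div_sq_le hW
  calc _ = 14 * C₄ * (√((W ^ 2 + α) / (W ^ 2 * κ₀)) + 2) * (1 / (α * √α)) +
        10 * d * (1 / W ^ 2) := by ring
    _ ≤ 14 * C₄ * (√((1 + q) / κ₀) + 2) * (1 / (p * √p) * W ^ (-6 / 5 : ℝ)) +
        10 * d * W ^ (-6 / 5 : ℝ) := by gcongr
    _ = _ := by ring

/-- `g_α` is an eigenfunction of `μ⁻¹ K` up to an error `O(W ^ (-6 / 5))`. -/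
theorem exists_eigenfunction_bound {κ₀ r₀ r₁ ρ₀ C₃ C : ℝ} (hκ₀ : 0 < κ₀) (hr₀ : 0 < r₀)
    (hr₁ : 0 < r₁) (hρ₀ : 0 < ρ₀) (hC₃ : 0 < C₃) (hC : 0 < C) :
    ∃ M W₀ : ℝ, 0 < M ∧ 1 ≤ W₀ ∧ ∀ (v u : ℂ) (U : ℝ → ℂ) (W α : ℝ) (hα : 0 < α),
      QuadraticSaddle κ₀ r₀ r₁ ρ₀ C₃ C v u U → W₀ ≤ W → α = W * √(‖u‖ / 2) →
      ∀ K : L2R →L[ℂ] L2R, IsIntegralOperator (saddleKernel W v U) K →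
        ‖((Real.pi / ((W : ℂ) ^ 2 * v + α)) ^ (1 / 2 : ℂ))⁻¹ • K (gaussianL2 α hα) -
          gaussianL2 α hα‖ ≤ M * W ^ (-6 / 5 : ℝ) := by
  have hq : 0 < √(r₁ / 2) := by positivity
  have hp : 0 < √(r₀ / 2) := by positivity
  have hd : 0 < r₁ / (4 * κ₀) + r₁ ^ 2 / (16 * κ₀) := by positivity
  have hdiv : 0 < (4 + r₁) / √(r₀ / 2) := by positivity
  refine ⟨14 * (C₃ + 2 / ρ₀ ^ 3) * (√((1 + √(r₁ / 2)) / κ₀) + 2) *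
    (1 / (√(r₀ / 2) * √(√(r₀ / 2)))) + 10 * (r₁ / (4 * κ₀) + r₁ ^ 2 / (16 * κ₀)),
    1 + (r₁ / (4 * κ₀) + r₁ ^ 2 / (16 * κ₀)) + (4 + r₁) / √(r₀ / 2), by positivity, by linarith, ?_⟩
  intro v u U W α hα h hWW hαW K hK
  have hW1 : 1 ≤ W := by linarith
  have hre : 0 < v.re := hκ₀.trans_le h.le_re
  have hure : 0 ≤ u.re := by rw [h.re_eq]; positivity
  have hpα := h.le_alpha (by linarith) hαW
  have hαr : 4 + r₁ ≤ α := by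
    have : (4 + r₁) / √(r₀ / 2) ≤ W := by linarith
    rw [div_le_iff₀ hp] at this
    linarith
  exact (norm_apply_gaussian_sub_le hα hW1 hκ₀ h.norm_dir h.le_re hure h.norm_le
    (h.sq_mul_mul hαW) h.continuous (h.re_nonneg hC) (by positivity)
    (norm_exp_sub_gaussian_le hρ₀ hC₃ (h.re_nonneg hC) hure h.taylor) (by linarith) hαr hK).trans
    (eigenfunction_error_le hW1 hp hq hκ₀ (by positivity) hd.le hpα (h.alpha_le (by linarith) hαW))

/-- The normalization returns t/2 of the 3t/2 gained from the gap; the product term -3t²/4 has the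
good sign. -/
theorem normalized_complement_le {t τ S D q : ℝ} (ht0 : 0 ≤ t) (ht1 : t ≤ 1 / 2) (hS : 0 ≤ S)
    (hD : 0 ≤ D) (hτ1 : τ ^ 2 ≤ 1) (hτ2 : τ ^ 2 ≤ q ^ 2 * S) :
    (1 + t / 2 + τ ^ 2 / 4) * (1 - 3 / 2 * t + D * S) ≤ 1 - t + (2 * D + q ^ 2) * S := by
  have a1 : 0 ≤ D * S := by positivity
  have a2 : (1 + t / 2 + τ ^ 2 / 4) * (D * S) ≤ 2 * (D * S) := by
    gcongr
    linarith
  have a3 : (1 + t / 2 + τ ^ 2 / 4) * (1 - 3 / 2 * t) ≤ 1 - t + τ ^ 2 / 4 := by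
    nlinarith [sq_nonneg t, sq_nonneg τ, mul_nonneg ht0 (sq_nonneg τ)]
  have a4 := sq_nonneg τ
  calc _ = (1 + t / 2 + τ ^ 2 / 4) * (1 - 3 / 2 * t) + (1 + t / 2 + τ ^ 2 / 4) * (D * S) := by ring
    _ ≤ 1 - t + τ ^ 2 / 4 + 2 * (D * S) := add_le_add a3 a2
    _ ≤ _ := by linarith

/-- On the orthogonal complement of `g_α` the operator `μ⁻¹ K` has norm at most
`1 - √(|u| / 2) Re v / W + O(W ^ (-6 / 5))`. -/
theorem exists_complement_bound {κ₀ r₀ r₁ ρ₀ C₃ C : ℝ} (hκ₀ : 0 < κ₀) (hr₀ : 0 < r₀)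
    (hr₁ : 0 < r₁) (hρ₀ : 0 < ρ₀) (hC₃ : 0 < C₃) (hC : 0 < C) :
    ∃ M W₀ : ℝ, 0 < M ∧ 1 ≤ W₀ ∧ ∀ (v u : ℂ) (U : ℝ → ℂ) (W α : ℝ) (hα : 0 < α),
      QuadraticSaddle κ₀ r₀ r₁ ρ₀ C₃ C v u U → W₀ ≤ W → α = W * √(‖u‖ / 2) →
      ∀ K : L2R →L[ℂ] L2R, IsIntegralOperator (saddleKernel W v U) K →
        ‖blockD (gaussianL2 α hα) (((Real.pi / ((W : ℂ) ^ 2 * v + α)) ^ (1 / 2 : ℂ))⁻¹ • K)‖ ≤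
          1 - √(‖u‖ / 2) * (v.re / W) + M * W ^ (-6 / 5 : ℝ) := by
  obtain ⟨MD, WD, hMD, hWD, hD⟩ := exists_halfKernel_bound hκ₀ hr₀ hr₁ hρ₀ hC₃ hC
  have hq : 0 < √(r₁ / 2) := by positivity
  refine ⟨2 * MD + √(r₁ / 2) ^ 2, WD + 2 * √(r₁ / 2), by positivity, by linarith, ?_⟩
  intro v u U W α hα h hWW hαW K hK
  have hW1 : 1 ≤ W := by linarith
  have hW : 0 < W := by linarith
  have hWD' : WD ≤ W := by linarith
  have hre : 0 < v.re := hκ₀.trans_le h.le_re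
  have hκ1 : v.re ≤ 1 := (Complex.re_le_norm v).trans h.norm_dir.le
  have hsq : √(‖u‖ / 2) ≤ √(r₁ / 2) := Real.sqrt_le_sqrt (by linarith [h.norm_le])
  have hαq := h.alpha_le hW.le hαW
  have hU := h.re_nonneg hC
  have h' := h.conjugate
  have hU' := h'.re_nonneg hC
  obtain ⟨T, hTo, -⟩ := (schurKernel_halfKernel hW hre h.continuous hU).exists_isIntegralOperator
  obtain ⟨T', hTo', -⟩ := (schurKernel_halfKernel hW (hκ₀.trans_le h'.le_re) h'.continuous
    hU').exists_isIntegralOperator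
  have hTb := hD v u U W α hα h.norm_dir h.le_re h.le_norm h.norm_le h.re_eq h.continuous h.lower
    h.taylor hWD' hαW T hTo
  have hTb' := hD _ _ _ W α hα h'.norm_dir h'.le_re h'.le_norm h'.norm_le h'.re_eq h'.continuous
    h'.lower h'.taylor hWD' (by rw [RCLike.norm_conj, hαW]) T' hTo'
  rw [RCLike.norm_conj, Complex.conj_re] at hTb'
  have e : √(‖u‖ / 2) * (v.re / W) = √(‖u‖ / 2) * v.re / W := by ring
  rw [e]
  have hτt : α / W ^ 2 * v.re / 2 = √(‖u‖ / 2) * v.re / W / 2 := by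
    rw [hαW]
    field_simp
  have hfac := norm_saddleMu_inv_mul_le hW h.norm_dir hre hα
  rw [hτt] at hfac
  have hτ2 : (α / W ^ 2) ^ 2 ≤ √(r₁ / 2) ^ 2 * W ^ (-6 / 5 : ℝ) := by
    calc (α / W ^ 2) ^ 2 ≤ (√(r₁ / 2) * W / W ^ 2) ^ 2 := by gcongr
      _ = √(r₁ / 2) ^ 2 * (1 / W ^ 2) := by field_simp
      _ ≤ _ := by gcongr; exact one_div_sq_le hW1
  have hτ1 : (α / W ^ 2) ^ 2 ≤ 1 := by
    refine pow_le_one₀ (by positivity) ?_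
    rw [div_le_one (by positivity)]
    nlinarith
  have ht0 : 0 ≤ √(‖u‖ / 2) * v.re / W := by positivity
  have ht1 : √(‖u‖ / 2) * v.re / W ≤ 1 / 2 := by
    rw [div_le_iff₀ hW]
    nlinarith [Real.sqrt_nonneg (‖u‖ / 2)]
  generalize √(‖u‖ / 2) * v.re / W = t at *
  have hS : 0 ≤ W ^ (-6 / 5 : ℝ) := by positivity
  generalize W ^ (-6 / 5 : ℝ) = S at *
  have hΛ0 : 0 ≤ 1 - 3 / 2 * t + MD * S := by
    have : 0 ≤ MD * S := by positivity
    linarith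
  generalize (Real.pi / ((W : ℂ) ^ 2 * v + α)) ^ (1 / 2 : ℂ) = μ at *
  have hDn : ‖blockD (gaussianL2 α hα) (μ⁻¹ • K)‖ ≤
      ‖μ‖⁻¹ * (√Real.pi / W * (1 - 3 / 2 * t + MD * S)) := by
    refine norm_blockD_le (by positivity) fun f k hf hk => ?_
    have := norm_inner_saddleKernel_le hW h.norm_dir hre h.continuous hU hΛ0 hK hTo hTo'
      (hTb f hf) (hTb' k hk)
    rw [smul_apply, inner_smul_right, norm_mul, norm_inv, mul_assoc]
    gcongr
  calc _ ≤ ‖μ‖⁻¹ * (√Real.pi / W) * (1 - 3 / 2 * t + MD * S) := hDn.trans (le_of_eq (by ring))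
    _ ≤ (1 + t / 2 + (α / W ^ 2) ^ 2 / 4) * (1 - 3 / 2 * t + MD * S) := by gcongr
    _ ≤ _ := normalized_complement_le ht0 ht1 hS hMD.le hτ1 hτ2

theorem mainTheorem1 :
    ∀ γ : ℝ, 1 < γ → ∃ δ : ℝ, 0 < δ ∧
      ∀ C c : ℝ, 0 < C → 0 < c → ∃ M W₀ : ℝ, 0 < M ∧ 0 < W₀ ∧
        ∀ (ζ : ℂ) (U : ℝ → ℂ), ‖ζ‖ = 1 → 0 < (ζ ^ 2).re →
          ∀ (hU : SaddlePotential ζ C c γ U) (W : ℝ) (hW : 0 < W), W₀ ≤ W →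
            ∃ K : L2R →L[ℂ] L2R, IsIntegralOperator (transferKernel W ζ U) K ∧
              let g : L2R := gaussianL2 (saddleAlpha W ζ U) (saddleAlpha_pos hW hU)
              let Khat : L2R →L[ℂ] L2R := (saddleMu W ζ U)⁻¹ • K
              ‖blockA g Khat - (1 - perpProj g)‖ ≤ M * W ^ (-1 - δ) ∧
              ‖blockB g Khat‖ ≤ M * W ^ (-1 - δ) ∧
              ‖blockC g Khat‖ ≤ M * W ^ (-1 - δ) ∧
              ‖blockD g Khat‖ ≤
                1 - Real.sqrt (‖iteratedDeriv 2 U 0‖ / 2) * ((ζ ^ 2).re / W)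
                  + M * W ^ (-1 - δ) := by
  intro γ _
  -- The exponent -6/5 is that of R³ for R = W^(-2/5).
  refine ⟨1 / 5, by norm_num, fun C c hC hc => ?_⟩
  rw [show (-1 - 1 / 5 : ℝ) = -6 / 5 by norm_num]
  obtain ⟨κ₀, r₀, r₁, ρ₀, C₃, hκ₀, hr₀, hr₁, hρ₀, hC₃, hloc⟩ :=
    SaddlePotential.exists_uniform_bounds hC hc
  obtain ⟨M₁, W₁, hM₁, hW₁, hE⟩ := exists_eigenfunction_bound hκ₀ hr₀ hr₁ hρ₀ hC₃ hC
  obtain ⟨M₂, W₂, hM₂, hW₂, hD⟩ := exists_complement_bound hκ₀ hr₀ hr₁ hρ₀ hC₃ hC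
  refine ⟨M₁ + M₂, max W₁ W₂, by positivity, by positivity, ?_⟩
  intro ζ U hζ hre hU W hW hWW
  obtain ⟨hκ, hr0, hr1, -, hconj, hζu, hT⟩ := hloc γ ζ U hζ hre hU
  have hQ : QuadraticSaddle κ₀ r₀ r₁ ρ₀ C₃ C (ζ ^ 2) (iteratedDeriv 2 U 0) U :=
    ⟨by rw [norm_pow, hζ, one_pow], hκ, hr0, hr1, hconj, hU.smooth.continuous, hU.lower, hT⟩
  have hαW : saddleAlpha W ζ U = W * √(‖iteratedDeriv 2 U 0‖ / 2) := by rw [saddleAlpha, hζu]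
  have hKS := schurKernel_saddleKernel hW hre hQ.continuous (hQ.re_nonneg hC)
  obtain ⟨K, hK, -⟩ := hKS.exists_isIntegralOperator
  refine ⟨K, hK, ?_⟩
  intro g Khat
  have hα := saddleAlpha_pos hW hU
  have hg : ‖g‖ = 1 := norm_gaussianL2 hα
  have hS : 0 ≤ W ^ (-6 / 5 : ℝ) := by positivity
  have hM₁' : M₁ * W ^ (-6 / 5 : ℝ) ≤ (M₁ + M₂) * W ^ (-6 / 5 : ℝ) := by gcongr; linarith
  have hM₂' : M₂ * W ^ (-6 / 5 : ℝ) ≤ (M₁ + M₂) * W ^ (-6 / 5 : ℝ) := by gcongr; linarith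
  have hKg : ‖Khat g - g‖ ≤ (M₁ + M₂) * W ^ (-6 / 5 : ℝ) :=
    (hE _ _ _ W _ hα hQ ((le_max_left _ _).trans hWW) hαW K hK).trans hM₁'
  -- The adjoint is the operator of the conjugated saddle with the conjugate of μ as normalization.
  -- Since α depends only on |u| and W, its approximate eigenvector is the same g.
  have hKg' : ‖ContinuousLinearMap.adjoint Khat g - g‖ ≤ (M₁ + M₂) * W ^ (-6 / 5 : ℝ) := by
    have hKadj : IsIntegralOperator (saddleKernel W (conj (ζ ^ 2)) fun x => conj (U x))
        (ContinuousLinearMap.adjoint K) := by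
      have h := hK.adjoint hKS
      simp only [conj_saddleKernel] at h
      exact h
    have h := hE _ _ _ W _ hα hQ.conjugate ((le_max_left _ _).trans hWW)
      (by rw [RCLike.norm_conj, hαW]) _ hKadj
    rw [saddleMu_conj hW hre hα] at h
    have e : ContinuousLinearMap.adjoint Khat =
        conj (saddleMu W ζ U)⁻¹ • ContinuousLinearMap.adjoint K := map_smulₛₗ _ _ _
    rw [e, smul_apply, map_inv₀]
    exact h.trans hM₁'
  refine ⟨norm_blockA_sub_le hg hKg, norm_blockB_le hg hKg', norm_blockC_le hg hKg, ?_⟩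
  refine (hD _ _ _ W _ hα hQ ((le_max_right _ _).trans hWW) hαW K hK).trans ?_
  gcongr
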